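/- An instance of \emph{quadratic huge $N$-fold integer programming} consists of $\bar\tau,r,s,t\in\mathbb N$ and, for each block type $i\in\{1,\dots,\bar\tau\}$, of matrices $E^i_1\in\mathbb Z^{r\times t}$ and $E^i_2\in\mathbb Z^{s\times t}$, bounds $l^i,u^i\in\mathbb Z^t$, a right hand side $b^i\in\mathbb Z^s$, a multiplicity $\mu^i\in\mathbb N$, and a convex separable quadratic function $f^i(x)=\sum_{j=1}^t(\alpha^i_jx_j^2+\beta^i_jx_j+\gamma^i_j)$ with $\alpha^i_j,\beta^i_j,\gamma^i_j\in\mathbb Q$ and $f^i(\mathbb Z^t)\subseteq\mathbb Z$, together with a vector $b^0\in\mathbb Z^r$. Let $N=\sum_i\mu^i$. The task is to minimize $f(x)$ subject to $E^{(N)}x=b$, $l\le x\le u$, $x\in\mathbb Z^{Nt}$, where $x$ consists of $N$ bricks in $\mathbb Z^t$, $\mu^i$ of them of type $i$; $E^{(N)}$ is the generalized $N$-fold matrix whose first $r$ rows contain side by side the matrices $E_1^i$ of all bricks and whose remaining rows contain the matrices $E_2^i$ of the bricks as a block diagonal; $b$ consists of $b^0$ followed by the vectors $b^i$ of the bricks;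 $l$ and $u$ consist of the vectors $l^i$ and $u^i$ of the bricks; and $f$ is the sum over the bricks of the functions $f^i$ of their types. All numbers are encoded in binary, rational numbers by numerator and denominator, and the data of each block type is written down only once, together with its multiplicity $\mu^i$. \textbf{Lemma.} The decision version of quadratic huge $N$-fold IP (given an instance and $k\in\mathbb Z$, is there a feasible $x$ with $f(x)\le k$?) belongs to $\mathsf{NP}$. Moreover, there is a polynomial $p$ such that every feasible instance $I$ has an optimal solution that uses at most $p(|I|)$ distinct configurations, where $|I|$ is the encoding length of $I$, and the configurations used by $x$ are the pairs (type of the brick, value of the brick in $\mathbb Z^t$) over all bricks of $x$. -/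

import Mathlib

/-! ### The complexity class NP -/

/-- The string `w # y`, over the alphabet `Γ` extended by a fresh separator `# = none`. -/
def pairString {Γ : Type} (w y : List Γ) : List (Option Γ) :=
  w.map some ++ none :: y.map some

/-- A language `L` is in NP: there are a polynomial `p` and a verifier `V`, computed on inputs `w # y`
by a (multi-stack) Turing machine in time polynomial in the length of its input, such that `w ∈ L`
iff `V` accepts `w` together with some certificate `y` of length at most `p(|w|)`. -/
def InNP {Γ : Type} (L : Language Γ) : Prop :=
  ∃ (p : Polynomial ℕ) (V : List Γ × List Γ → Bool),
    Nonempty (Turing.TM2ComputableInPolyTime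
      (fun q : List Γ × List Γ => pairString q.1 q.2) Computability.encodeBool V) ∧
    ∀ w : List Γ, w ∈ L ↔ ∃ y : List Γ, y.length ≤ p.eval w.length ∧ V (w, y) = true

/-! ### Quadratic huge `N`-fold integer programming -/

/-- The separable quadratic function `x ↦ ∑ j, (α j * x j ^ 2 + β j * x j + γ j)` on `ℝ^t`. -/
noncomputable def separableQuadratic {t : ℕ} (α β γ : Fin t → ℚ) (x : Fin t → ℝ) : ℝ :=
  ∑ j, ((α j : ℝ) * x j ^ 2 + (β j : ℝ) * x j + (γ j : ℝ))

/-- An instance of quadratic huge `N`-fold IP with `τ` types of blocks. -/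
structure QuadraticHugeNFoldIP where
  /-- number of block types -/
  τ : ℕ
  /-- number of linking rows -/
  r : ℕ
  /-- number of rows of a diagonal block -/
  s : ℕ
  /-- number of variables of a brick -/
  t : ℕ
  E₁ : Fin τ → Matrix (Fin r) (Fin t) ℤ
  E₂ : Fin τ → Matrix (Fin s) (Fin t) ℤ
  /-- lower bounds -/
  l : Fin τ → Fin t → ℤ
  /-- upper bounds -/
  u : Fin τ → Fin t → ℤ
  /-- right hand side of the linking rows -/
  b₀ : Fin r → ℤ
  /-- right hand sides of the diagonal blocks -/
  b : Fin τ → Fin s → ℤ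
  /-- quadratic coefficients of the objective functions -/
  α : Fin τ → Fin t → ℚ
  /-- linear coefficients of the objective functions -/
  β : Fin τ → Fin t → ℚ
  /-- constant coefficients of the objective functions -/
  γ : Fin τ → Fin t → ℚ
  /-- multiplicities of the block types -/
  μ : Fin τ → ℕ
  convex : ∀ i, ConvexOn ℝ Set.univ (separableQuadratic (α i) (β i) (γ i))
  integral : ∀ i, ∀ x : Fin t → ℤ,
    ∃ z : ℤ, separableQuadratic (α i) (β i) (γ i) (fun j => (x j : ℝ)) = (z : ℝ)

namespace QuadraticHugeNFoldIP

variable (I : QuadraticHugeNFoldIP)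

/-- The objective function `f^i` of the bricks of type `i`. -/
noncomputable def f (i : Fin I.τ) : (Fin I.t → ℝ) → ℝ :=
  separableQuadratic (I.α i) (I.β i) (I.γ i)

/-- The `N = ∑ i, μ i` bricks: `⟨i, m⟩` is the `m`-th brick of type `i`. -/
abbrev Brick : Type := (i : Fin I.τ) × Fin (I.μ i)

/-- The generalized `N`-fold matrix `E^(N)`: the first `r` rows contain the matrices `E₁` of all
bricks side by side, below them the matrices `E₂` of the bricks form a block diagonal. -/
def matrix : Matrix (Fin I.r ⊕ I.Brick × Fin I.s) (I.Brick × Fin I.t) ℤ :=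
  Matrix.of fun row col =>
    match row with
    | Sum.inl a => I.E₁ col.1.1 a col.2
    | Sum.inr (p, c) => if p = col.1 then I.E₂ col.1.1 c col.2 else 0

/-- The right hand side of the whole program. -/
def rhs : Fin I.r ⊕ I.Brick × Fin I.s → ℤ
  | Sum.inl a => I.b₀ a
  | Sum.inr (p, c) => I.b p.1 c

/-- `x ∈ ℤ^{Nt}` satisfies `E^(N) x = b` and `l ≤ x ≤ u`. -/
def IsFeasible (x : I.Brick × Fin I.t → ℤ) : Prop :=
  I.matrix.mulVec x = I.rhs ∧ ∀ p j, I.l p.1 j ≤ x (p, j) ∧ x (p, j) ≤ I.u p.1 j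

/-- The objective value of `x`, the sum of the objective values of its bricks. -/
noncomputable def objective (x : I.Brick × Fin I.t → ℤ) : ℝ :=
  ∑ p : I.Brick, I.f p.1 (fun j => (x (p, j) : ℝ))

/-- `x` is an optimal solution. -/
def IsOptimal (x : I.Brick × Fin I.t → ℤ) : Prop :=
  I.IsFeasible x ∧ ∀ z, I.IsFeasible z → I.objective x ≤ I.objective z

/-- The configurations, together with their types, that occur as bricks of `x`. -/
def usedConfigurations (x : I.Brick × Fin I.t → ℤ) : Set (Fin I.τ × (Fin I.t → ℤ)) :=
  Set.range fun p : I.Brick => (p.1, fun j => x (p, j))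

/-- Numerators and denominators of the entries of a rational vector. -/
def ratTokens {n : ℕ} (v : Fin n → ℚ) : List ℤ :=
  (List.ofFn v).flatMap fun q => [q.num, (q.den : ℤ)]

/-- The entries of a matrix, row by row. -/
def matrixTokens {m n : ℕ} (A : Matrix (Fin m) (Fin n) ℤ) : List ℤ :=
  (List.ofFn fun a => List.ofFn (A a)).flatten

/-- The data of block type `i` as a list of integers. -/
def typeTokens (i : Fin I.τ) : List ℤ :=
  matrixTokens (I.E₁ i) ++ matrixTokens (I.E₂ i) ++ List.ofFn (I.l i) ++ List.ofFn (I.u i) ++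
    List.ofFn (I.b i) ++ ratTokens (I.α i) ++ ratTokens (I.β i) ++ ratTokens (I.γ i) ++
    [(I.μ i : ℤ)]

/-- The instance as a list of integers: the dimensions, the right hand side of the linking rows,
and the data of each block type once (with its multiplicity). -/
def tokens : List ℤ :=
  [(I.τ : ℤ), (I.r : ℤ), (I.s : ℤ), (I.t : ℤ)] ++ List.ofFn I.b₀ ++
    (List.ofFn fun i => I.typeTokens i).flatten

end QuadraticHugeNFoldIP

/-- An integer as a string: its sign bit, the binary digits of its absolute value, and a comma. -/
def encodeInteger (z : ℤ) : List Computability.Γ' :=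
  Computability.Γ'.bit (decide (z < 0)) ::
    (Computability.encodeNat z.natAbs).map Computability.Γ'.bit ++ [Computability.Γ'.comma]

/-- The binary encoding of an instance. -/
def QuadraticHugeNFoldIP.encode (I : QuadraticHugeNFoldIP) : List Computability.Γ' :=
  I.tokens.flatMap encodeInteger

/-- The decision version of quadratic huge `N`-fold IP, as a language: the binary encodings of
pairs of an instance and an integer `k` such that the instance has a feasible solution of
objective value at most `k`. -/
def quadraticHugeNFoldIPLanguage : Language Computability.Γ' :=
  {w | ∃ (I : QuadraticHugeNFoldIP) (k : ℤ), w = encodeInteger k ++ I.encode ∧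
    ∃ x, I.IsFeasible x ∧ I.objective x ≤ (k : ℝ)}

/-! Few configurations. Up to the order of the bricks, a feasible vector is a multiset of
configurations with `μ i` members of type `i` (`exists_bricks`). The constraints on single bricks
hold configuration by configuration; everything else is a sum over the multiset of an integer vector
`φ c`: the indicators of the types, the contributions to the linking rows, and the objective value.
With `L` the encoding length, `φ` has at most `L` coordinates, each at most `2 ^ (4 * L + 2)` in
absolute value. Among `M = 8 * (L + 1) ^ 2` distinct configurations there are `2 ^ M` subsets but
fewer possible sums of `φ`, so two disjoint subsets `A`, `B`, not both empty, have equal sums.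
Exchanging as many copies of `A` for `B` as the multiset permits makes a member of `A` disappear and
changes no relevant sum. Iteration leaves fewer than `M` configurations
(`Multiset.exists_card_toFinset_lt`), and it starts from an optimal solution, which exists because
the bounds form a finite box.

Membership in NP. A certificate lists the instance and, for each type, the distinct configurations
with their multiplicities. By the first part this is short even if `N` is exponential
(`exists_small_certificate`). The verifier also has to be sure that the word encodes an instance. It
never parses the word: it encodes the certified instance again and compares (`eq_of_map_natVal_eq`).
Convexity means `0 ≤ α j`, and integrality means that all `α j + β j`, `α j - β j` and `∑ j, γ j`
are integers. These become integer identities once the certificate provides the integers, a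
denominator for the `γ j`, and Bézout coefficients showing that fractions are reduced. Conversely,
an accepted certificate yields a multiset of configurations, hence a solution
(`Accepts.mem_language`).

Polynomial time. Structured stack programs compile to multi-stack machines, and binary trees serve
as the universal data type. `PolyTime` is closed under composition, pairing, case distinction and
folds over lists whose intermediate values stay polynomially large (`PolyTime.foldl`). Binary
arithmetic, list operations and finally the acceptance predicate are built from these, and
`PolyTime.tm2ComputableInPolyTime` turns the result into a Turing machine. -/

open Turing StateTransition Computability

/-! ### Structured stack programs and their compilation to multi-stack Turing machines -/


/-- Structured programs acting on a family of stacks. -/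
inductive StackProgram {K : Type} (Γ : K → Type) : Type
  | skip : StackProgram Γ
  | push (k : K) (a : Γ k) : StackProgram Γ
  | pop (k : K) : StackProgram Γ
  | seq (c₁ c₂ : StackProgram Γ) : StackProgram Γ
  | cond (k : K) (p : Option (Γ k) → Bool) (c₁ c₂ : StackProgram Γ) : StackProgram Γ
  | loop (k : K) (p : Option (Γ k) → Bool) (c : StackProgram Γ) : StackProgram Γ

namespace StackProgram

variable {K : Type} {Γ : K → Type}

/-- The program points of a program. -/
def Label : StackProgram Γ → Type
  | skip => Unit
  | push _ _ => Unit
  | pop _ => Unit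
  | seq c₁ c₂ => c₁.Label ⊕ c₂.Label
  | cond _ _ c₁ c₂ => Option (c₁.Label ⊕ c₂.Label)
  | loop _ _ c => Option c.Label

noncomputable instance Label.fintype : (c : StackProgram Γ) → Fintype c.Label
  | skip => inferInstanceAs (Fintype Unit)
  | push _ _ => inferInstanceAs (Fintype Unit)
  | pop _ => inferInstanceAs (Fintype Unit)
  | seq c₁ c₂ =>
    haveI := Label.fintype c₁
    haveI := Label.fintype c₂
    inferInstanceAs (Fintype (c₁.Label ⊕ c₂.Label))
  | cond _ _ c₁ c₂ =>
    haveI := Label.fintype c₁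
    haveI := Label.fintype c₂
    inferInstanceAs (Fintype (Option (c₁.Label ⊕ c₂.Label)))
  | loop _ _ c =>
    haveI := Label.fintype c
    inferInstanceAs (Fintype (Option c.Label))

/-- The program point at which the execution starts. -/
def entry : (c : StackProgram Γ) → c.Label
  | skip => ()
  | push _ _ => ()
  | pop _ => ()
  | seq c₁ _ => Sum.inl c₁.entry
  | cond _ _ _ _ => none
  | loop _ _ _ => none

/-- The machine statement at a program point, where `e` embeds the program points into the labels
of the machine and `x` is the label at which the machine continues after the program. -/
def code {Λ : Type} : (c : StackProgram Γ) → (c.Label → Λ) → Λ → c.Label → TM2.Stmt Γ Λ Bool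
  | skip, _, x, _ => .goto fun _ => x
  | push k a, _, x, _ => .push k (fun _ => a) (.goto fun _ => x)
  | pop k, _, x, _ => .pop k (fun s _ => s) (.goto fun _ => x)
  | seq c₁ c₂, e, _, Sum.inl l => c₁.code (fun l => e (Sum.inl l)) (e (Sum.inr c₂.entry)) l
  | seq _ c₂, e, x, Sum.inr l => c₂.code (fun l => e (Sum.inr l)) x l
  | cond k p c₁ c₂, e, _, none => .peek k (fun _ o => p o)
      (.goto fun s => if s then e (some (Sum.inl c₁.entry)) else e (some (Sum.inr c₂.entry)))
  | cond _ _ c₁ _, e, x, some (Sum.inl l) => c₁.code (fun l => e (some (Sum.inl l))) x l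
  | cond _ _ _ c₂, e, x, some (Sum.inr l) => c₂.code (fun l => e (some (Sum.inr l))) x l
  | loop k p c, e, x, none => .peek k (fun _ o => p o)
      (.goto fun s => if s then e (some c.entry) else x)
  | loop _ _ c, e, _, some l => c.code (fun l => e (some l)) (e none) l

variable [DecidableEq K]

/-- Started on the stacks `S`, the program `c` ends with the stacks `S'` after at most `n` steps. -/
def Exec (c : StackProgram Γ) (S S' : ∀ k, List (Γ k)) (n : ℕ) : Prop :=
  ∀ (Λ : Type) (M : Λ → TM2.Stmt Γ Λ Bool) (e : c.Label → Λ) (x : Λ),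
    (∀ l, M (e l) = c.code e x l) → ∀ v, ∃ v',
      Nonempty (EvalsToInTime (TM2.step M) ⟨some (e c.entry), v, S⟩ (some ⟨some x, v', S'⟩) n)

theorem evalsToInTime_of_step {σ : Type} {f : σ → Option σ} {a b : σ} (h : f a = some b) :
    Nonempty (EvalsToInTime f a (some b) 1) :=
  ⟨⟨⟨1, h⟩, le_rfl⟩⟩

theorem evalsToInTime_mono {σ : Type} {f : σ → Option σ} {a : σ} {b : Option σ} {m n : ℕ}
    (h : Nonempty (EvalsToInTime f a b m)) (hmn : m ≤ n) : Nonempty (EvalsToInTime f a b n) :=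
  h.elim fun h => ⟨⟨h.toEvalsTo, h.steps_le_m.trans hmn⟩⟩

theorem evalsToInTime_trans {σ : Type} {f : σ → Option σ} {a b : σ} {c : Option σ} {m n k : ℕ}
    (h₁ : Nonempty (EvalsToInTime f a (some b) m)) (h₂ : Nonempty (EvalsToInTime f b c n))
    (hk : m + n ≤ k) : Nonempty (EvalsToInTime f a c k) :=
  evalsToInTime_mono (h₁.elim fun h₁ => h₂.elim fun h₂ => ⟨EvalsToInTime.trans f m n a b c h₁ h₂⟩)
    (by omega)

variable {c c₁ c₂ : StackProgram Γ} {S S' S'' : ∀ k, List (Γ k)} {m n : ℕ}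

theorem Exec.mono (h : Exec c S S' m) (hmn : m ≤ n) : Exec c S S' n := fun Λ M e x hM v =>
  let ⟨v', h'⟩ := h Λ M e x hM v
  ⟨v', evalsToInTime_mono h' hmn⟩

theorem exec_skip : Exec (skip : StackProgram Γ) S S 1 := fun Λ M e x hM v =>
  ⟨v, evalsToInTime_of_step (by simp [hM, code])⟩

theorem exec_push (k : K) (a : Γ k) : Exec (push k a) S (Function.update S k (a :: S k)) 1 :=
  fun Λ M e x hM v => ⟨v, evalsToInTime_of_step (by simp [hM, code])⟩

theorem exec_pop (k : K) : Exec (pop k) S (Function.update S k (S k).tail) 1 :=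
  fun Λ M e x hM v => ⟨v, evalsToInTime_of_step (by simp [hM, code])⟩

/-- Composition needs no relabelling, because `Exec` speaks of every machine that contains the code:
the exit label of `c₁` is instantiated with the entry of `c₂` inside the same machine. The internal
state in between is arbitrary. -/
theorem Exec.seq (h₁ : Exec c₁ S S' m) (h₂ : Exec c₂ S' S'' n) :
    Exec (seq c₁ c₂) S S'' (m + n) := fun Λ M e x hM v => by
  obtain ⟨v₁, h₁⟩ := h₁ Λ M _ _ (fun l => hM (Sum.inl l)) v
  obtain ⟨v₂, h₂⟩ := h₂ Λ M _ _ (fun l => hM (Sum.inr l)) v₁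
  exact ⟨v₂, evalsToInTime_trans h₁ h₂ le_rfl⟩

theorem Exec.cond_true {k : K} {p : Option (Γ k) → Bool} (hp : p (S k).head? = true)
    (h : Exec c₁ S S' m) : Exec (cond k p c₁ c₂) S S' (m + 1) := fun Λ M e x hM v => by
  -- The peek leaves the outcome of the test in the internal state, so the branch starts in the
  -- state `true`.
  obtain ⟨v₁, h₁⟩ := h Λ M _ _ (fun l => hM (some (Sum.inl l))) true
  refine ⟨v₁, evalsToInTime_trans (evalsToInTime_of_step ?_) h₁ (by omega)⟩
  have := hM none
  simp only [entry] at *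
  simp [this, code, hp]

theorem Exec.cond_false {k : K} {p : Option (Γ k) → Bool} (hp : p (S k).head? = false)
    (h : Exec c₂ S S' m) : Exec (cond k p c₁ c₂) S S' (m + 1) := fun Λ M e x hM v => by
  obtain ⟨v₁, h₁⟩ := h Λ M _ _ (fun l => hM (some (Sum.inr l))) false
  refine ⟨v₁, evalsToInTime_trans (evalsToInTime_of_step ?_) h₁ (by omega)⟩
  have := hM none
  simp only [entry] at *
  simp [this, code, hp]

theorem Exec.loop_done {k : K} {p : Option (Γ k) → Bool} (hp : p (S k).head? = false) :
    Exec (loop k p c) S S 1 := fun Λ M e x hM v => by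
  refine ⟨false, evalsToInTime_of_step ?_⟩
  have := hM none
  simp only [entry] at *
  simp [this, code, hp]

theorem Exec.loop_step {k : K} {p : Option (Γ k) → Bool} (hp : p (S k).head? = true)
    (h : Exec c S S' m) (h' : Exec (loop k p c) S' S'' n) :
    Exec (loop k p c) S S'' (m + n + 1) := fun Λ M e x hM v => by
  obtain ⟨v₁, h₁⟩ := h Λ M _ _ (fun l => hM (some l)) true
  obtain ⟨v₂, h₂⟩ := h' Λ M e x hM v₁
  refine ⟨v₂, evalsToInTime_trans (evalsToInTime_of_step ?_)
    (evalsToInTime_trans h₁ h₂ le_rfl) (by omega)⟩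
  have := hM none
  simp only [entry] at *
  simp [this, code, hp]

end StackProgram

/-! ### Binary trees on stacks -/

/-- Binary trees, the universal data type of polynomial-time functions below. -/
inductive BinTree : Type
  | nil : BinTree
  | node (l r : BinTree) : BinTree

namespace BinTree

/-- The preorder serialization. -/
def bits : BinTree → List Bool
  | nil => [false]
  | node l r => true :: (l.bits ++ r.bits)

/-- The number of nodes and leaves. -/
def size : BinTree → ℕ
  | nil => 1
  | node l r => l.size + r.size + 1

@[simp] theorem length_bits (x : BinTree) : x.bits.length = x.size := by
  induction x with
  | nil => rfl
  | node l r hl hr => simp [bits, size, hl, hr]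

theorem size_pos (x : BinTree) : 0 < x.size := by cases x <;> simp [size]

def fst : BinTree → BinTree
  | nil => nil
  | node l _ => l

def snd : BinTree → BinTree
  | nil => nil
  | node _ r => r

@[simp] theorem fst_node (l r : BinTree) : (node l r).fst = l := rfl
@[simp] theorem snd_node (l r : BinTree) : (node l r).snd = r := rfl
@[simp] theorem fst_nil : nil.fst = nil := rfl
@[simp] theorem snd_nil : nil.snd = nil := rfl

/-- A binary tree is the list of the left children along its right spine. -/
def toList : BinTree → List BinTree
  | nil => []
  | node l r => l :: r.toList

def ofList : List BinTree → BinTree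
  | [] => nil
  | a :: l => node a (ofList l)

@[simp] theorem toList_ofList (l : List BinTree) : (ofList l).toList = l := by
  induction l with
  | nil => rfl
  | cons a l ih => simp [ofList, toList, ih]

@[simp] theorem ofList_toList (x : BinTree) : ofList x.toList = x := by
  induction x with
  | nil => rfl
  | node l r _ ih => simp [ofList, toList, ih]

end BinTree

/-- The stacks of the machines below. -/
inductive Register : Type
  | inp | out | work | count
  | data (n : Fin 3)
  deriving DecidableEq, Fintype

/-- The alphabets of the stacks, where `A` is the input alphabet. -/
@[reducible] def Register.Sym (A : Type) : Register → Type
  | .inp => A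
  | .out => Bool
  | .work => Bool
  | .count => Bool
  | .data _ => Bool

/-- The contents of all stacks. -/
def store {A : Type} (i : List A) (o w c : List Bool) (D : Fin 3 → List Bool) :
    ∀ k : Register, List (k.Sym A)
  | .inp => i
  | .out => o
  | .work => w
  | .count => c
  | .data n => D n

section store

variable {A : Type} (i i' : List A) (o w c l : List Bool) (D : Fin 3 → List Bool) (n : Fin 3)

@[simp] theorem store_inp : store i o w c D .inp = i := rfl
@[simp] theorem store_out : store i o w c D .out = o := rfl
@[simp] theorem store_work : store i o w c D .work = w := rfl
@[simp] theorem store_count : store i o w c D .count = c := rfl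
@[simp] theorem store_data : store i o w c D (.data n) = D n := rfl

@[simp] theorem update_store_inp :
    Function.update (store i o w c D) .inp i' = store i' o w c D := by
  funext k; cases k <;> simp [Function.update]
@[simp] theorem update_store_out :
    Function.update (store i o w c D) .out l = store i l w c D := by
  funext k; cases k <;> simp [Function.update]
@[simp] theorem update_store_work :
    Function.update (store i o w c D) .work l = store i o l c D := by
  funext k; cases k <;> simp [Function.update]
@[simp] theorem update_store_count :
    Function.update (store i o w c D) .count l = store i o w l D := by
  funext k; cases k <;> simp [Function.update]
@[simp] theorem update_store_data :
    Function.update (store i o w c D) (.data n) l = store i o w c (Function.update D n l) := by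
  funext k
  cases k with
  | data k =>
    by_cases h : k = n
    · subst h; simp
    · simp [Function.update, h]
  | _ => simp [Function.update]

@[simp] theorem update_vec3_zero (x y z v : List Bool) :
    Function.update ![x, y, z] 0 v = ![v, y, z] := by
  funext k; fin_cases k <;> simp [Function.update]
@[simp] theorem update_vec3_one (x y z v : List Bool) :
    Function.update ![x, y, z] 1 v = ![x, v, z] := by
  funext k; fin_cases k <;> simp [Function.update]
@[simp] theorem update_vec3_two (x y z v : List Bool) :
    Function.update ![x, y, z] 2 v = ![x, y, v] := by
  funext k; fin_cases k <;> simp [Function.update]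

end store

/-! ### Reading, moving, copying and deleting serialized trees -/

namespace StackProgram

variable {A : Type}

/-- Pops the serialization of a tree, whose unread part consists of as many trees as there are
symbols on the stack `count`, and pushes it, reversed, on the stack `work`. -/
def readLoop (n : Fin 3) : StackProgram (Register.Sym A) :=
  loop .count Option.isSome
    (cond (.data n) (fun o => o == some true)
      (seq (push .count true) (seq (pop (.data n)) (push .work true)))
      (seq (pop .count) (seq (pop (.data n)) (push .work false))))

def read (n : Fin 3) : StackProgram (Register.Sym A) := seq (push .count true) (readLoop n)

variable {i : List A} {o w c : List Bool} {D : Fin 3 → List Bool} {n j : Fin 3} {k : ℕ}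
  {S : ∀ k : Register, List (k.Sym A)} {rest : List Bool}

/-- The preorder serialization is self-delimiting: a `true` replaces one pending tree by its two
children, a `false` completes one, and the height of `count` is the number of pending trees. The
induction is in continuation form: `h` is the rest of the loop once `x` has been read, which allows
the two subtrees to be chained. Each symbol costs one loop test, one branch test and three stack
operations. -/
theorem exec_readLoop (x : BinTree)
    (h : Exec (readLoop n) (store i o (x.bits.reverse ++ w) c (Function.update D n rest)) S k)
    (hD : D n = x.bits ++ rest) :
    Exec (readLoop n) (store i o w (true :: c) D) S (k + 5 * x.size) := by
  induction x generalizing w c D rest k with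
  | nil =>
    have hb : Exec _ (store i o w (true :: c) D) _ _ := Exec.cond_false
      (k := Register.data n) (p := fun o => o == some true)
      (c₁ := (seq (push .count true) (seq (pop (.data n)) (push .work true))))
      (by simp [hD, BinTree.bits]) ((exec_pop .count).seq ((exec_pop (.data n)).seq
        (exec_push .work false)))
    refine (Exec.loop_step (S' := store i o (false :: w) c (Function.update D n rest))
      (by simp) ?_ (by simpa [BinTree.bits, readLoop] using h)).mono (m := 4 + k + 1)
      (by simp [BinTree.size]; omega)
    simpa [hD, BinTree.bits] using hb
  | node l r hl hr =>
    have hb : Exec _ (store i o w (true :: c) D) _ _ := Exec.cond_true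
      (k := Register.data n) (p := fun o => o == some true)
      (c₂ := (seq (pop .count) (seq (pop (.data n)) (push .work false))))
      (by simp [hD, BinTree.bits]) ((exec_push .count true).seq ((exec_pop (.data n)).seq
        (exec_push .work true)))
    have h2 := hr (w := l.bits.reverse ++ (true :: w)) (c := c) (rest := rest) (k := k)
      (D := Function.update D n (r.bits ++ rest)) (by simpa [BinTree.bits] using h) (by simp)
    have h1 := hl (w := true :: w) (c := true :: c) (rest := r.bits ++ rest)
      (D := Function.update D n (l.bits ++ (r.bits ++ rest))) (by simpa using h2) (by simp)
    refine (Exec.loop_step (by simp) ?_ h1).mono (m := 4 + (k + 5 * r.size + 5 * l.size) + 1)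
      (by simp [BinTree.size]; omega)
    simpa [hD, BinTree.bits] using hb

theorem exec_read (x : BinTree) (hD : D n = x.bits ++ rest) :
    Exec (read n) (store i o w [] D) (store i o (x.bits.reverse ++ w) [] (Function.update D n rest))
      (5 * x.size + 2) := by
  have h := exec_readLoop (i := i) (o := o) (w := w) (c := []) x (Exec.loop_done (by simp)) hD
  refine (Exec.seq (S' := store i o w [true] D) (m := 1) ?_ h).mono (by omega)
  simpa using exec_push (S := store i o w [] D) Register.count true

/-- Moves the contents of the stack `work`, reversed, onto a data stack. -/
def flush (j : Fin 3) : StackProgram (Register.Sym A) :=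
  loop .work Option.isSome (seq
    (cond .work (fun o => o == some true) (push (.data j) true) (push (.data j) false))
    (pop .work))

theorem exec_flush : Exec (flush j) (store i o w c D)
    (store i o [] c (Function.update D j (w.reverse ++ D j))) (4 * w.length + 1) := by
  induction w generalizing D with
  | nil => simpa [flush] using Exec.loop_done (S := store i o [] c D) (k := Register.work) (by simp)
  | cons b w ih =>
    have h := ih (D := Function.update D j (b :: D j))
    have hb : Exec (cond .work (fun o => o == some true) (push (.data j) true)
        (push (.data j) false)) (store i o (b :: w) c D)
        (store i o (b :: w) c (Function.update D j (b :: D j))) 2 := by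
      cases b
      · simpa using Exec.cond_false (S := store i o (false :: w) c D) (k := Register.work)
          (p := fun o => o == some true) (c₁ := push (.data j) true) (by simp)
          (exec_push (.data j) false)
      · simpa using Exec.cond_true (S := store i o (true :: w) c D) (k := Register.work)
          (p := fun o => o == some true) (c₂ := push (.data j) false) (by simp)
          (exec_push (.data j) true)
    refine (Exec.loop_step (by simp) (Exec.seq hb ?_)
      (by simpa [flush] using h)).mono (m := 2 + 1 + (4 * w.length + 1) + 1)
      (by simp; omega)
    simpa using exec_pop (S := store i o (b :: w) c (Function.update D j (b :: D j))) Register.work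

/-- Moves the contents of the stack `work`, reversed, onto two data stacks. -/
def flushBoth (n j : Fin 3) : StackProgram (Register.Sym A) :=
  loop .work Option.isSome (seq
    (cond .work (fun o => o == some true) (seq (push (.data n) true) (push (.data j) true))
      (seq (push (.data n) false) (push (.data j) false)))
    (pop .work))

theorem exec_flushBoth (hn : n ≠ j) : Exec (flushBoth n j) (store i o w c D)
    (store i o [] c (Function.update (Function.update D n (w.reverse ++ D n)) j
      (w.reverse ++ D j))) (5 * w.length + 1) := by
  induction w generalizing D with
  | nil => simpa [flushBoth] using Exec.loop_done (S := store i o [] c D) (k := Register.work) (by simp)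
  | cons b w ih =>
    have h := ih (D := Function.update (Function.update D n (b :: D n)) j (b :: D j))
    have hb : Exec (cond .work (fun o => o == some true)
        (seq (push (.data n) true) (push (.data j) true))
        (seq (push (.data n) false) (push (.data j) false))) (store i o (b :: w) c D)
        (store i o (b :: w) c (Function.update (Function.update D n (b :: D n)) j (b :: D j)))
        3 := by
      cases b
      · simpa [Function.update_of_ne hn.symm] using
          Exec.cond_false (S := store i o (false :: w) c D) (k := Register.work)
          (p := fun o => o == some true)
          (c₁ := (seq (push (.data n) true) (push (.data j) true))) (by simp)
          ((exec_push (.data n) false).seq (exec_push (.data j) false))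
      · simpa [Function.update_of_ne hn.symm] using
          Exec.cond_true (S := store i o (true :: w) c D) (k := Register.work)
          (p := fun o => o == some true)
          (c₂ := (seq (push (.data n) false) (push (.data j) false))) (by simp)
          ((exec_push (.data n) true).seq (exec_push (.data j) true))
    have e : Function.update (Function.update (Function.update (Function.update D n (b :: D n)) j
        (b :: D j)) n (w.reverse ++ b :: D n)) j (w.reverse ++ b :: D j) =
        Function.update (Function.update D n (w.reverse ++ b :: D n)) j (w.reverse ++ b :: D j) := by
      funext q
      by_cases hq : q = j <;> by_cases hq' : q = n <;> simp [Function.update, hq, hq']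
    refine (Exec.loop_step (by simp) (Exec.seq hb ?_)
      (by simpa [flushBoth, Function.update_of_ne hn, e] using h)).mono
      (m := 3 + 1 + (5 * w.length + 1) + 1) (by simp; omega)
    simpa using exec_pop (S := store i o (b :: w) c _) Register.work

/-- Empties the stack `work`. -/
def clear : StackProgram (Register.Sym A) := loop .work Option.isSome (pop .work)

theorem exec_clear : Exec clear (store i o w c D) (store i o [] c D) (2 * w.length + 1) := by
  induction w with
  | nil => simpa [clear] using Exec.loop_done (S := store i o [] c D) (k := Register.work) (by simp)
  | cons b w ih =>
    refine (Exec.loop_step (by simp) ?_ ih).mono (m := 1 + (2 * w.length + 1) + 1)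
      (by simp; omega)
    simpa using exec_pop (S := store i o (b :: w) c D) Register.work

/-- Moves a tree from one data stack to another one. -/
def move (n j : Fin 3) : StackProgram (Register.Sym A) := seq (read n) (flush j)

theorem exec_move (x : BinTree) (hn : n ≠ j) (hD : D n = x.bits ++ rest) :
    Exec (move n j) (store i o [] [] D)
      (store i o [] [] (Function.update (Function.update D n rest) j (x.bits ++ D j)))
      (10 * x.size + 3) := by
  have h := exec_read (i := i) (o := o) (w := []) x hD
  have h' := h.seq (exec_flush (j := j))
  simp only [List.append_nil, List.reverse_reverse, List.length_reverse, BinTree.length_bits,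
    Function.update_of_ne hn.symm] at h'
  exact h'.mono (by omega)

/-- Copies a tree from one data stack to another one. -/
def copy (n j : Fin 3) : StackProgram (Register.Sym A) := seq (read n) (flushBoth n j)

/-- Reading consumes the tree, so it is written back to its source at the same time as to its
target; by `hD` the source stack ends unchanged. -/
theorem exec_copy (x : BinTree) (hn : n ≠ j) (hD : D n = x.bits ++ rest) :
    Exec (copy n j) (store i o [] [] D)
      (store i o [] [] (Function.update D j (x.bits ++ D j))) (10 * x.size + 3) := by
  have h := exec_read (i := i) (o := o) (w := []) x hD
  have h' := h.seq (exec_flushBoth hn)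
  simp only [List.append_nil, List.reverse_reverse, List.length_reverse, BinTree.length_bits,
    Function.update_of_ne hn.symm, Function.update_self, Function.update_idem, ← hD,
    Function.update_eq_self] at h'
  exact h'.mono (by omega)

/-- Removes a tree from a data stack. -/
def drop (n : Fin 3) : StackProgram (Register.Sym A) := seq (read n) clear

theorem exec_drop (x : BinTree) (hD : D n = x.bits ++ rest) :
    Exec (drop n) (store i o [] [] D) (store i o [] [] (Function.update D n rest))
      (10 * x.size + 3) := by
  have h := exec_read (i := i) (o := o) (w := []) x hD
  have h' := h.seq exec_clear
  simp only [List.append_nil, List.length_reverse, BinTree.length_bits] at h'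
  exact h'.mono (by omega)

/-- Pushes a list of bits on a data stack. -/
def pushAll (k : Register) (f : Bool → k.Sym A) : List Bool → StackProgram (Register.Sym A)
  | [] => skip
  | b :: l => seq (push k (f b)) (pushAll k f l)

theorem exec_pushAll_data (l : List Bool) : Exec (pushAll (.data n) id l) (store i o w c D)
    (store i o w c (Function.update D n (l.reverse ++ D n))) (l.length + 1) := by
  induction l generalizing D with
  | nil => simpa [pushAll] using exec_skip
  | cons b l ih =>
    have h := ih (D := Function.update D n (b :: D n))
    refine (Exec.seq (m := 1) ?_ (by simpa using h)).mono (by simp; omega)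
    simpa using exec_push (S := store i o w c D) (.data n) b

theorem exec_pushAll_work (l : List Bool) : Exec (pushAll .work id l) (store i o w c D)
    (store i o (l.reverse ++ w) c D) (l.length + 1) := by
  induction l generalizing w with
  | nil => simpa [pushAll] using exec_skip
  | cons b l ih =>
    have h := ih (w := b :: w)
    refine (Exec.seq (m := 1) ?_ (by simpa using h)).mono (by simp; omega)
    simpa using exec_push (S := store i o w c D) .work b

end StackProgram

/-! ### Polynomial-time functions on binary trees -/

theorem Polynomial.monotone_eval_nat (P : Polynomial ℕ) : Monotone fun n => P.eval n := by
  intro m n h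
  induction P using Polynomial.induction_on' with
  | add p q hp hq => simpa using add_le_add hp hq
  | monomial k a => simpa using Nat.mul_le_mul_left a (Nat.pow_le_pow_left h k)

/-- `B x` is bounded by a polynomial in the size of `x`. -/
def PolyBdd (B : BinTree → ℕ) : Prop := ∃ P : Polynomial ℕ, ∀ x, B x ≤ P.eval x.size

namespace PolyBdd

variable {B B' : BinTree → ℕ}

theorem mono (h : PolyBdd B') (hB : ∀ x, B x ≤ B' x) : PolyBdd B :=
  let ⟨P, hP⟩ := h
  ⟨P, fun x => (hB x).trans (hP x)⟩

theorem const (n : ℕ) : PolyBdd fun _ => n := ⟨Polynomial.C n, fun x => by simp⟩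

theorem size : PolyBdd BinTree.size := ⟨Polynomial.X, fun x => by simp⟩

theorem add (h : PolyBdd B) (h' : PolyBdd B') : PolyBdd fun x => B x + B' x :=
  let ⟨P, hP⟩ := h
  let ⟨Q, hQ⟩ := h'
  ⟨P + Q, fun x => by simpa using add_le_add (hP x) (hQ x)⟩

theorem mul (h : PolyBdd B) (h' : PolyBdd B') : PolyBdd fun x => B x * B' x :=
  let ⟨P, hP⟩ := h
  let ⟨Q, hQ⟩ := h'
  ⟨P * Q, fun x => by simpa using Nat.mul_le_mul (hP x) (hQ x)⟩

theorem eval (P : Polynomial ℕ) (h : PolyBdd B) : PolyBdd fun x => P.eval (B x) :=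
  let ⟨Q, hQ⟩ := h
  ⟨P.comp Q, fun x => by simpa using P.monotone_eval_nat (hQ x)⟩

theorem comp (h : PolyBdd B) {f : BinTree → BinTree} (hf : PolyBdd fun x => (f x).size) :
    PolyBdd fun x => B (f x) :=
  let ⟨P, hP⟩ := h
  (eval P hf).mono fun x => hP (f x)

end PolyBdd

/-- The contents of the stacks when only the data stacks are nonempty. -/
def dataStore (m a b : List Bool) : ∀ k : Register, List (k.Sym (Option Γ')) :=
  store [] [] [] [] ![m, a, b]

/-- `f` is computed in polynomial time by a program that acts on the topmost tree of the first data
stack. -/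
def PolyTime (f : BinTree → BinTree) : Prop :=
  PolyBdd (fun x => (f x).size) ∧
  ∃ (c : StackProgram (Register.Sym (Option Γ'))) (B : BinTree → ℕ), PolyBdd B ∧
    ∀ x m a b, c.Exec (dataStore (x.bits ++ m) a b) (dataStore ((f x).bits ++ m) a b) (B x)

/-! ### Closure properties of polynomial-time tree functions -/

namespace PolyTime

open StackProgram BinTree

section dataStore

variable (x : BinTree) (m a b : List Bool) (t : Bool)

theorem exec_move01 : Exec (move 0 1) (dataStore (x.bits ++ m) a b)
    (dataStore m (x.bits ++ a) b) (10 * x.size + 3) := by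
  simpa [dataStore] using exec_move (i := ([] : List (Option Γ'))) (o := []) (n := 0) (j := 1)
    (D := ![x.bits ++ m, a, b]) (rest := m) x (by decide) (by simp)

theorem exec_move02 : Exec (move 0 2) (dataStore (x.bits ++ m) a b)
    (dataStore m a (x.bits ++ b)) (10 * x.size + 3) := by
  simpa [dataStore] using exec_move (i := ([] : List (Option Γ'))) (o := []) (n := 0) (j := 2)
    (D := ![x.bits ++ m, a, b]) (rest := m) x (by decide) (by simp)

theorem exec_move10 : Exec (move 1 0) (dataStore m (x.bits ++ a) b)
    (dataStore (x.bits ++ m) a b) (10 * x.size + 3) := by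
  simpa [dataStore] using exec_move (i := ([] : List (Option Γ'))) (o := []) (n := 1) (j := 0)
    (D := ![m, x.bits ++ a, b]) (rest := a) x (by decide) (by simp)

theorem exec_move20 : Exec (move 2 0) (dataStore m a (x.bits ++ b))
    (dataStore (x.bits ++ m) a b) (10 * x.size + 3) := by
  simpa [dataStore] using exec_move (i := ([] : List (Option Γ'))) (o := []) (n := 2) (j := 0)
    (D := ![m, a, x.bits ++ b]) (rest := b) x (by decide) (by simp)

theorem exec_copy01 : Exec (copy 0 1) (dataStore (x.bits ++ m) a b)
    (dataStore (x.bits ++ m) (x.bits ++ a) b) (10 * x.size + 3) := by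
  simpa [dataStore] using exec_copy (i := ([] : List (Option Γ'))) (o := []) (n := 0) (j := 1)
    (D := ![x.bits ++ m, a, b]) (rest := m) x (by decide) (by simp)

theorem exec_copy20 : Exec (copy 2 0) (dataStore m a (x.bits ++ b))
    (dataStore (x.bits ++ m) a (x.bits ++ b)) (10 * x.size + 3) := by
  simpa [dataStore] using exec_copy (i := ([] : List (Option Γ'))) (o := []) (n := 2) (j := 0)
    (D := ![m, a, x.bits ++ b]) (rest := b) x (by decide) (by simp)

theorem exec_drop0 : Exec (drop 0) (dataStore (x.bits ++ m) a b) (dataStore m a b)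
    (10 * x.size + 3) := by
  simpa [dataStore] using exec_drop (i := ([] : List (Option Γ'))) (o := []) (n := 0)
    (D := ![x.bits ++ m, a, b]) (rest := m) x (by simp)

theorem exec_push0 : Exec (push (.data 0) t) (dataStore m a b) (dataStore (t :: m) a b) 1 := by
  simpa [dataStore] using exec_push (S := dataStore m a b) (.data 0) t

theorem exec_pop0 : Exec (pop (.data 0)) (dataStore (t :: m) a b) (dataStore m a b) 1 := by
  simpa [dataStore] using exec_pop (S := dataStore (t :: m) a b) (.data 0)

end dataStore

variable {f g c : BinTree → BinTree}

theorem id : PolyTime fun x => x :=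
  ⟨.size, skip, fun _ => 1, .const 1, fun _ _ _ _ => exec_skip⟩

/-- The running time of `g` is polynomial in the size of `f x`; this is why `PolyTime` includes a
size bound on the value. -/
theorem comp (hg : PolyTime g) (hf : PolyTime f) : PolyTime fun x => g (f x) := by
  obtain ⟨sf, cf, Bf, hBf, hf⟩ := hf
  obtain ⟨sg, cg, Bg, hBg, hg⟩ := hg
  exact ⟨sg.comp sf, seq cf cg, _, hBf.add (hBg.comp sf),
    fun x m a b => (hf x m a b).seq (hg _ m a b)⟩

/-- A copy of the input waits on the second stack while `g` runs, and the value of `g` waits on the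
third while `f` runs. This is safe because programs leave everything below their argument, and the
other two stacks, unchanged. The right child is then put back first, below the left one, and the
node bit is pushed last. -/
theorem node (hf : PolyTime f) (hg : PolyTime g) : PolyTime fun x => node (f x) (g x) := by
  obtain ⟨sf, cf, Bf, hBf, hf⟩ := hf
  obtain ⟨sg, cg, Bg, hBg, hg⟩ := hg
  refine ⟨(sf.add sg).add (.const 1), seq (copy 0 1) (seq cg (seq (move 0 2) (seq (move 1 0)
    (seq cf (seq (move 0 1) (seq (move 2 0) (seq (move 1 0) (push (.data 0) true)))))))),
    fun x => (10 * x.size + 3) + (Bg x + ((10 * (g x).size + 3) + ((10 * x.size + 3) + (Bf x +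
      ((10 * (f x).size + 3) + ((10 * (g x).size + 3) + ((10 * (f x).size + 3) + 1))))))), ?_,
    fun x m a b => ?_⟩
  rotate_left
  · have h1 := exec_copy01 x m a b
    have h2 := hg x m (x.bits ++ a) b
    have h3 := exec_move02 (g x) m (x.bits ++ a) b
    have h4 := exec_move10 x m a ((g x).bits ++ b)
    have h5 := hf x m a ((g x).bits ++ b)
    have h6 := exec_move01 (f x) m a ((g x).bits ++ b)
    have h7 := exec_move20 (g x) m ((f x).bits ++ a) b
    have h8 := exec_move10 (f x) ((g x).bits ++ m) a b
    have h9 := exec_push0 ((f x).bits ++ ((g x).bits ++ m)) a b true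
    have := h1.seq (h2.seq (h3.seq (h4.seq (h5.seq (h6.seq (h7.seq (h8.seq h9)))))))
    simpa [bits] using this
  · have hc := PolyBdd.const
    have lin : ∀ {B : BinTree → ℕ}, PolyBdd B → PolyBdd fun x => 10 * B x + 3 :=
      fun h => ((hc 10).mul h).add (hc 3)
    exact (lin .size).add (hBg.add ((lin sg).add ((lin .size).add (hBf.add ((lin sf).add
      ((lin sg).add ((lin sf).add (hc 1))))))))

theorem const (t : BinTree) : PolyTime fun _ => t := by
  refine ⟨.const _, seq (drop 0) (pushAll (.data 0) _root_.id t.bits.reverse), _,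
    (((PolyBdd.const 10).mul .size).add (.const 3)).add (.const (t.size + 1)),
    fun x m a b => (exec_drop0 x m a b).seq ?_⟩
  have := exec_pushAll_data (i := ([] : List (Option Γ'))) (o := []) (w := []) (c := []) (n := 0)
    (D := ![m, a, b]) t.bits.reverse
  simpa [dataStore] using this

theorem fst (hf : PolyTime f) : PolyTime fun x => (f x).fst := by
  suffices PolyTime BinTree.fst from this.comp hf
  refine ⟨PolyBdd.size.mono fun x => by cases x <;> simp [size]; omega,
    cond (.data 0) (fun o => o == some true)
      (seq (pop (.data 0)) (seq (move 0 1) (seq (drop 0) (move 1 0)))) skip,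
    fun x => 30 * x.size + 30, ((PolyBdd.const 30).mul .size).add (.const 30), fun x m a b => ?_⟩
  cases x with
  | nil => exact (Exec.cond_false (by simp [dataStore, bits]) exec_skip).mono (by simp)
  | node l r =>
    have h := (exec_pop0 (l.bits ++ (r.bits ++ m)) a b true).seq
      ((exec_move01 l (r.bits ++ m) a b).seq ((exec_drop0 r m (l.bits ++ a) b).seq
        (exec_move10 l m a b)))
    refine (Exec.cond_true (by simp [dataStore, bits]) (by simpa [bits] using h)).mono ?_
    simp only [size]; omega

theorem snd (hf : PolyTime f) : PolyTime fun x => (f x).snd := by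
  suffices PolyTime BinTree.snd from this.comp hf
  refine ⟨PolyBdd.size.mono fun x => by cases x <;> simp [size]; omega,
    cond (.data 0) (fun o => o == some true) (seq (pop (.data 0)) (drop 0)) skip,
    fun x => 30 * x.size + 30, ((PolyBdd.const 30).mul .size).add (.const 30), fun x m a b => ?_⟩
  cases x with
  | nil => exact (Exec.cond_false (by simp [dataStore, bits]) exec_skip).mono (by simp)
  | node l r =>
    have h := (exec_pop0 (l.bits ++ (r.bits ++ m)) a b true).seq (exec_drop0 l (r.bits ++ m) a b)
    refine (Exec.cond_true (by simp [dataStore, bits]) (by simpa [bits] using h)).mono ?_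
    simp only [size]; omega

/-- Case distinction on whether a tree is `nil`. -/
def _root_.BinTree.ifNil (c x y : BinTree) : BinTree :=
  match c with
  | .nil => x
  | .node _ _ => y

theorem ifNil (hc : PolyTime c) (hf : PolyTime f) (hg : PolyTime g) :
    PolyTime fun x => ifNil (c x) (f x) (g x) := by
  -- Pairing the tested tree with `x` keeps the argument available to the chosen branch.
  suffices PolyTime fun z => BinTree.ifNil z.fst (f z.snd) (g z.snd) from
    this.comp (hc.node .id)
  obtain ⟨sf, cf, Bf, hBf, hf⟩ := hf
  obtain ⟨sg, cg, Bg, hBg, hg⟩ := hg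
  have ss := (snd .id).1
  refine ⟨((sf.comp ss).add (sg.comp ss)).mono fun x => ?_,
    -- After the node bit of `z` is popped, the next bit tells whether the left child is a leaf; the
    -- child is removed and the branch runs on the right child. For `z = nil` the program of `f`
    -- runs on `nil` directly, in agreement with `nil.fst = nil.snd = nil`.
    cond (.data 0) (fun o => o == some true)
      (seq (pop (.data 0)) (cond (.data 0) (fun o => o == some true) (seq (drop 0) cg)
        (seq (pop (.data 0)) cf))) cf,
    fun x => (10 * x.size + 10) + (Bf x.snd + Bg x.snd),
    (((PolyBdd.const 10).mul .size).add (.const 10)).add ((hBf.comp ss).add (hBg.comp ss)),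
    fun x m a b => ?_⟩
  · rcases x with _ | ⟨_ | ⟨_, _⟩, r⟩ <;> simp [BinTree.ifNil]
  · rcases x with _ | ⟨_ | ⟨l₁, l₂⟩, r⟩
    · refine (Exec.cond_false (by simp [dataStore, bits]) (hf .nil m a b)).mono ?_
      simp only [snd_nil]; omega
    · have h := (exec_pop0 (r.bits ++ m) a b false).seq (hf r m a b)
      have h' := (exec_pop0 (false :: (r.bits ++ m)) a b true).seq
        (Exec.cond_false (k := .data 0) (p := fun o => o == some true) (c₁ := seq (drop 0) cg)
          (by simp [dataStore]) h)
      refine (Exec.cond_true (by simp [dataStore, bits]) 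
        (by simpa [bits, BinTree.ifNil] using h')).mono ?_
      simp only [snd_node]; omega
    · have h := (exec_drop0 (.node l₁ l₂) (r.bits ++ m) a b).seq (hg r m a b)
      have h' := (exec_pop0 ((BinTree.node l₁ l₂).bits ++ (r.bits ++ m)) a b true).seq
        (Exec.cond_true (k := .data 0) (p := fun o => o == some true)
          (c₂ := seq (pop (.data 0)) cf) (by simp [dataStore, bits]) h)
      refine (Exec.cond_true (by simp [dataStore, bits])
        (by simpa [bits, BinTree.ifNil] using h')).mono ?_
      simp only [snd_node, size]; omega

/-- The loop that folds a program for `F` over a list, where the first data stack holds the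
remaining list and the pair of the context and the accumulator. -/
def foldProgram (c : StackProgram (Register.Sym (Option Γ'))) :
    StackProgram (Register.Sym (Option Γ')) :=
  loop (.data 0) (fun o => o == some true)
    (seq (pop (.data 0)) (seq (move 0 1) (seq (move 0 2) (seq (pop (.data 0)) (seq (move 0 2)
      (seq (move 1 0) (seq (push (.data 0) true) (seq (copy 2 0) (seq (push (.data 0) true)
        (seq c (seq (move 2 0) (seq (push (.data 0) true) (move 2 0)))))))))))))

/-- Every accumulator that occurs is the fold over a prefix of the list, so a size bound `Q` on
those folds gives one bound `K` for the cost of each call of `F`. -/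
theorem exec_foldProgram {F : BinTree → BinTree → BinTree → BinTree}
    {p : StackProgram (Register.Sym (Option Γ'))} {B : BinTree → ℕ}
    (hF : ∀ z m a b, p.Exec (dataStore (z.bits ++ m) a b)
      (dataStore ((F z.fst z.snd.snd z.snd.fst).bits ++ m) a b) (B z))
    (x : BinTree) (N Q K : ℕ)
    (hK : ∀ h s : BinTree, h.size ≤ N → s.size ≤ Q → B (.node x (.node h s)) ≤ K)
    (m a b : List Bool) (L s : BinTree) (hL : L.size ≤ N)
    (hs : ∀ l', l' <+: L.toList → (l'.foldl (F x) s).size ≤ Q) :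
    Exec (foldProgram p) (dataStore (L.bits ++ ((BinTree.node x s).bits ++ m)) a b)
      (dataStore (BinTree.nil.bits ++ ((BinTree.node x (L.toList.foldl (F x) s)).bits ++ m)) a b)
      (L.size * (K + 30 * x.size + 20 * N + 30) + 1) := by
  induction L generalizing s with
  | nil => exact (Exec.loop_done (by simp [dataStore, bits])).mono (by simp)
  | node h t _ ih =>
    simp only [size] at hL
    have ih := ih (F x s h) (by omega) fun l' hl' => by
      have := hs (h :: l') (by simpa [toList] using hl')
      simpa using this
    -- One iteration parks the tail and the context on the third stack, assembles `(x, (h, s))` as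
    -- the argument of `F`, runs the program and restores the layout. The context is traversed three
    -- times, head and tail twice each, whence the summands `30 * x.size` and `20 * N`.
    have e := (exec_pop0 (h.bits ++ (t.bits ++ (true :: (x.bits ++ (s.bits ++ m))))) a b true).seq
      ((exec_move01 h (t.bits ++ (true :: (x.bits ++ (s.bits ++ m)))) a b).seq
      ((exec_move02 t (true :: (x.bits ++ (s.bits ++ m))) (h.bits ++ a) b).seq
      ((exec_pop0 (x.bits ++ (s.bits ++ m)) (h.bits ++ a) (t.bits ++ b) true).seq
      ((exec_move02 x (s.bits ++ m) (h.bits ++ a) (t.bits ++ b)).seq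
      ((exec_move10 h (s.bits ++ m) a (x.bits ++ (t.bits ++ b))).seq
      ((exec_push0 (h.bits ++ (s.bits ++ m)) a (x.bits ++ (t.bits ++ b)) true).seq
      ((exec_copy20 x (true :: (h.bits ++ (s.bits ++ m))) a (t.bits ++ b)).seq
      ((exec_push0 (x.bits ++ (true :: (h.bits ++ (s.bits ++ m)))) a
        (x.bits ++ (t.bits ++ b)) true).seq
      (Exec.seq (by simpa [bits] using hF (.node x (.node h s)) m a (x.bits ++ (t.bits ++ b)))
      ((exec_move20 x ((F x s h).bits ++ m) a (t.bits ++ b)).seq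
      ((exec_push0 (x.bits ++ ((F x s h).bits ++ m)) a (t.bits ++ b) true).seq
      (exec_move20 t (true :: (x.bits ++ ((F x s h).bits ++ m))) a b))))))))))))
    have hb := hK h s (by omega) (hs [] (by simp))
    refine (Exec.loop_step (by simp [dataStore, bits]) (by simpa [bits] using e)
      (by simpa [bits, foldProgram, toList] using ih)).mono ?_
    simp only [size, add_mul, one_mul]
    have : 0 ≤ h.size * (K + 30 * x.size + 20 * N + 30) := Nat.zero_le _
    simp only [mul_add] at *
    omega

/-- Folding a polynomial-time function over a list takes polynomial time if all intermediate values
have polynomial size. -/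
theorem foldl {l s : BinTree → BinTree} {F : BinTree → BinTree → BinTree → BinTree}
    {q : BinTree → ℕ} (hl : PolyTime l) (hs : PolyTime s)
    (hF : PolyTime fun z => F z.fst z.snd.snd z.snd.fst) (hq : PolyBdd q)
    (hsize : ∀ x l', l' <+: (l x).toList → (l'.foldl (F x) (s x)).size ≤ q x) :
    PolyTime fun x => (l x).toList.foldl (F x) (s x) := by
  obtain ⟨_, ci, Bi, hBi, hi⟩ := hl.node (id.node hs)
  have sl := hl.1
  obtain ⟨_, p, B, ⟨P, hP⟩, hF⟩ := hF
  -- The argument of `P` bounds the size of the triple of context, list element and accumulator that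
  -- is passed to `F`.
  let K : BinTree → ℕ := fun x => P.eval (x.size + ((l x).size + q x + 1) + 1)
  refine ⟨hq.mono fun x => hsize x _ List.prefix_rfl,
    seq ci (seq (pop (.data 0)) (seq (foldProgram p) (seq (pop (.data 0)) (seq (pop (.data 0))
      (drop 0))))), fun x => Bi x + (1 + (((l x).size * (K x + 30 * x.size + 20 * (l x).size + 30)
        + 1) + (1 + (1 + (10 * x.size + 3))))), ?_, fun x m a b => ?_⟩
  · have hc := PolyBdd.const
    have hsz := PolyBdd.size
    have hK : PolyBdd K :=
      PolyBdd.eval P ((hsz.add ((sl.add hq).add (hc 1))).add (hc 1))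
    exact hBi.add ((hc 1).add (((sl.mul (((hK.add ((hc 30).mul hsz)).add ((hc 20).mul sl)).add
      (hc 30))).add (hc 1)).add ((hc 1).add ((hc 1).add (((hc 10).mul hsz).add (hc 3))))))
  · have h1 := hi x m a b
    have h2 := exec_pop0 ((l x).bits ++ ((BinTree.node x (s x)).bits ++ m)) a b true
    have h3 := exec_foldProgram hF x (l x).size (q x) (K x) (fun h s hh hs =>
      (hP _).trans (P.monotone_eval_nat (by simp only [size]; omega))) m a b (l x) (s x) le_rfl
      (hsize x)
    have h4 := exec_pop0 ((BinTree.node x ((l x).toList.foldl (F x) (s x))).bits ++ m) a b false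
    have h5 := exec_pop0 (x.bits ++ (((l x).toList.foldl (F x) (s x)).bits ++ m)) a b true
    have h6 := exec_drop0 x (((l x).toList.foldl (F x) (s x)).bits ++ m) a b
    exact Exec.seq (by simpa [bits] using h1) (h2.seq (Exec.seq (by simpa [bits] using h3)
      (Exec.seq (by simpa [bits] using h4) (h5.seq h6))))

end PolyTime

/-! ### From polynomial-time functions to Turing machines -/

namespace StackProgram

open BinTree

/-- Reads the topmost input symbol and pushes, reversed, a list node followed by its tree. -/
def loadSymbol (sym : Option Γ' → BinTree) :
    List (Option Γ') → StackProgram (Register.Sym (Option Γ'))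
  | [] => skip
  | a :: l => cond .inp (fun o => o == some a) (pushAll .work id (true :: (sym a).bits))
      (loadSymbol sym l)

variable {sym : Option Γ' → BinTree} {i : List (Option Γ')} {o w c : List Bool}
  {D : Fin 3 → List Bool}

theorem exec_loadSymbol (a : Option Γ') (l : List (Option Γ')) (ha : a ∈ l) :
    Exec (loadSymbol sym l) (store (a :: i) o w c D)
      (store (a :: i) o ((true :: (sym a).bits).reverse ++ w) c D)
      (l.length + (sym a).size + 2) := by
  induction l with
  | nil => simp at ha
  | cons b l ih =>
    by_cases hab : a = b
    · subst hab
      exact (Exec.cond_true (by simp) (exec_pushAll_work _)).mono (by simp only [List.length_cons, length_bits]; omega)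
    · exact (Exec.cond_false (by simpa using hab) (ih (by simpa [hab] using ha))).mono
        (by simp only [List.length_cons]; omega)

/-- Turns the input into a tree on the first data stack. -/
noncomputable def load (sym : Option Γ' → BinTree) : StackProgram (Register.Sym (Option Γ')) :=
  seq (loop .inp Option.isSome (seq (loadSymbol sym Finset.univ.toList) (pop .inp)))
    (seq (push .work false) (flush 0))

theorem size_ofList_cons (a : BinTree) (l : List BinTree) :
    (ofList (a :: l)).size = a.size + (ofList l).size + 1 := rfl

theorem exec_load_loop (K : ℕ) (hK : ∀ a, (sym a).size + Fintype.card (Option Γ') ≤ K) :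
    Exec (loop .inp Option.isSome (seq (loadSymbol sym Finset.univ.toList) (pop .inp)))
      (store i o w c D)
      (store [] o ((i.flatMap fun a => true :: (sym a).bits).reverse ++ w) c D)
      (i.length * (K + 10) + 1) := by
  induction i generalizing w with
  | nil => simpa using Exec.loop_done (S := store [] o w c D) (k := Register.inp) (by simp)
  | cons a i ih =>
    have h1 := exec_loadSymbol (sym := sym) (i := i) (o := o) (w := w) (c := c) (D := D) a
      Finset.univ.toList (by simp)
    have h2 := exec_pop (S := store (a :: i) o ((true :: (sym a).bits).reverse ++ w) c D) .inp
    have h := Exec.loop_step (k := Register.inp) (p := Option.isSome) (by simp) (h1.seq h2)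
      (by simpa using ih (w := (true :: (sym a).bits).reverse ++ w))
    refine Exec.mono (by simpa using h) ?_
    have := hK a
    rw [Fintype.card_option] at this
    simp only [List.length_cons, add_mul]
    omega

theorem bits_ofList (l : List BinTree) :
    (ofList l).bits = l.flatMap (fun a => true :: a.bits) ++ [false] := by
  induction l with
  | nil => rfl
  | cons a l ih => simp [ofList, bits, ih]

/-- The input is consumed from left to right, so the serialization accumulates in reverse on `work`.
The last `false` is the leaf that ends the list, and `flush` restores the order. -/
theorem exec_load (K : ℕ) (hK : ∀ a, (sym a).size + Fintype.card (Option Γ') ≤ K) :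
    Exec (load sym) (store i [] [] [] ![[], [], []])
      (dataStore (ofList (i.map sym)).bits [] [])
      (i.length * (K + 10) + 1 + (1 + (4 * (ofList (i.map sym)).size + 1))) := by
  have h1 := exec_load_loop (i := i) (o := []) (w := []) (c := []) (D := ![[], [], []]) K hK
  have h2 := exec_push
    (S := store ([] : List (Option Γ')) [] ((i.flatMap fun a => true :: (sym a).bits).reverse ++ []) [] ![[], [], []])
    Register.work false
  have h3 := exec_flush (i := ([] : List (Option Γ'))) (o := []) (c := []) (D := ![[], [], []])
    (j := 0) (w := (ofList (i.map sym)).bits.reverse)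
  have e : (ofList (i.map sym)).bits.reverse =
      false :: (i.flatMap fun a => true :: (sym a).bits).reverse := by
    simp [bits_ofList, List.flatMap_map]
  rw [List.length_reverse, length_bits] at h3
  refine h1.seq (Exec.seq (S' := store [] [] (ofList (i.map sym)).bits.reverse [] ![[], [], []])
    ?_ ?_)
  · simpa [e] using h2
  · simpa [dataStore] using h3

/-- Replaces the tree on the first data stack by an output bit. -/
def emit : StackProgram (Register.Sym (Option Γ')) :=
  seq (cond (.data 0) (fun o => o == some true) (push .out true) (push .out false)) (drop 0)

theorem exec_emit (x : BinTree) (b : Bool) (hb : b = true ↔ x ≠ nil) :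
    Exec emit (dataStore x.bits [] []) (store [] [b] [] [] ![[], [], []])
      (2 + (10 * x.size + 3)) := by
  have h2 := exec_drop (i := ([] : List (Option Γ'))) (o := [b]) (D := ![x.bits, [], []])
    (n := 0) (rest := []) x (by simp)
  refine Exec.seq ?_ (by simpa using h2)
  cases x with
  | nil =>
    have hb : b = false := by simpa using hb
    subst hb
    exact Exec.cond_false (by simp [dataStore, bits])
      (by simpa [dataStore] using exec_push (S := dataStore (BinTree.nil).bits [] []) .out false)
  | node l r =>
    have hb : b = true := by simpa using hb
    subst hb
    exact Exec.cond_true (by simp [dataStore, bits])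
      (by simpa [dataStore] using exec_push (S := dataStore (BinTree.node l r).bits [] []) .out true)

/-- The Turing machine that runs a program on the input stack `inp`. -/
noncomputable def machine (c : StackProgram (Register.Sym (Option Γ'))) : FinTM2 where
  K := Register
  k₀ := .inp
  k₁ := .out
  Γ := Register.Sym (Option Γ')
  Λ := Option c.Label
  main := some c.entry
  σ := Bool
  initialState := false
  Γk₀Fin := inferInstanceAs (Fintype (Option Γ'))
  m l := match l with
    | none => .load (fun _ => false) .halt
    | some l => c.code some none l

/-- A halting configuration must carry the initial internal state and empty stacks apart from the
output. The exit label `none` therefore resets the state before halting, which is the additional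
step. -/
theorem Exec.outputsInTime {c : StackProgram (Register.Sym (Option Γ'))} {l : List (Option Γ')}
    {b : Bool} {n : ℕ}
    (h : Exec c (store l [] [] [] ![[], [], []]) (store [] [b] [] [] ![[], [], []]) n) :
    Nonempty (TM2OutputsInTime (machine c) l (some [b]) (n + 1)) := by
  obtain ⟨v, hv⟩ := h (Option c.Label) (machine c).m some none (fun _ => rfl) false
  have h1 : initList (machine c) l =
      ⟨some (some c.entry), false, store l [] [] [] ![[], [], []]⟩ := by
    simp only [initList, machine]
    congr 1
    funext k
    cases k with
    | data n => fin_cases n <;> rfl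
    | _ => rfl
  have h2 : haltList (machine c) [b] =
      ⟨none, false, store [] [b] [] [] ![[], [], []]⟩ := by
    simp only [haltList, machine]
    congr 1
    funext k
    cases k with
    | data n => fin_cases n <;> rfl
    | _ => rfl
  unfold TM2OutputsInTime
  rw [Option.map_some, h1, h2]
  exact evalsToInTime_trans hv (evalsToInTime_of_step rfl) le_rfl

end StackProgram

open StackProgram BinTree in
/-- A property of strings is decided by a Turing machine in polynomial time if it is represented by
a polynomial-time function on trees. -/
theorem PolyTime.tm2ComputableInPolyTime {α : Type} (enc : α → List (Option Γ'))
    (sym : Option Γ' → BinTree) {f : BinTree → BinTree} (hf : PolyTime f) (V : α → Bool)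
    (hV : ∀ a, V a = true ↔ f (ofList ((enc a).map sym)) ≠ .nil) :
    Nonempty (TM2ComputableInPolyTime enc encodeBool V) := by
  obtain ⟨⟨Q, hQ⟩, c, B, ⟨P, hP⟩, hf⟩ := hf
  let K := ∑ a, (sym a).size + Fintype.card (Option Γ')
  have hK : ∀ a, (sym a).size + Fintype.card (Option Γ') ≤ K := fun a =>
    Nat.add_le_add_right (Finset.single_le_sum (f := fun a => (sym a).size)
      (fun _ _ => Nat.zero_le _) (Finset.mem_univ a)) _
  have hs : ∀ l : List (Option Γ'), (ofList (l.map sym)).size ≤ l.length * (K + 1) + 1 := by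
    intro l
    induction l with
    | nil => simp [ofList, size]
    | cons a l ih =>
      have := hK a
      rw [List.map_cons, size_ofList_cons, List.length_cons, add_mul]
      omega
  let p := seq (load sym) (seq c emit)
  -- `L` bounds the size of the input tree: each symbol contributes its own tree and one list node,
  -- at most `K + 1` in all, and one leaf ends the list.
  let L : Polynomial ℕ := Polynomial.X * Polynomial.C (K + 1) + 1
  let T : Polynomial ℕ := Polynomial.X * Polynomial.C (K + 10) + 1 + (1 + (4 * L + 1)) +
    (P.comp L + (2 + (10 * Q.comp L + 3))) + 1
  have hp : ∀ a, Nonempty (TM2OutputsInTime (machine p) (enc a) (some [V a])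
      (T.eval (enc a).length)) := fun a => by
    have h1 := exec_load (i := enc a) K hK
    have h2 := hf (ofList ((enc a).map sym)) [] [] []
    have h3 := exec_emit _ _ (hV a)
    have h := Exec.outputsInTime (h1.seq (Exec.seq (by simpa using h2) h3))
    refine evalsToInTime_mono h ?_
    have hL := hs (enc a)
    have hP' := (hP _).trans (P.monotone_eval_nat hL)
    have hQ' := (hQ _).trans (Q.monotone_eval_nat hL)
    simp only [T, L, Polynomial.eval_add, Polynomial.eval_mul, Polynomial.eval_X,
      Polynomial.eval_C, Polynomial.eval_one, Polynomial.eval_comp, Polynomial.eval_ofNat] at *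
    omega
  exact ⟨{
    tm := machine p
    inputAlphabet := Equiv.refl _
    outputAlphabet := Equiv.refl _
    time := T
    outputsFun := fun a => by
      have e : ∀ (l : List (p.machine.Γ p.machine.k₀)) (l' : List (p.machine.Γ p.machine.k₁)) n,
          TM2OutputsInTime p.machine l (some l') n →
          TM2OutputsInTime p.machine (l.map (Equiv.refl _).invFun)
            (some (l'.map (Equiv.refl _).invFun)) n := by
        intro l l' n h
        change TM2OutputsInTime p.machine (l.map _root_.id) (some (l'.map _root_.id)) n
        rwa [List.map_id, List.map_id]
      exact e _ _ _ (hp a).some }⟩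

/-! ### Lists and binary numbers as trees -/

namespace BinTree

theorem size_fst_le (x : BinTree) : x.fst.size ≤ x.size := by cases x <;> simp [size]; omega

theorem size_snd_le (x : BinTree) : x.snd.size ≤ x.size := by cases x <;> simp [size]; omega

theorem size_ofList (l : List BinTree) : (ofList l).size = (l.map fun a => a.size + 1).sum + 1 := by
  induction l with
  | nil => rfl
  | cons a l ih => simp [ofList, size, ih]; omega

theorem size_eq_sum (x : BinTree) : x.size = (x.toList.map fun a => a.size + 1).sum + 1 := by
  rw [← size_ofList, ofList_toList]

theorem length_toList_le (x : BinTree) : x.toList.length ≤ x.size := by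
  induction x with
  | nil => simp [toList]
  | node l r _ ih => simp [toList, size]; omega

theorem size_le_of_mem_toList {x a : BinTree} (h : a ∈ x.toList) : a.size ≤ x.size := by
  induction x with
  | nil => simp [toList] at h
  | node l r _ ih =>
    rcases List.mem_cons.1 h with rfl | h
    · simp [size]; omega
    · have := ih h; simp [size]; omega

@[simp] theorem toList_nil : nil.toList = [] := rfl
@[simp] theorem toList_node (l r : BinTree) : (node l r).toList = l :: r.toList := rfl

theorem toList_snd (x : BinTree) : x.snd.toList = x.toList.tail := by cases x <;> rfl

@[simp] theorem ifNil_nil (x y : BinTree) : ifNil nil x y = x := rfl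
@[simp] theorem ifNil_node (l r x y : BinTree) : ifNil (node l r) x y = y := rfl

/-- The tree representing `true`. -/
def tt : BinTree := node nil nil

/-- The digit represented by a tree. -/
def bit : BinTree → ℕ
  | nil => 0
  | node _ _ => 1

/-- The number with the given binary digits, least significant digit first. -/
def natVal : BinTree → ℕ
  | nil => 0
  | node h t => h.bit + 2 * t.natVal

/-- The integer represented by the pair of two natural numbers with this difference. -/
def intVal (x : BinTree) : ℤ := (x.fst.natVal : ℤ) - x.snd.natVal

@[simp] theorem natVal_nil : nil.natVal = 0 := rfl
@[simp] theorem natVal_node (h t : BinTree) : (node h t).natVal = h.bit + 2 * t.natVal := rfl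
@[simp] theorem bit_nil : nil.bit = 0 := rfl
@[simp] theorem bit_node (h t : BinTree) : (node h t).bit = 1 := rfl
theorem bit_le_one (x : BinTree) : x.bit ≤ 1 := by cases x <;> simp

theorem natVal_eq_fst_snd (x : BinTree) : x.natVal = x.fst.bit + 2 * x.snd.natVal := by
  cases x <;> simp

/-- Moves the elements of the first list, one by one, to the second one. -/
def revAppend (x y : BinTree) : BinTree := x.toList.foldl (fun s a => node a s) y

@[simp] theorem toList_revAppend (x y : BinTree) :
    (revAppend x y).toList = x.toList.reverse ++ y.toList := by
  unfold revAppend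
  generalize x.toList = l
  induction l generalizing y with
  | nil => rfl
  | cons a l ih => simp [ih]

def append (x y : BinTree) : BinTree := revAppend (revAppend x nil) y

@[simp] theorem toList_append (x y : BinTree) : (append x y).toList = x.toList ++ y.toList := by
  simp [append]

/-- The sum digit of a full adder. -/
def sumBit (a b c : BinTree) : BinTree :=
  ifNil a (ifNil b (ifNil c nil tt) (ifNil c tt nil)) (ifNil b (ifNil c tt nil) (ifNil c nil tt))

/-- The carry digit of a full adder. -/
def carryBit (a b c : BinTree) : BinTree :=
  ifNil a (ifNil b nil (ifNil c nil tt)) (ifNil b (ifNil c nil tt) tt)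

theorem sumBit_add_carryBit (a b c : BinTree) :
    (sumBit a b c).bit + 2 * (carryBit a b c).bit = a.bit + b.bit + c.bit := by
  cases a <;> cases b <;> cases c <;> rfl

theorem size_sumBit_le (a b c : BinTree) : (sumBit a b c).size ≤ 3 := by
  cases a <;> cases b <;> cases c <;> simp [sumBit, ifNil, tt, size]

theorem size_carryBit_le (a b c : BinTree) : (carryBit a b c).size ≤ 3 := by
  cases a <;> cases b <;> cases c <;> simp [carryBit, ifNil, tt, size]

/-- One step of the ripple-carry addition, on the two remaining summands, the carry digit and the
reversed list of the digits computed so far. -/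
def addStep (s : BinTree) : BinTree :=
  node s.snd.fst.snd (node s.fst.snd (node
    (carryBit s.fst.fst s.snd.fst.fst s.snd.snd.fst)
    (node (sumBit s.fst.fst s.snd.fst.fst s.snd.snd.fst) s.snd.snd.snd)))

/-- The state of the ripple-carry addition after as many steps as the clock has ticks. -/
def addRun (x y clock : BinTree) : BinTree :=
  clock.toList.foldl (fun s _ => addStep s) (node x (node y (node nil nil)))

/-- The clock `append x y` has enough ticks to exhaust both summands, and exhausted summands deliver
`nil`, the digit zero. The last carry becomes the most significant digit. -/
def addNat (x y : BinTree) : BinTree :=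
  revAppend (addRun x y (append x y)).snd.snd.snd
    (node (addRun x y (append x y)).snd.snd.fst nil)

/-- The number whose reversed digits, followed by those of `v`, are given. -/
def revVal : BinTree → ℕ → ℕ
  | nil, v => v
  | node h t, v => t.revVal (h.bit + 2 * v)

theorem natVal_revAppend (x y : BinTree) : (revAppend x y).natVal = x.revVal y.natVal := by
  induction x generalizing y with
  | nil => rfl
  | node h t _ ih => exact ih (node h y)

theorem addRun_invariant (l : List BinTree) (s : BinTree) :
    (l.foldl (fun s _ => addStep s) s).snd.snd.snd.revVal
      ((l.foldl (fun s _ => addStep s) s).fst.natVal +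
        (l.foldl (fun s _ => addStep s) s).snd.fst.natVal +
        (l.foldl (fun s _ => addStep s) s).snd.snd.fst.bit) =
      s.snd.snd.snd.revVal (s.fst.natVal + s.snd.fst.natVal + s.snd.snd.fst.bit) := by
  induction l generalizing s with
  | nil => rfl
  | cons a l ih =>
    rw [List.foldl_cons, ih]
    have h := sumBit_add_carryBit s.fst.fst s.snd.fst.fst s.snd.snd.fst
    simp only [addStep, fst_node, snd_node, revVal]
    congr 1
    rw [natVal_eq_fst_snd s.fst, natVal_eq_fst_snd s.snd.fst]
    omega

theorem addRun_length (l : List BinTree) (s : BinTree)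
    (h : s.fst.toList.length + s.snd.fst.toList.length ≤ l.length) :
    (l.foldl (fun s _ => addStep s) s).fst = nil ∧
      (l.foldl (fun s _ => addStep s) s).snd.fst = nil := by
  induction l generalizing s with
  | nil =>
    have e : ∀ x : BinTree, x.toList.length = 0 → x = nil := by
      intro x; cases x <;> simp
    simp only [List.length_nil] at h
    exact ⟨e _ (by rw [List.foldl_nil]; omega), e _ (by rw [List.foldl_nil]; omega)⟩
  | cons a l ih =>
    rw [List.foldl_cons]
    by_cases h0 : s.fst.toList.length + s.snd.fst.toList.length = 0
    · exact ih _ (by simp [addStep, toList_snd]; omega)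
    · exact ih _ (by simp [addStep, toList_snd] at h ⊢; omega)

@[simp] theorem natVal_addNat (x y : BinTree) : (addNat x y).natVal = x.natVal + y.natVal := by
  have h := addRun_invariant (append x y).toList (node x (node y (node nil nil)))
  obtain ⟨h1, h2⟩ := addRun_length (append x y).toList (node x (node y (node nil nil))) (by simp)
  rw [h1, h2] at h
  simpa [addNat, natVal_revAppend, addRun, revVal] using h

/-- Whatever trees serve as digits of the summands, the adder only emits `nil` and `tt`. The size of
a sum is thus controlled by its number of digits alone. -/
theorem addRun_digits (l : List BinTree) (s : BinTree) (hs : ∀ d ∈ s.snd.snd.snd.toList, d.size ≤ 3)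
    (hc : s.snd.snd.fst.size ≤ 3) :
    (∀ d ∈ (l.foldl (fun s _ => addStep s) s).snd.snd.snd.toList, d.size ≤ 3) ∧
    (l.foldl (fun s _ => addStep s) s).snd.snd.fst.size ≤ 3 ∧
    (l.foldl (fun s _ => addStep s) s).snd.snd.snd.toList.length =
      l.length + s.snd.snd.snd.toList.length := by
  induction l generalizing s with
  | nil => exact ⟨hs, hc, by simp⟩
  | cons a l ih =>
    obtain ⟨h1, h2, h3⟩ := ih (addStep s)
      (by simpa [addStep] using ⟨size_sumBit_le _ _ _, hs⟩) (size_carryBit_le _ _ _)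
    refine ⟨h1, h2, ?_⟩
    rw [List.foldl_cons, h3]
    simp [addStep]
    omega

theorem size_le_of_digits {x : BinTree} (h : ∀ d ∈ x.toList, d.size ≤ 3) :
    x.size ≤ 4 * x.toList.length + 1 := by
  induction x with
  | nil => simp [size]
  | node l r _ ih =>
    have h1 := h l (by simp)
    have h2 := ih fun d hd => h d (by simp [hd])
    simp [size]; omega

theorem length_addNat (x y : BinTree) :
    (addNat x y).toList.length = x.toList.length + y.toList.length + 1 := by
  have h := (addRun_digits (append x y).toList (node x (node y (node nil nil))) (by simp)
    (by simp [size])).2.2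
  simp only [addNat, addRun, toList_revAppend, List.length_append, List.length_reverse, h]
  simp

theorem size_addNat_le (x y : BinTree) : (addNat x y).size ≤ 4 * (addNat x y).toList.length + 1 := by
  obtain ⟨h1, h2, -⟩ := addRun_digits (append x y).toList (node x (node y (node nil nil))) (by simp)
    (by simp [size])
  refine size_le_of_digits fun d hd => ?_
  simp only [addNat, toList_revAppend, List.mem_append, List.mem_reverse, toList_node, toList_nil,
    List.mem_singleton] at hd
  rcases hd with hd | rfl
  · exact h1 d hd
  · exact h2

/-- Horner's scheme from the most significant digit of `x`: prepending `nil` doubles the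
accumulator. -/
def mulNat (x y : BinTree) : BinTree :=
  (revAppend x nil).toList.foldl (fun s a => addNat (node nil s) (ifNil a nil y)) nil

@[simp] theorem natVal_mulNat (x y : BinTree) : (mulNat x y).natVal = x.natVal * y.natVal := by
  simp only [mulNat, toList_revAppend, toList_nil, List.append_nil, List.foldl_reverse]
  induction x with
  | nil => simp
  | node h t _ ih =>
    cases h <;> simp [ih] <;> ring

/-- One step of the comparison of two numbers, on the remaining digits and the result of the
comparison of the digits seen so far. -/
def leStep (s : BinTree) : BinTree :=
  node s.fst.snd (node s.snd.fst.snd (ifNil s.fst.fst (ifNil s.snd.fst.fst s.snd.snd tt)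
    (ifNil s.snd.fst.fst nil s.snd.snd)))

/-- Digits arrive in order of increasing significance, so a later difference overrides the earlier
verdict. The initial verdict `tt` makes equal numbers comparable. -/
def leNat (x y : BinTree) : BinTree :=
  ((append x y).toList.foldl (fun s _ => leStep s) (node x (node y tt))).snd.snd

theorem leNat_invariant (l : List BinTree) (s : BinTree)
    (h : s.fst.toList.length + s.snd.fst.toList.length ≤ l.length) :
    (l.foldl (fun s _ => leStep s) s).snd.snd ≠ nil ↔
      s.fst.natVal < s.snd.fst.natVal ∨ s.fst.natVal = s.snd.fst.natVal ∧ s.snd.snd ≠ nil := by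
  induction l generalizing s with
  | nil =>
    have e : ∀ x : BinTree, x.toList.length = 0 → x = nil := by
      intro x; cases x <;> simp
    simp only [List.length_nil] at h
    have h1 := e s.fst (by omega)
    have h2 := e s.snd.fst (by omega)
    simp [h1, h2]
  | cons a l ih =>
    have hl : (leStep s).fst.toList.length + (leStep s).snd.fst.toList.length ≤ l.length := by
      by_cases h0 : s.fst.toList.length + s.snd.fst.toList.length = 0
      · simp [leStep, toList_snd]; omega
      · simp [leStep, toList_snd] at h ⊢; omega
    rw [List.foldl_cons, ih _ hl, natVal_eq_fst_snd s.fst, natVal_eq_fst_snd s.snd.fst]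
    simp only [leStep, fst_node, snd_node]
    cases s.fst.fst <;> cases s.snd.fst.fst <;> simp [ifNil, tt] <;> omega

theorem leNat_ne_nil (x y : BinTree) : leNat x y ≠ nil ↔ x.natVal ≤ y.natVal := by
  have := leNat_invariant (append x y).toList (node x (node y tt)) (by simp)
  rw [leNat, this]
  simp [tt]
  omega

/-- Integers are formal differences of natural numbers, so the ring operations and the comparison
need neither subtraction nor a case distinction on signs. -/
def addInt (x y : BinTree) : BinTree := node (addNat x.fst y.fst) (addNat x.snd y.snd)

@[simp] theorem intVal_addInt (x y : BinTree) : (addInt x y).intVal = x.intVal + y.intVal := by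
  simp [addInt, intVal]; ring

def mulInt (x y : BinTree) : BinTree :=
  node (addNat (mulNat x.fst y.fst) (mulNat x.snd y.snd))
    (addNat (mulNat x.fst y.snd) (mulNat x.snd y.fst))

@[simp] theorem intVal_mulInt (x y : BinTree) : (mulInt x y).intVal = x.intVal * y.intVal := by
  simp [mulInt, intVal]; ring

def leInt (x y : BinTree) : BinTree := leNat (addNat x.fst y.snd) (addNat y.fst x.snd)

theorem leInt_ne_nil (x y : BinTree) : leInt x y ≠ nil ↔ x.intVal ≤ y.intVal := by
  rw [leInt, leNat_ne_nil]; simp [intVal]; omega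

end BinTree

/-! ### Binary arithmetic in polynomial time -/

namespace PolyTime

open BinTree

variable {f g h l s : BinTree → BinTree}

/-- Folding a polynomial-time function over a list takes polynomial time if each step increases
a measure of the size of the intermediate values by a polynomial amount only. -/
theorem foldl_of_measure {F : BinTree → BinTree → BinTree → BinTree} (hl : PolyTime l)
    (hs : PolyTime s) (hF : PolyTime fun z => F z.fst z.snd.snd z.snd.fst)
    (m : BinTree → ℕ) (hm : ∀ x, m x ≤ x.size) {r : BinTree → ℕ} (hr : PolyBdd r)
    (h : ∀ x s, ∀ a ∈ (l x).toList, m (F x s a) ≤ m s + r x)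
    (hsize : ∀ x s a, (F x s a).size ≤ 8 * m (F x s a) + 8) :
    PolyTime fun x => (l x).toList.foldl (F x) (s x) := by
  refine foldl (q := fun x => 8 * ((s x).size + (l x).size * r x) + 8) hl hs hF
    (((PolyBdd.const 8).mul (hs.1.add (hl.1.mul hr))).add (.const 8)) fun x l' hl' => ?_
  have key : ∀ l', l' ⊆ (l x).toList → ∀ t, m (l'.foldl (F x) t) ≤ m t + l'.length * r x := by
    intro l' hl'
    induction l' with
    | nil => simp
    | cons a l' ih =>
      intro t
      rw [List.foldl_cons]
      refine (ih (fun b hb => hl' (by simp [hb])) _).trans ?_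
      have := h x t a (hl' (by simp))
      rw [List.length_cons, add_mul]
      omega
  have hlen : l'.length * r x ≤ (l x).size * r x :=
    Nat.mul_le_mul_right _ (hl'.length_le.trans (length_toList_le _))
  -- The comparison of size and measure is known only for values produced by a step, so the last
  -- step of a nonempty prefix is split off; the initial value is bounded by its own size.
  rcases List.eq_nil_or_concat' l' with rfl | ⟨l₁, a, rfl⟩
  · simp only [List.foldl_nil]; omega
  · have := key _ hl'.subset (s x)
    have := hm (s x)
    rw [List.foldl_append] at *
    simp only [List.foldl_cons, List.foldl_nil] at *
    have := hsize x (l₁.foldl (F x) (s x)) a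
    omega

theorem foldl_of_size {F : BinTree → BinTree → BinTree → BinTree} (hl : PolyTime l)
    (hs : PolyTime s) (hF : PolyTime fun z => F z.fst z.snd.snd z.snd.fst)
    {r : BinTree → ℕ} (hr : PolyBdd r)
    (h : ∀ x s, ∀ a ∈ (l x).toList, (F x s a).size ≤ s.size + r x) :
    PolyTime fun x => (l x).toList.foldl (F x) (s x) :=
  foldl_of_measure hl hs hF size (fun _ => le_rfl) hr h fun _ _ _ => by omega

theorem revAppend (hf : PolyTime f) (hg : PolyTime g) :
    PolyTime fun x => revAppend (f x) (g x) :=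
  foldl_of_size (F := fun _ s a => .node a s) (r := fun x => (f x).size + 1) hf hg
    ((id.snd.fst).node id.snd.snd) (hf.1.add (.const 1)) fun x s a ha => by
      have := size_le_of_mem_toList ha
      simp only [size]; omega

theorem append (hf : PolyTime f) (hg : PolyTime g) : PolyTime fun x => append (f x) (g x) :=
  (hf.revAppend (const .nil)).revAppend hg

theorem sumBit (hf : PolyTime f) (hg : PolyTime g) (hh : PolyTime h) :
    PolyTime fun x => sumBit (f x) (g x) (h x) :=
  have h0 := const .nil
  have h1 := const tt
  hf.ifNil (hg.ifNil (hh.ifNil h0 h1) (hh.ifNil h1 h0)) (hg.ifNil (hh.ifNil h1 h0) (hh.ifNil h0 h1))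

theorem carryBit (hf : PolyTime f) (hg : PolyTime g) (hh : PolyTime h) :
    PolyTime fun x => carryBit (f x) (g x) (h x) :=
  have h0 := const .nil
  have h1 := const tt
  hf.ifNil (hg.ifNil h0 (hh.ifNil h0 h1)) (hg.ifNil (hh.ifNil h0 h1) h1)

theorem addNat (hf : PolyTime f) (hg : PolyTime g) : PolyTime fun x => addNat (f x) (g x) := by
  have hrun : PolyTime fun x => addRun (f x) (g x) (BinTree.append (f x) (g x)) := by
    refine foldl_of_size (F := fun _ s _ => addStep s) (r := fun _ => 20) (hf.append hg)
      (hf.node (hg.node (const _))) ?_ (.const 20) fun x s a _ => ?_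
    · have hs : PolyTime fun z => z.snd.snd := id.snd.snd
      suffices PolyTime addStep from this.comp hs
      have i := id
      have a := i.fst.fst
      have b := i.snd.fst.fst
      have c := i.snd.snd.fst
      exact i.snd.fst.snd.node (i.fst.snd.node ((a.carryBit b c).node
        ((a.sumBit b c).node i.snd.snd.snd)))
    · have h1 := size_sumBit_le s.fst.fst s.snd.fst.fst s.snd.snd.fst
      have h2 := size_carryBit_le s.fst.fst s.snd.fst.fst s.snd.snd.fst
      simp only [addStep, size]
      rcases s with _ | ⟨x, _ | ⟨y, _ | ⟨c, o⟩⟩⟩ <;> simp only [fst_nil, snd_nil, fst_node, snd_node,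
        size] at * <;> (try have := size_snd_le x) <;> (try have := size_snd_le y) <;> omega
  exact hrun.snd.snd.snd.revAppend (hrun.snd.snd.fst.node (const .nil))

/-- The measure is the number of digits: an addition may turn digits of size 1 into digits of size
3, so sizes do not grow additively, while lengths do. -/
theorem mulNat (hf : PolyTime f) (hg : PolyTime g) : PolyTime fun x => mulNat (f x) (g x) := by
  refine foldl_of_measure (F := fun x s a => BinTree.addNat (.node .nil s) (_root_.BinTree.ifNil a .nil (g x)))
    (hf.revAppend (const .nil)) (const .nil)
    (((const .nil).node id.snd.snd).addNat (ifNil id.snd.fst (const .nil) (hg.comp id.fst)))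
    (fun x => x.toList.length) length_toList_le (r := fun x => (g x).size + 2)
    (hg.1.add (.const 2)) (fun x s a _ => ?_) fun x s a => ?_
  · have : (_root_.BinTree.ifNil a .nil (g x)).toList.length ≤ (g x).size := by
      cases a
      · simp [_root_.BinTree.ifNil]
      · exact length_toList_le _
    simp only [length_addNat, toList_node, List.length_cons]
    omega
  · exact (size_addNat_le _ _).trans (by omega)

theorem leNat (hf : PolyTime f) (hg : PolyTime g) : PolyTime fun x => leNat (f x) (g x) := by
  refine snd (snd ?_)
  refine foldl_of_size (F := fun _ s _ => leStep s) (r := fun _ => 20) (hf.append hg)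
      (hf.node (hg.node (const _))) ?_ (.const 20) fun x s a _ => ?_
  · have hs : PolyTime fun z => z.snd.snd := id.snd.snd
    suffices PolyTime leStep from this.comp hs
    have i := id
    exact i.fst.snd.node (i.snd.fst.snd.node (i.fst.fst.ifNil (i.snd.fst.fst.ifNil i.snd.snd
      (const _)) (i.snd.fst.fst.ifNil (const _) i.snd.snd)))
  · have h1 : (_root_.BinTree.ifNil s.fst.fst (_root_.BinTree.ifNil s.snd.fst.fst s.snd.snd tt)
        (_root_.BinTree.ifNil s.snd.fst.fst BinTree.nil s.snd.snd)).size ≤ s.snd.snd.size + 3 := by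
      have := size_pos s.snd.snd
      cases s.fst.fst <;> cases s.snd.fst.fst <;> simp [_root_.BinTree.ifNil, size, tt]
    simp only [leStep, size] at *
    rcases s with _ | ⟨x, _ | ⟨y, c⟩⟩ <;> simp only [fst_nil, snd_nil, fst_node, snd_node,
        size] at * <;> (try have := size_snd_le x) <;> (try have := size_snd_le y) <;> omega

theorem addInt (hf : PolyTime f) (hg : PolyTime g) : PolyTime fun x => addInt (f x) (g x) :=
  (hf.fst.addNat hg.fst).node (hf.snd.addNat hg.snd)

theorem mulInt (hf : PolyTime f) (hg : PolyTime g) : PolyTime fun x => mulInt (f x) (g x) :=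
  ((hf.fst.mulNat hg.fst).addNat (hf.snd.mulNat hg.snd)).node
    ((hf.fst.mulNat hg.snd).addNat (hf.snd.mulNat hg.fst))

theorem leInt (hf : PolyTime f) (hg : PolyTime g) : PolyTime fun x => leInt (f x) (g x) :=
  (hf.fst.addNat hg.snd).leNat (hg.fst.addNat hf.snd)

end PolyTime

/-! ### Polynomial-time computable functions with values in types represented by trees -/

/-- A type whose elements are represented by binary trees. -/
class TreeInterp (α : Type) where
  /-- The element represented by a tree. -/
  interp : BinTree → α

namespace BinTree

instance : TreeInterp BinTree := ⟨fun x => x⟩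
instance : TreeInterp (List BinTree) := ⟨toList⟩
instance : TreeInterp ℕ := ⟨natVal⟩
instance : TreeInterp ℤ := ⟨intVal⟩
instance : TreeInterp Prop := ⟨fun x => x ≠ nil⟩

end BinTree

/-- `f` is computed in polynomial time up to the representation of its values by trees. -/
def PolyComputable {α : Type} [TreeInterp α] (f : BinTree → α) : Prop :=
  ∃ g, PolyTime g ∧ ∀ x, TreeInterp.interp (g x) = f x

namespace PolyComputable

open BinTree

section general

variable {α : Type} [TreeInterp α]

theorem congr {f g : BinTree → α} (hf : PolyComputable f) (h : ∀ x, f x = g x) :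
    PolyComputable g :=
  (funext h : f = g) ▸ hf

theorem _root_.polyComputable_iff_polyTime {f : BinTree → BinTree} :
    PolyComputable f ↔ PolyTime f :=
  ⟨fun ⟨_, hg, h⟩ => (funext h) ▸ hg, fun h => ⟨f, h, fun _ => rfl⟩⟩

theorem polyTime {f : BinTree → BinTree} (h : PolyComputable f) : PolyTime f :=
  polyComputable_iff_polyTime.1 h

theorem comp {F : BinTree → α} {f : BinTree → BinTree} (hF : PolyComputable F)
    (hf : PolyComputable f) : PolyComputable fun x => F (f x) :=
  let ⟨G, hG, h⟩ := hF
  ⟨fun x => G (f x), hG.comp hf.polyTime, fun x => h (f x)⟩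

theorem const (t : BinTree) : PolyComputable fun _ => (TreeInterp.interp t : α) :=
  ⟨fun _ => t, .const t, fun _ => rfl⟩

end general

section trees

variable {f g h : BinTree → BinTree}

theorem id : PolyComputable fun x : BinTree => x := polyComputable_iff_polyTime.2 .id

theorem tree (t : BinTree) : PolyComputable fun _ => t := polyComputable_iff_polyTime.2 (.const t)

theorem fst (hf : PolyComputable f) : PolyComputable fun x => (f x).fst :=
  polyComputable_iff_polyTime.2 hf.polyTime.fst

theorem snd (hf : PolyComputable f) : PolyComputable fun x => (f x).snd :=
  polyComputable_iff_polyTime.2 hf.polyTime.snd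

theorem ifNil (hf : PolyComputable f) (hg : PolyComputable g) (hh : PolyComputable h) :
    PolyComputable fun x => ifNil (f x) (g x) (h x) :=
  polyComputable_iff_polyTime.2 (hf.polyTime.ifNil hg.polyTime hh.polyTime)

/-- The component with the given index of a tuple. -/
def _root_.BinTree.arg : ℕ → BinTree → BinTree
  | 0, x => x.fst
  | n + 1, x => BinTree.arg n x.snd

theorem arg (n : ℕ) (hf : PolyComputable f) : PolyComputable fun x => arg n (f x) := by
  induction n generalizing f with
  | zero => exact hf.fst
  | succ n ih => exact ih hf.snd

theorem toList (hf : PolyComputable f) : PolyComputable fun x => (f x).toList :=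
  ⟨f, hf.polyTime, fun _ => rfl⟩

theorem ofList {l : BinTree → List BinTree} (hl : PolyComputable l) :
    PolyComputable fun x => ofList (l x) := by
  obtain ⟨g, hg, h⟩ := hl
  refine (polyComputable_iff_polyTime.2 hg).congr fun x => ?_
  rw [← h]
  exact (ofList_toList _).symm

theorem intVal (hf : PolyComputable f) : PolyComputable fun x => (f x).intVal :=
  ⟨f, hf.polyTime, fun _ => rfl⟩

theorem natVal (hf : PolyComputable f) : PolyComputable fun x => (f x).natVal :=
  ⟨f, hf.polyTime, fun _ => rfl⟩

end trees

section integers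

variable {f g : BinTree → ℤ}

theorem add (hf : PolyComputable f) (hg : PolyComputable g) :
    PolyComputable fun x => f x + g x :=
  let ⟨_, hf, hf'⟩ := hf
  let ⟨_, hg, hg'⟩ := hg
  ⟨_, hf.addInt hg, fun x => (intVal_addInt _ _).trans (congr_arg₂ _ (hf' x) (hg' x))⟩

theorem mul (hf : PolyComputable f) (hg : PolyComputable g) :
    PolyComputable fun x => f x * g x :=
  let ⟨_, hf, hf'⟩ := hf
  let ⟨_, hg, hg'⟩ := hg
  ⟨_, hf.mulInt hg, fun x => (intVal_mulInt _ _).trans (congr_arg₂ _ (hf' x) (hg' x))⟩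

theorem neg (hf : PolyComputable f) : PolyComputable fun x => -f x :=
  let ⟨f', hf, hf'⟩ := hf
  ⟨fun x => .node (f' x).snd (f' x).fst, hf.snd.node hf.fst, fun x => by
    beta_reduce; rw [← hf' x]; simp [TreeInterp.interp, BinTree.intVal]⟩

theorem sub (hf : PolyComputable f) (hg : PolyComputable g) :
    PolyComputable fun x => f x - g x :=
  (hf.add hg.neg).congr fun _ => (sub_eq_add_neg _ _).symm

theorem zero : PolyComputable fun _ => (0 : ℤ) :=
  (const .nil).congr fun _ => by simp [TreeInterp.interp, BinTree.intVal]

theorem one : PolyComputable fun _ => (1 : ℤ) :=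
  (const (.node (.node tt .nil) .nil)).congr fun _ => by simp [TreeInterp.interp, BinTree.intVal, tt]

theorem two : PolyComputable fun _ => (2 : ℤ) := (one.add one).congr fun _ => by norm_num

theorem natCast {f : BinTree → ℕ} (hf : PolyComputable f) : PolyComputable fun x => (f x : ℤ) :=
  let ⟨f', hf, hf'⟩ := hf
  ⟨fun x => .node (f' x) .nil, hf.node (.const _), fun x => by
    beta_reduce; rw [← hf' x]; simp [TreeInterp.interp, BinTree.intVal]⟩

theorem le (hf : PolyComputable f) (hg : PolyComputable g) : PolyComputable fun x => f x ≤ g x :=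
  let ⟨f', hf, hf'⟩ := hf
  let ⟨g', hg, hg'⟩ := hg
  ⟨_, hf.leInt hg, fun x => by
    beta_reduce; rw [← hf' x, ← hg' x]; exact propext (leInt_ne_nil _ _)⟩

end integers

section propositions

variable {p q : BinTree → Prop} {f g : BinTree → ℤ}

theorem and (hp : PolyComputable p) (hq : PolyComputable q) :
    PolyComputable fun x => p x ∧ q x :=
  let ⟨f, hf, hf'⟩ := hp
  let ⟨g, hg, hg'⟩ := hq
  ⟨_, hf.ifNil (.const .nil) hg, fun x => by
    beta_reduce; rw [← hf' x, ← hg' x]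
    simp only [TreeInterp.interp]
    cases f x <;> simp⟩

theorem or (hp : PolyComputable p) (hq : PolyComputable q) :
    PolyComputable fun x => p x ∨ q x :=
  let ⟨f, hf, hf'⟩ := hp
  let ⟨g, hg, hg'⟩ := hq
  ⟨_, hf.ifNil hg (.const tt), fun x => by
    beta_reduce; rw [← hf' x, ← hg' x]
    simp only [TreeInterp.interp]
    cases f x <;> simp [tt]⟩

theorem ne_nil {f : BinTree → BinTree} (hf : PolyComputable f) :
    PolyComputable fun x => f x ≠ nil :=
  ⟨f, hf.polyTime, fun _ => rfl⟩

theorem eq_nil {f : BinTree → BinTree} (hf : PolyComputable f) :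
    PolyComputable fun x => f x = nil :=
  ⟨_, hf.polyTime.ifNil (.const tt) (.const nil), fun x => by
    simp only [TreeInterp.interp]
    cases f x <;> simp [tt]⟩

theorem eq (hf : PolyComputable f) (hg : PolyComputable g) : PolyComputable fun x => f x = g x :=
  ((hf.le hg).and (hg.le hf)).congr fun _ => propext le_antisymm_iff.symm

theorem lt (hf : PolyComputable f) (hg : PolyComputable g) : PolyComputable fun x => f x < g x :=
  (((hf.add one).le hg)).congr fun _ => propext Int.add_one_le_iff

end propositions

/-! ### Computable operations on lists -/

section lists

variable {l l' : BinTree → List BinTree}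

/-- An element is no larger than its list, so one polynomial bounds the contribution of every step
of the folds below. -/
theorem polyBdd_of_mem {G : BinTree → BinTree} (hG : PolyTime G) {l : BinTree → BinTree}
    (hl : PolyTime l) : ∃ r, PolyBdd r ∧ ∀ x, ∀ a ∈ (l x).toList, (G (.node x a)).size ≤ r x := by
  obtain ⟨⟨P, hP⟩, -⟩ := hG
  refine ⟨fun x => P.eval (x.size + (l x).size + 1),
    PolyBdd.eval P ((PolyBdd.size.add hl.1).add (.const 1)), fun x a ha => ?_⟩
  have := size_le_of_mem_toList ha
  exact (hP _).trans (P.monotone_eval_nat (by simp only [size]; omega))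

theorem forall_mem {p : BinTree → BinTree → Prop} (hl : PolyComputable l)
    (hp : PolyComputable fun z => p z.fst z.snd) : PolyComputable fun x => ∀ a ∈ l x, p x a := by
  obtain ⟨L, hL, hL'⟩ := hl
  obtain ⟨G, hG, hG'⟩ := hp
  obtain ⟨r, hr, hr'⟩ := polyBdd_of_mem hG hL
  -- The accumulator is a truth value: `nil` once a test has failed, and otherwise the result of the
  -- latest test.
  refine ⟨_, PolyTime.foldl_of_size (F := fun x s a => BinTree.ifNil s nil (G (.node x a)))
    (r := fun x => r x + 1) hL (.const tt) (PolyTime.id.snd.snd.ifNil (.const _)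
      (hG.comp (PolyTime.id.fst.node PolyTime.id.snd.fst))) (hr.add (.const 1))
      fun x s a ha => ?_, fun x => ?_⟩
  · have := hr' x a ha
    cases s <;> simp [size] ; omega
  · have hG'' : ∀ a, p x a ↔ G (.node x a) ≠ nil := fun a => by
      have := hG' (.node x a); simp only [TreeInterp.interp] at this; simp [this]
    have hLx : (L x).toList = l x := hL' x
    simp only [hG'', hLx, TreeInterp.interp]
    have key : ∀ (l : List BinTree) (s : BinTree),
        (l.foldl (fun s a => BinTree.ifNil s nil (G (.node x a))) s ≠ nil) =
          (s ≠ nil ∧ ∀ a ∈ l, G (.node x a) ≠ nil) := by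
      intro l
      induction l with
      | nil => simp
      | cons a l ih =>
        intro s
        rw [List.foldl_cons, ih]
        cases s <;> simp
    rw [key]
    simp [tt]

/-- The measure counts the digits of both components of the partial sum. Each component gains at
most `r x + 1` digits per step, hence `2 * r x + 2`. -/
theorem sum {F : BinTree → BinTree → ℤ} (hl : PolyComputable l)
    (hF : PolyComputable fun z => F z.fst z.snd) :
    PolyComputable fun x => ((l x).map (F x)).sum := by
  obtain ⟨L, hL, hL'⟩ := hl
  obtain ⟨G, hG, hG'⟩ := hF
  obtain ⟨r, hr, hr'⟩ := polyBdd_of_mem hG hL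
  refine ⟨_, PolyTime.foldl_of_measure (F := fun x s a => addInt s (G (.node x a)))
    (r := fun x => 2 * r x + 2) hL (.const .nil) (PolyTime.id.snd.snd.addInt
      (hG.comp (PolyTime.id.fst.node PolyTime.id.snd.fst)))
      (fun x => x.fst.toList.length + x.snd.toList.length) (fun x => ?_)
      (((PolyBdd.const 2).mul hr).add (.const 2)) (fun x s a ha => ?_) (fun x s a => ?_),
      fun x => ?_⟩
  · cases x with
    | nil => simp
    | node y z =>
      have := length_toList_le y
      have := length_toList_le z
      simp [size]; omega
  · have := hr' x a ha
    have h1 := (length_toList_le (G (.node x a)).fst).trans (size_fst_le _)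
    have h2 := (length_toList_le (G (.node x a)).snd).trans (size_snd_le _)
    simp only [addInt, fst_node, snd_node, length_addNat]
    omega
  · have h1 := size_addNat_le s.fst (G (.node x a)).fst
    have h2 := size_addNat_le s.snd (G (.node x a)).snd
    simp only [addInt, fst_node, snd_node, size]
    omega
  · have hG'' : ∀ a, F x a = (G (.node x a)).intVal := fun a => by
      have := hG' (.node x a); simp only [TreeInterp.interp] at this; simp [this]
    have hLx : (L x).toList = l x := hL' x
    simp only [hLx, TreeInterp.interp]
    have key : ∀ (l : List BinTree) (s : BinTree),
        (l.foldl (fun s a => addInt s (G (.node x a))) s).intVal =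
          s.intVal + (l.map (F x)).sum := by
      intro l
      induction l with
      | nil => simp
      | cons a l ih =>
        intro s
        rw [List.foldl_cons, ih]
        simp [hG'', add_assoc]
    rw [key]
    simp [BinTree.intVal]

theorem length (hl : PolyComputable l) : PolyComputable fun x => ((l x).length : ℤ) :=
  (hl.sum (F := fun _ _ => 1) one).congr fun x => by simp

theorem append (hl : PolyComputable l) (hl' : PolyComputable l') :
    PolyComputable fun x => l x ++ l' x :=
  let ⟨L, hL, h⟩ := hl
  let ⟨L', hL', h'⟩ := hl'
  ⟨_, hL.append hL', fun x => by
    beta_reduce; rw [← h x, ← h' x]; exact toList_append _ _⟩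

theorem reverse (hl : PolyComputable l) : PolyComputable fun x => (l x).reverse :=
  let ⟨L, hL, h⟩ := hl
  ⟨_, hL.revAppend (.const .nil), fun x => by
    beta_reduce; rw [← h x]; exact (toList_revAppend _ _).trans (by simp [TreeInterp.interp])⟩

theorem nil : PolyComputable fun _ => ([] : List BinTree) := (tree BinTree.nil).toList

theorem cons {f : BinTree → BinTree} (hf : PolyComputable f) (hl : PolyComputable l) :
    PolyComputable fun x => f x :: l x :=
  let ⟨L, hL, h⟩ := hl
  ⟨_, hf.polyTime.node hL, fun x => by beta_reduce; rw [← h x]; rfl⟩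

theorem flatMap {F : BinTree → BinTree → List BinTree} (hl : PolyComputable l)
    (hF : PolyComputable fun z => F z.fst z.snd) :
    PolyComputable fun x => (l x).flatMap (F x) := by
  obtain ⟨L, hL, hL'⟩ := hl
  obtain ⟨G, hG, hG'⟩ := hF
  obtain ⟨r, hr, hr'⟩ := polyBdd_of_mem hG hL
  -- `revAppend` pushes every block in reverse onto the accumulator, so a step adds only the size of
  -- its block, and one final reversal restores the order of blocks and elements.
  refine (reverse ?_).congr (f := fun x => ((L x).toList.foldl
    (fun s a => BinTree.revAppend (G (.node x a)) s) BinTree.nil).toList.reverse) fun x => ?_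
  · refine toList (polyComputable_iff_polyTime.2 (PolyTime.foldl_of_size hL
      (.const _) ((hG.comp (PolyTime.id.fst.node PolyTime.id.snd.fst)).revAppend
        PolyTime.id.snd.snd) hr fun x s a ha => ?_))
    have h1 := hr' x a ha
    have h2 := size_eq_sum (BinTree.revAppend (G (.node x a)) s)
    have h3 := size_eq_sum (G (.node x a))
    have h4 := size_eq_sum s
    simp only [toList_revAppend, List.map_append, List.sum_append, List.map_reverse,
      List.sum_reverse] at h2
    omega
  · have hG'' : ∀ a, F x a = (G (.node x a)).toList := fun a => by
      have := hG' (.node x a); simp only [TreeInterp.interp] at this; simp [this]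
    have hLx : (L x).toList = l x := hL' x
    have key : ∀ (l : List BinTree) (s : BinTree),
        (l.foldl (fun s a => BinTree.revAppend (G (.node x a)) s) s).toList.reverse =
          s.toList.reverse ++ l.flatMap (F x) := by
      intro l
      induction l with
      | nil => simp
      | cons a l ih =>
        intro s
        rw [List.foldl_cons, ih]
        simp [hG'']
    rw [key, hLx]
    simp

theorem map {F : BinTree → BinTree → BinTree} (hl : PolyComputable l)
    (hF : PolyComputable fun z => F z.fst z.snd) : PolyComputable fun x => (l x).map (F x) :=
  (hl.flatMap (F := fun x a => [F x a]) (hF.cons nil)).congr fun x => by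
    exact List.map_eq_flatMap.symm

/-- One step of the computation of the list of the pairs of elements of two lists, on the remaining
elements of the first list and the reversed list of pairs. -/
def _root_.BinTree.zipStep (s a : BinTree) : BinTree :=
  .node s.fst.snd (BinTree.ifNil s.fst s.snd (.node (.node s.fst.fst a) s.snd))

theorem zip (hl : PolyComputable l) (hl' : PolyComputable l') :
    PolyComputable fun x => List.zipWith BinTree.node (l x) (l' x) := by
  obtain ⟨L, hL, h⟩ := hl
  obtain ⟨L', hL', h'⟩ := hl'
  refine (reverse ?_).congr (f := fun x => ((L' x).toList.foldl
    zipStep (BinTree.node (L x) .nil)).snd.toList.reverse) fun x => ?_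
  · refine toList (snd (polyComputable_iff_polyTime.2 (PolyTime.foldl_of_size
      (F := fun _ => zipStep) hL'
      (hL.node (.const _)) ?_ (hL'.1.add (.const 2)) fun x s a ha => ?_)))
    · have i := PolyTime.id
      exact i.snd.snd.fst.snd.node (i.snd.snd.fst.ifNil i.snd.snd.snd
        ((i.snd.snd.fst.fst.node i.snd.fst).node i.snd.snd.snd))
    · have := size_le_of_mem_toList ha
      rcases s with _ | ⟨_ | _, _⟩ <;> simp [zipStep, size] <;> omega
  · have hx : (L x).toList = l x := h x
    have hx' : (L' x).toList = l' x := h' x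
    rw [← hx, ← hx']
    have key : ∀ (l : List BinTree) (y s : BinTree),
        (l.foldl zipStep (.node y s)).snd.toList.reverse =
          s.toList.reverse ++ List.zipWith BinTree.node y.toList l := by
      intro l
      induction l with
      | nil => simp
      | cons a l ih =>
        intro y s
        rw [List.foldl_cons, zipStep, ih]
        cases y <;> simp
    rw [key]
    simp

/-- The position is given in unary, as the length of a list along which `snd` is iterated. Past the
end, `nil.snd = nil` and `nil.fst = nil` produce the default value. -/
theorem getD {i : BinTree → BinTree} (hl : PolyComputable l) (hi : PolyComputable i) :
    PolyComputable fun x => (l x).getD (i x).toList.length BinTree.nil := by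
  obtain ⟨L, hL, h⟩ := hl
  refine (polyComputable_iff_polyTime.2 (PolyTime.foldl_of_size (F := fun _ s _ => s.snd)
    (r := fun _ => 0) hi.polyTime hL PolyTime.id.snd.snd.snd
    (.const 0) fun x s a _ => size_snd_le s)).fst.congr fun x => ?_
  have hx : (L x).toList = l x := h x
  rw [← hx]
  generalize (i x).toList = l'
  generalize L x = y
  induction l' generalizing y with
  | nil => cases y <;> rfl
  | cons a l' ih =>
    rw [List.foldl_cons, ih]
    cases y <;> simp

theorem size_ofList_replicate (n : ℕ) :
    (BinTree.ofList (List.replicate n BinTree.nil)).size = 2 * n + 1 := by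
  simp [size_ofList, size]; ring

/-- The trees that represent the numbers less than the length of a list in unary. -/
theorem unaryRange (hl : PolyComputable l) : PolyComputable fun x =>
    (List.range (l x).length).map fun n => BinTree.ofList (List.replicate n BinTree.nil) := by
  obtain ⟨L, hL, h⟩ := hl
  -- After `n` steps the accumulator holds `n` in unary and, latest first, the unary numbers below
  -- `n`; its size is quadratic in `n`.
  have key : ∀ (l : List BinTree),
      l.foldl (fun s _ => BinTree.node (.node .nil s.fst) (.node s.fst s.snd))
        (.node .nil .nil) =
      .node (BinTree.ofList (List.replicate l.length BinTree.nil)) (BinTree.ofList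
        ((List.range l.length).map fun n =>
          BinTree.ofList (List.replicate n BinTree.nil)).reverse) := by
    intro l
    induction l using List.reverseRecOn with
    | nil => rfl
    | append_singleton l a ih =>
      rw [List.foldl_append, ih]
      simp [List.range_succ, List.replicate_succ, BinTree.ofList]
  refine (reverse (toList (snd (polyComputable_iff_polyTime.2 (PolyTime.foldl
    (F := fun _ s _ => BinTree.node (.node .nil s.fst) (.node s.fst s.snd))
    (q := fun x => (2 * (L x).size + 2) * ((L x).size + 2)) hL (.const (.node .nil .nil))
    ((((PolyTime.const .nil).node PolyTime.id.snd.snd.fst).node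
      (PolyTime.id.snd.snd.fst.node PolyTime.id.snd.snd.snd)))
    ((((PolyBdd.const 2).mul hL.1).add (.const 2)).mul (hL.1.add (.const 2)))
    fun x l' hl' => ?_))))).congr fun x => ?_
  · rw [key, size, size_ofList_replicate, size_ofList, List.map_reverse, List.sum_reverse,
      List.map_map]
    have hn := hl'.length_le.trans (length_toList_le _)
    have hsum : ((List.range l'.length).map ((fun a => a.size + 1) ∘ fun n =>
        BinTree.ofList (List.replicate n BinTree.nil))).sum ≤
        l'.length * (2 * l'.length + 2) := by
      refine (List.sum_le_card_nsmul _ (2 * l'.length + 2) fun y hy => ?_).trans (by simp)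
      obtain ⟨n, hn, rfl⟩ := List.mem_map.1 hy
      simp only [Function.comp, size_ofList_replicate]
      have := List.mem_range.1 hn
      omega
    have := Nat.mul_le_mul hn (show 2 * l'.length + 2 ≤ 2 * (L x).size + 2 by omega)
    nlinarith
  · have hx : (L x).toList = l x := h x
    rw [hx, key]
    simp

theorem forall_lt {p : BinTree → ℕ → Prop} (hl : PolyComputable l)
    (hp : PolyComputable fun z => p z.fst z.snd.toList.length) :
    PolyComputable fun x => ∀ n < (l x).length, p x n :=
  (hl.unaryRange.forall_mem (p := fun x a => p x a.toList.length) hp).congr fun x => by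
    simp

/-- Pairing truncates to the shorter list, so the lengths are compared separately. -/
theorem map_natVal_eq (hl : PolyComputable l) (hl' : PolyComputable l') :
    PolyComputable fun x => (l x).map BinTree.natVal = (l' x).map BinTree.natVal := by
  refine ((hl.length.eq hl'.length).and ((hl.zip hl').forall_mem
    (p := fun _ a => (a.fst.natVal : ℤ) = a.snd.natVal)
    (id.snd.fst.natVal.natCast.eq id.snd.snd.natVal.natCast))).congr fun x => ?_
  generalize l x = l
  generalize l' x = l'
  induction l generalizing l' with
  | nil => cases l' <;> simp; omega
  | cons a l ih =>
    cases l' with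
    | nil => simp; omega
    | cons b l' =>
      have := ih l'
      simp only [Nat.cast_inj, eq_iff_iff] at this
      simp [← this]
      tauto

end lists

end PolyComputable

/-! ### Sizes of binary encodings -/

namespace BinTree

/-- The digit with the given value. -/
def bitTree : Bool → BinTree
  | false => nil
  | true => tt

/-- The canonical tree of a natural number. -/
def natTree (n : ℕ) : BinTree := ofList ((encodeNat n).map bitTree)

theorem natVal_encodePosNum (n : PosNum) :
    (ofList ((encodePosNum n).map bitTree)).natVal = (n : ℕ) := by
  induction n with
  | one => rfl
  | bit1 n ih => simp [encodePosNum, ofList, ih, bitTree, tt]; omega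
  | bit0 n ih => simp [encodePosNum, ofList, ih, bitTree]; omega

@[simp] theorem natVal_natTree (n : ℕ) : (natTree n).natVal = n := by
  have h := Num.to_of_nat n
  unfold natTree encodeNat
  cases hn : (n : Num) with
  | zero => rw [hn] at h; simpa [encodeNum, ofList] using h
  | pos p => rw [hn] at h; rw [encodeNum, natVal_encodePosNum]; simpa using h

theorem natVal_lt (x : BinTree) : x.natVal < 2 ^ x.toList.length := by
  induction x with
  | nil => simp
  | node h t _ ih =>
    have := bit_le_one h
    simp only [natVal_node, toList_node, List.length_cons, pow_succ]
    omega

end BinTree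

theorem lt_two_pow_length_encodeNat (n : ℕ) : n < 2 ^ (encodeNat n).length := by
  have h := BinTree.natVal_lt (BinTree.natTree n)
  rw [BinTree.natVal_natTree] at h
  simpa [BinTree.natTree] using h

/-- The source of all magnitude bounds below: the binary digits of a number are part of the
encoding, so every number of an instance is smaller than `2` to the encoding length. -/
theorem abs_lt_two_pow_of_mem_flatMap {z : ℤ} {l : List ℤ} (h : z ∈ l) :
    |z| < 2 ^ (l.flatMap encodeInteger).length := by
  have h1 := lt_two_pow_length_encodeNat z.natAbs
  have h2 : (encodeNat z.natAbs).length ≤ (l.flatMap encodeInteger).length := by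
    rw [List.length_flatMap]
    refine le_trans ?_ (List.single_le_sum (by simp) _ (List.mem_map_of_mem h))
    simp [encodeInteger]
    omega
  have h3 := h1.trans_le (Nat.pow_le_pow_right (by norm_num) h2)
  rw [Int.abs_eq_natAbs]
  exact_mod_cast h3

theorem length_le_length_flatMap_encodeInteger (l : List ℤ) :
    2 * l.length ≤ (l.flatMap encodeInteger).length := by
  induction l with
  | nil => simp
  | cons a l ih => simp [encodeInteger] at *; omega

namespace QuadraticHugeNFoldIP

variable (I : QuadraticHugeNFoldIP)

theorem length_typeTokens (i : Fin I.τ) :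
    (I.typeTokens i).length = I.r * I.t + I.s * I.t + I.t + I.t + I.s + 6 * I.t + 1 := by
  simp [typeTokens, matrixTokens, ratTokens, List.length_flatten, List.length_flatMap,
    List.map_ofFn, Function.comp_def]
  ring

theorem length_tokens : I.tokens.length =
    4 + I.r + I.τ * (I.r * I.t + I.s * I.t + I.t + I.t + I.s + 6 * I.t + 1) := by
  simp [tokens, List.length_flatten, List.map_ofFn, Function.comp_def,
    length_typeTokens]
  ring

theorem length_tokens_le : 2 * I.tokens.length ≤ I.encode.length :=
  length_le_length_flatMap_encodeInteger _

theorem abs_lt_of_mem_tokens {z : ℤ} (h : z ∈ I.tokens) : |z| < 2 ^ I.encode.length :=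
  abs_lt_two_pow_of_mem_flatMap h

theorem mem_tokens_of_mem_typeTokens {i : Fin I.τ} {z : ℤ} (h : z ∈ I.typeTokens i) :
    z ∈ I.tokens := by
  simp only [tokens, List.mem_append, List.mem_flatten, List.mem_ofFn]
  exact Or.inr ⟨_, ⟨i, rfl⟩, h⟩

variable {I} {i : Fin I.τ} (j : Fin I.t)

theorem abs_E₁_lt (a : Fin I.r) : |I.E₁ i a j| < 2 ^ I.encode.length :=
  I.abs_lt_of_mem_tokens (I.mem_tokens_of_mem_typeTokens (i := i) (by
    simp only [typeTokens, matrixTokens, List.mem_append, List.mem_flatten, List.mem_ofFn,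
      exists_exists_eq_and]
    have : ∃ a' j', I.E₁ i a' j' = I.E₁ i a j := ⟨a, j, rfl⟩
    simp only [this, true_or]))

theorem abs_E₂_lt (a : Fin I.s) : |I.E₂ i a j| < 2 ^ I.encode.length :=
  I.abs_lt_of_mem_tokens (I.mem_tokens_of_mem_typeTokens (i := i) (by
    simp only [typeTokens, matrixTokens, List.mem_append, List.mem_flatten, List.mem_ofFn,
      exists_exists_eq_and]
    have : ∃ a' j', I.E₂ i a' j' = I.E₂ i a j := ⟨a, j, rfl⟩
    simp only [this, true_or, or_true]))

theorem abs_l_lt : |I.l i j| < 2 ^ I.encode.length :=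
  I.abs_lt_of_mem_tokens (I.mem_tokens_of_mem_typeTokens (i := i) (by simp [typeTokens]))

theorem abs_u_lt : |I.u i j| < 2 ^ I.encode.length :=
  I.abs_lt_of_mem_tokens (I.mem_tokens_of_mem_typeTokens (i := i) (by simp [typeTokens]))

theorem abs_b_lt (a : Fin I.s) : |I.b i a| < 2 ^ I.encode.length :=
  I.abs_lt_of_mem_tokens (I.mem_tokens_of_mem_typeTokens (i := i) (by simp [typeTokens]))

theorem μ_lt (i : Fin I.τ) : (I.μ i : ℤ) < 2 ^ I.encode.length := by
  have := I.abs_lt_of_mem_tokens (I.mem_tokens_of_mem_typeTokens (i := i)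
    (z := I.μ i) (by simp [typeTokens]))
  rwa [Nat.abs_cast] at this

theorem mem_ratTokens {n : ℕ} (v : Fin n → ℚ) (k : Fin n) :
    (v k).num ∈ ratTokens v ∧ ((v k).den : ℤ) ∈ ratTokens v := by
  simp only [ratTokens, List.mem_flatMap, List.mem_ofFn, exists_exists_eq_and]
  exact ⟨⟨k, by simp⟩, ⟨k, by simp⟩⟩

theorem mem_typeTokens_of_rat {z : ℤ}
    (h : z ∈ ratTokens (I.α i) ∨ z ∈ ratTokens (I.β i) ∨ z ∈ ratTokens (I.γ i)) :
    |z| < 2 ^ I.encode.length :=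
  I.abs_lt_of_mem_tokens (I.mem_tokens_of_mem_typeTokens (i := i) (by
    simp only [typeTokens, List.mem_append]; tauto))

theorem abs_α_lt : |(I.α i j).num| < 2 ^ I.encode.length ∧
    ((I.α i j).den : ℤ) < 2 ^ I.encode.length :=
  ⟨mem_typeTokens_of_rat (Or.inl (mem_ratTokens _ j).1), by
    simpa using mem_typeTokens_of_rat (Or.inl (mem_ratTokens (I.α i) j).2)⟩

theorem abs_β_lt : |(I.β i j).num| < 2 ^ I.encode.length ∧
    ((I.β i j).den : ℤ) < 2 ^ I.encode.length :=
  ⟨mem_typeTokens_of_rat (Or.inr (Or.inl (mem_ratTokens _ j).1)), by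
    simpa using mem_typeTokens_of_rat (Or.inr (Or.inl (mem_ratTokens (I.β i) j).2))⟩

theorem abs_γ_lt : |(I.γ i j).num| < 2 ^ I.encode.length ∧
    ((I.γ i j).den : ℤ) < 2 ^ I.encode.length :=
  ⟨mem_typeTokens_of_rat (Or.inr (Or.inr (mem_ratTokens _ j).1)), by
    simpa using mem_typeTokens_of_rat (Or.inr (Or.inr (mem_ratTokens (I.γ i) j).2))⟩

end QuadraticHugeNFoldIP

/-! ### Solutions with few configurations -/

/-- The elements of a multiset can be replaced, keeping the sum of their images under `φ`, such that
fewer than `M` distinct elements remain: otherwise two sets of distinct elements have the same sum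
and can be exchanged for each other. -/
theorem Multiset.exists_card_toFinset_lt {C ι : Type*} [DecidableEq C] [Fintype ι] [DecidableEq ι]
    (φ : C → ι → ℤ) (K M : ℕ) (hM : (2 * (M * K) + 1) ^ Fintype.card ι < 2 ^ M) (S : Multiset C)
    (hφ : ∀ c ∈ S, ∀ i, |φ c i| ≤ K) :
    ∃ S' : Multiset C, S' ⊆ S ∧ S'.toFinset.card < M ∧ (S'.map φ).sum = (S.map φ).sum := by
  induction hn : S.toFinset.card using Nat.strong_induction_on generalizing S with
  | _ n ih =>
  rcases lt_or_ge S.toFinset.card M with h | h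
  · exact ⟨S, fun _ h => h, h, rfl⟩
  obtain ⟨U, hU, hUM⟩ := Finset.exists_subset_card_eq h
  -- A subset of `U` has at most `M` elements, so each coordinate of its sum is one of `2 * (M * K)
  -- + 1` integers.
  have hmaps : ∀ A ∈ U.powerset, ∑ c ∈ A, φ c ∈
      Fintype.piFinset fun _ : ι => Finset.Icc (-((M * K : ℕ) : ℤ)) ((M * K : ℕ) : ℤ) := by
    intro A hA
    rw [Finset.mem_powerset] at hA
    rw [Fintype.mem_piFinset]
    intro i
    rw [Finset.mem_Icc, ← abs_le, Finset.sum_apply]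
    refine (Finset.abs_sum_le_sum_abs _ _).trans ((Finset.sum_le_card_nsmul A _ (K : ℤ)
      fun c hc => hφ c (Multiset.mem_toFinset.1 (hU (hA hc))) i).trans ?_)
    rw [nsmul_eq_mul, Nat.cast_mul]
    have := Finset.card_le_card hA
    gcongr
    omega
  -- Pigeonhole: by `hM` the `2 ^ M` subsets of `U` outnumber the possible sums.
  obtain ⟨A, hA, B, hB, hAB, hsum⟩ := Finset.exists_ne_map_eq_of_card_lt_of_maps_to (by
    rw [Finset.card_powerset, hUM, Fintype.card_piFinset]
    simp only [Int.card_Icc, Finset.prod_const, Finset.card_univ]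
    convert hM using 2
    omega) hmaps
  rw [Finset.mem_powerset] at hA hB
  -- Removing the common elements makes the sets disjoint and keeps the sums equal. As the sets
  -- differ, one of the differences is nonempty and is taken as `A`; `B` may be empty.
  obtain ⟨A, B, hA, hB, hdisj, hne, hsum⟩ : ∃ A B : Finset C, A ⊆ U ∧ B ⊆ U ∧ Disjoint A B ∧
      A.Nonempty ∧ ∑ c ∈ A, φ c = ∑ c ∈ B, φ c := by
    have key : ∀ A B : Finset C, A ⊆ U → B ⊆ U → ∑ c ∈ A, φ c = ∑ c ∈ B, φ c →
        ¬A ⊆ B → ∃ A B : Finset C, A ⊆ U ∧ B ⊆ U ∧ Disjoint A B ∧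
      A.Nonempty ∧ ∑ c ∈ A, φ c = ∑ c ∈ B, φ c := fun A B hA hB h hAB =>
      ⟨A \ B, B \ A, Finset.sdiff_subset.trans hA, Finset.sdiff_subset.trans hB,
        disjoint_sdiff_sdiff, Finset.sdiff_nonempty.2 hAB, by
          have h1 := Finset.sum_inter_add_sum_sdiff A B φ
          have h2 := Finset.sum_inter_add_sum_sdiff B A φ
          rw [Finset.inter_comm B A] at h2
          exact add_left_cancel ((h1.trans h).trans h2.symm)⟩
    by_cases h : A ⊆ B
    · exact key B A hB hA hsum.symm fun h' => hAB (h.antisymm h')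
    · exact key A B hA hB hsum h
  -- Let `a` be the rarest element of `A`, with `k` copies. Then `k` copies of all of `A` can be
  -- removed, which uses up `a`, and the `k` copies of the disjoint set `B` do not bring it back.
  -- They bring in nothing new either, since `B` consists of elements of `S`; hence the number of
  -- distinct elements drops.
  obtain ⟨a, ha, hmin⟩ := A.exists_min_image (fun c => S.count c) hne
  set k := S.count a with hk
  have hle : k • A.val ≤ S := by
    rw [Multiset.le_iff_count]
    intro c
    rw [Multiset.count_nsmul]
    by_cases hc : c ∈ A
    · rw [Multiset.count_eq_one_of_mem A.nodup hc, mul_one]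
      exact hmin c hc
    · rw [Multiset.count_eq_zero_of_notMem hc]; simp
  have hS : S - k • A.val + k • A.val = S := tsub_add_cancel_of_le hle
  have hsub : S - k • A.val + k • B.val ⊆ S := by
    intro c hc
    rcases Multiset.mem_add.1 hc with hc | hc
    · exact Multiset.mem_of_le (Multiset.sub_le_self _ _) hc
    · exact Multiset.mem_toFinset.1 (hU (hB (Multiset.mem_of_mem_nsmul hc)))
  have ha' : a ∉ S - k • A.val + k • B.val := by
    rw [← Multiset.count_eq_zero, Multiset.count_add, Multiset.count_sub, Multiset.count_nsmul,
      Multiset.count_nsmul, Multiset.count_eq_one_of_mem A.nodup ha,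
      Multiset.count_eq_zero_of_notMem (Finset.disjoint_left.1 hdisj ha : a ∉ B.val)]
    simp [hk]
  have hlt : (S - k • A.val + k • B.val).toFinset.card < S.toFinset.card := by
    refine Finset.card_lt_card ⟨Multiset.toFinset_subset.2 hsub, fun h => ?_⟩
    exact ha' (Multiset.mem_toFinset.1 (h (hU (hA ha))))
  obtain ⟨S', h1, h2, h3⟩ := ih _ (hn ▸ hlt) _ (fun c hc => hφ c (hsub hc)) rfl
  refine ⟨S', fun c hc => hsub (h1 hc), h2, h3.trans ?_⟩
  conv_rhs => rw [← hS]
  simp only [Multiset.map_add, Multiset.sum_add, Multiset.map_nsmul, Multiset.sum_nsmul]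
  congr 2
  exact hsum.symm

/-! ### Feasible vectors as multisets of configurations -/

namespace QuadraticHugeNFoldIP

variable (I : QuadraticHugeNFoldIP)

/-- `c` satisfies the constraints of a single brick of type `i`. -/
def IsConfiguration (i : Fin I.τ) (c : Fin I.t → ℤ) : Prop :=
  (∀ a, ∑ j, I.E₂ i a j * c j = I.b i a) ∧ ∀ j, I.l i j ≤ c j ∧ c j ≤ I.u i j

theorem isFeasible_iff (x : I.Brick × Fin I.t → ℤ) : I.IsFeasible x ↔
    (∀ p : I.Brick, I.IsConfiguration p.1 fun j => x (p, j)) ∧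
      ∀ a, ∑ p : I.Brick, ∑ j, I.E₁ p.1 a j * x (p, j) = I.b₀ a := by
  have h1 : ∀ a, I.matrix.mulVec x (Sum.inl a) = ∑ p : I.Brick, ∑ j, I.E₁ p.1 a j * x (p, j) := by
    intro a
    simp [Matrix.mulVec, dotProduct, matrix, Fintype.sum_prod_type]
  have h2 : ∀ p c, I.matrix.mulVec x (Sum.inr (p, c)) = ∑ j, I.E₂ p.1 c j * x (p, j) := by
    intro p c
    simp only [Matrix.mulVec, dotProduct, matrix, Fintype.sum_prod_type, Matrix.of_apply, ite_mul,
      zero_mul]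
    rw [Finset.sum_eq_single p]
    · simp
    · intro q _ hq
      simp [hq.symm]
    · simp
  simp only [IsFeasible, funext_iff, Sum.forall, Prod.forall, h1, h2, rhs, IsConfiguration]
  constructor
  · rintro ⟨⟨h, h'⟩, h''⟩
    exact ⟨fun p => ⟨h' p, h'' p⟩, h⟩
  · rintro ⟨h, h'⟩
    exact ⟨⟨h', fun p => (h p).1⟩, fun p => (h p).2⟩

/-- A multiset of configurations with the right number of configurations of each type is the
multiset of the bricks of some vector. -/
theorem exists_bricks (S : Multiset (Fin I.τ × (Fin I.t → ℤ)))
    (hS : ∀ i, (S.filter fun c => c.1 = i).card = I.μ i) :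
    ∃ x : I.Brick × Fin I.t → ℤ, (∀ p : I.Brick, (p.1, fun j => x (p, j)) ∈ S) ∧
      ∀ {G : Type} [AddCommMonoid G] (F : Fin I.τ × (Fin I.t → ℤ) → G),
        ∑ p : I.Brick, F (p.1, fun j => x (p, j)) = (S.map F).sum := by
  -- The configurations of type `i`, with multiplicity, are listed in some order and assigned to the
  -- bricks of type `i`.
  have hex : ∀ i, ∃ g : Fin (I.μ i) → Fin I.τ × (Fin I.t → ℤ),
      (List.ofFn g : Multiset _) = S.filter fun c => c.1 = i := by
    intro i
    have hl : (S.filter fun c => c.1 = i).toList.length = I.μ i := by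
      rw [Multiset.length_toList, hS]
    refine ⟨fun m => (S.filter fun c => c.1 = i).toList.get (m.cast hl.symm), ?_⟩
    have : List.ofFn (fun m => (S.filter fun c => c.1 = i).toList.get (m.cast hl.symm)) =
        (S.filter fun c => c.1 = i).toList := by
      refine List.ext_getElem (by simp [hS]) fun n h1 h2 => by simp
    rw [this, Multiset.coe_toList]
  choose g hg using hex
  have hmem : ∀ i m, g i m ∈ S ∧ (g i m).1 = i := fun i m => by
    have : g i m ∈ S.filter fun c => c.1 = i := by rw [← hg i]; simp
    simpa using this
  have he : ∀ p : I.Brick, (p.1, fun j => (g p.1 p.2).2 j) = g p.1 p.2 := fun p =>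
    Prod.ext (hmem _ _).2.symm rfl
  refine ⟨fun q => (g q.1.1 q.1.2).2 q.2, fun p => by simpa only [he] using (hmem p.1 p.2).1,
    fun F => ?_⟩
  simp only [he]
  rw [Fintype.sum_sigma]
  have h1 : ∀ i, ∑ m, F (g i m) = ((S.filter fun c => c.1 = i).map F).sum := by
    intro i
    rw [← hg i, Multiset.map_coe, Multiset.sum_coe, List.map_ofFn, List.sum_ofFn]
    rfl
  simp only [h1]
  have h2 : ∀ T : Multiset (Fin I.τ × (Fin I.t → ℤ)),
      ∑ i, ((T.filter fun c => c.1 = i).map F).sum = (T.map F).sum := by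
    intro T
    induction T using Multiset.induction_on with
    | empty => simp
    | cons a T ih =>
      have : ∀ i, (((a ::ₘ T).filter fun c => c.1 = i).map F).sum =
          (if a.1 = i then F a else 0) + ((T.filter fun c => c.1 = i).map F).sum := by
        intro i
        by_cases h : a.1 = i <;> simp [h]
      simp only [this, Finset.sum_add_distrib, ih]
      simp
  exact h2 S

/-- The integral value of the objective function of a brick. -/
noncomputable def value (i : Fin I.τ) (c : Fin I.t → ℤ) : ℤ := (I.integral i c).choose

theorem f_eq_value (i : Fin I.τ) (c : Fin I.t → ℤ) : I.f i (fun j => (c j : ℝ)) = I.value i c :=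
  (I.integral i c).choose_spec

theorem objective_eq (x : I.Brick × Fin I.t → ℤ) :
    I.objective x = ((∑ p : I.Brick, I.value p.1 fun j => x (p, j) : ℤ) : ℝ) := by
  simp only [objective, Int.cast_sum, ← f_eq_value]

variable {I} in
theorem IsConfiguration.abs_coord_lt {i : Fin I.τ} {c : Fin I.t → ℤ} (h : I.IsConfiguration i c)
    (j : Fin I.t) : |c j| < 2 ^ I.encode.length := by
  have h1 := abs_lt.1 (abs_l_lt (i := i) j)
  have h2 := abs_lt.1 (abs_u_lt (i := i) j)
  have h3 := h.2 j
  rw [abs_lt]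
  constructor <;> omega

/-- The entries of `b₀` account for `r` and the multiplicities for `τ`. -/
theorem card_index_le : I.τ + I.r + 4 ≤ I.encode.length := by
  have h1 := I.length_tokens_le
  rw [length_tokens, mul_add I.τ _ 1] at h1
  omega

/-- A block type is needed: in an instance without any, `t` is written only as a binary number and
may be exponential in the encoding length. -/
theorem t_le (i : Fin I.τ) : I.t ≤ I.encode.length := by
  have h1 := I.length_tokens_le
  rw [length_tokens] at h1
  have h2 : 0 < I.τ := i.pos
  have h3 : 1 * (I.r * I.t + I.s * I.t + I.t + I.t + I.s + 6 * I.t + 1) ≤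
    I.τ * (I.r * I.t + I.s * I.t + I.t + I.t + I.s + 6 * I.t + 1) := Nat.mul_le_mul_right _ h2
  have h4 := Nat.zero_le (I.r * I.t)
  omega

theorem s_le (i : Fin I.τ) : I.s ≤ I.encode.length := by
  have h1 := I.length_tokens_le
  rw [length_tokens] at h1
  have h2 : 0 < I.τ := i.pos
  have h3 : 1 * (I.r * I.t + I.s * I.t + I.t + I.t + I.s + 6 * I.t + 1) ≤
    I.τ * (I.r * I.t + I.s * I.t + I.t + I.t + I.s + 6 * I.t + 1) := Nat.mul_le_mul_right _ h2
  have h4 := Nat.zero_le (I.r * I.t)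
  omega

theorem _root_.Rat.abs_le_abs_num (q : ℚ) : |(q : ℝ)| ≤ |(q.num : ℝ)| := by
  rw [Rat.cast_def, abs_div]
  refine div_le_self (abs_nonneg _) ?_
  rw [Nat.abs_cast]
  exact_mod_cast q.pos

theorem abs_linking_le {i : Fin I.τ} {c : Fin I.t → ℤ} (h : I.IsConfiguration i c)
    (a : Fin I.r) : |∑ j, I.E₁ i a j * c j| ≤ 2 ^ (4 * I.encode.length + 2) := by
  set L := I.encode.length
  have h1 : |∑ j, I.E₁ i a j * c j| ≤ ∑ j : Fin I.t, (2 : ℤ) ^ L * 2 ^ L := by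
    refine (Finset.abs_sum_le_sum_abs _ _).trans (Finset.sum_le_sum fun j _ => ?_)
    rw [abs_mul]
    exact mul_le_mul (abs_E₁_lt j a).le (h.abs_coord_lt j).le (abs_nonneg _) (by positivity)
  refine h1.trans ?_
  simp only [Finset.sum_const, Finset.card_univ, Fintype.card_fin, nsmul_eq_mul]
  have h2 : (I.t : ℤ) ≤ 2 ^ L := by
    exact_mod_cast (I.t_le i).trans Nat.lt_two_pow_self.le
  calc (I.t : ℤ) * (2 ^ L * 2 ^ L) ≤ 2 ^ L * (2 ^ L * 2 ^ L) := by gcongr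
    _ = 2 ^ (3 * L) := by ring
    _ ≤ 2 ^ (4 * L + 2) := pow_le_pow_right₀ (by norm_num) (by omega)

theorem abs_value_le {i : Fin I.τ} {c : Fin I.t → ℤ} (h : I.IsConfiguration i c) :
    |I.value i c| ≤ 2 ^ (4 * I.encode.length + 2) := by
  set L := I.encode.length with hL
  have h1 : |(I.value i c : ℝ)| ≤ ∑ j : Fin I.t, (3 : ℝ) * 2 ^ (3 * L) := by
    rw [← f_eq_value, f, separableQuadratic]
    refine (Finset.abs_sum_le_sum_abs _ _).trans (Finset.sum_le_sum fun j _ => ?_)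
    have ha : |(I.α i j : ℝ)| ≤ 2 ^ L := (Rat.abs_le_abs_num _).trans (by
      exact_mod_cast (abs_α_lt j).1.le)
    have hb : |(I.β i j : ℝ)| ≤ 2 ^ L := (Rat.abs_le_abs_num _).trans (by
      exact_mod_cast (abs_β_lt j).1.le)
    have hg : |(I.γ i j : ℝ)| ≤ 2 ^ L := (Rat.abs_le_abs_num _).trans (by
      exact_mod_cast (abs_γ_lt j).1.le)
    have hc : |(c j : ℝ)| ≤ 2 ^ L := by exact_mod_cast (h.abs_coord_lt j).le
    have h2 : |(I.α i j : ℝ) * c j ^ 2| ≤ 2 ^ (3 * L) := by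
      rw [abs_mul, abs_pow]
      calc _ ≤ (2 : ℝ) ^ L * (2 ^ L) ^ 2 := by gcongr
        _ = 2 ^ (3 * L) := by ring
    have h3 : |(I.β i j : ℝ) * c j| ≤ 2 ^ (3 * L) := by
      rw [abs_mul]
      calc _ ≤ (2 : ℝ) ^ L * 2 ^ L := by gcongr
        _ = 2 ^ (2 * L) := by ring
        _ ≤ 2 ^ (3 * L) := pow_le_pow_right₀ (by norm_num) (by omega)
    have h4 : |(I.γ i j : ℝ)| ≤ 2 ^ (3 * L) :=
      hg.trans (pow_le_pow_right₀ (by norm_num) (by omega))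
    have h5 := abs_add_le ((I.α i j : ℝ) * c j ^ 2 + (I.β i j : ℝ) * c j) (I.γ i j)
    have h6 := abs_add_le ((I.α i j : ℝ) * c j ^ 2) ((I.β i j : ℝ) * c j)
    linarith
  simp only [Finset.sum_const, Finset.card_univ, Fintype.card_fin, nsmul_eq_mul] at h1
  have h2 : (I.t : ℝ) ≤ 2 ^ L := by
    exact_mod_cast (I.t_le i).trans Nat.lt_two_pow_self.le
  have h3 : |(I.value i c : ℝ)| ≤ 2 ^ (4 * L + 2) := by
    refine h1.trans ?_
    calc (I.t : ℝ) * (3 * 2 ^ (3 * L)) ≤ 2 ^ L * (4 * 2 ^ (3 * L)) := by gcongr; norm_num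
      _ = 2 ^ (4 * L + 2) := by ring
  exact_mod_cast h3

/-- The counting inequality of the exchange argument for coordinates of size `2 ^ (4 * L + 2)`.
Since `M ≤ 2 ^ (2 * L + 3)`, the base is at most `2 ^ (6 * L + 7)`, and `(6 * L + 7) * L < 8 * (L +
1) ^ 2`. -/
theorem index_bound (L M n : ℕ) (hM : M = 8 * (L + 1) ^ 2) (hn : n ≤ L) :
    (2 * (M * 2 ^ (4 * L + 2)) + 1) ^ n < 2 ^ M := by
  have h1 : M ≤ 2 ^ (2 * L + 3) := by
    have : L + 1 ≤ 2 ^ L := Nat.lt_two_pow_self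
    calc M = 8 * (L + 1) ^ 2 := hM
      _ ≤ 8 * (2 ^ L) ^ 2 := by gcongr
      _ = 2 ^ (2 * L + 3) := by ring
  have h2 : 2 * (M * 2 ^ (4 * L + 2)) + 1 ≤ 2 ^ (6 * L + 7) := by
    have h3 : M * 2 ^ (4 * L + 2) ≤ 2 ^ (6 * L + 5) := by
      calc M * 2 ^ (4 * L + 2) ≤ 2 ^ (2 * L + 3) * 2 ^ (4 * L + 2) := by gcongr
        _ = 2 ^ (6 * L + 5) := by ring
    have h4 : (2 : ℕ) ^ (6 * L + 7) = 4 * 2 ^ (6 * L + 5) := by ring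
    have : 1 ≤ 2 ^ (6 * L + 5) := Nat.one_le_two_pow
    omega
  calc (2 * (M * 2 ^ (4 * L + 2)) + 1) ^ n ≤ (2 ^ (6 * L + 7)) ^ n := by gcongr
    _ = 2 ^ ((6 * L + 7) * n) := by rw [← pow_mul]
    _ < 2 ^ M := by
      refine Nat.pow_lt_pow_right (by norm_num) ?_
      rw [hM]
      nlinarith [Nat.mul_le_mul_left (6 * L + 7) hn]

/-- Every feasible vector can be replaced by one of the same objective value with few
configurations. -/
theorem exists_few_configurations (x : I.Brick × Fin I.t → ℤ) (hx : I.IsFeasible x) :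
    ∃ x', I.IsFeasible x' ∧ I.objective x' = I.objective x ∧
      (I.usedConfigurations x').ncard ≤ 8 * (I.encode.length + 1) ^ 2 := by
  classical
  rw [isFeasible_iff] at hx
  let S : Multiset (Fin I.τ × (Fin I.t → ℤ)) :=
    (Finset.univ : Finset I.Brick).val.map fun p => (p.1, fun j => x (p, j))
  have hSmem : ∀ c ∈ S, I.IsConfiguration c.1 c.2 := by
    intro c hc
    obtain ⟨p, -, rfl⟩ := Multiset.mem_map.1 hc
    exact hx.1 p
  -- Preserving the sum of `φ` preserves the number of bricks of each type, the linking rows and the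
  -- objective value. The constraints of single bricks survive because no new configuration appears.
  let φ : Fin I.τ × (Fin I.t → ℤ) → Fin I.τ ⊕ Fin I.r ⊕ Unit → ℤ := fun c =>
    Sum.elim (fun i => if c.1 = i then 1 else 0)
      (Sum.elim (fun a => ∑ j, I.E₁ c.1 a j * c.2 j) fun _ => I.value c.1 c.2)
  obtain ⟨S', hsub, hcard, hsum⟩ := Multiset.exists_card_toFinset_lt φ
    (2 ^ (4 * I.encode.length + 2)) (8 * (I.encode.length + 1) ^ 2)
    (index_bound _ _ _ rfl (by
      have := I.card_index_le
      simp only [Fintype.card_sum, Fintype.card_fin, Fintype.card_unit]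
      omega)) S (fun c hc k => by
      rcases k with i | a | _
      · simp only [φ, Sum.elim_inl]
        split_ifs
        · rw [abs_one]; exact_mod_cast Nat.one_le_two_pow
        · simp
      · simpa [φ] using I.abs_linking_le (hSmem c hc) a
      · simpa [φ] using I.abs_value_le (hSmem c hc))
  have hφ : ∀ k, (S'.map fun c => φ c k).sum = (S.map fun c => φ c k).sum := by
    have ev : ∀ (T : Multiset (Fin I.τ × (Fin I.t → ℤ))) k,
        (T.map φ).sum k = (T.map fun c => φ c k).sum := by
      intro T k
      induction T using Multiset.induction_on with
      | empty => simp
      | cons a T ih => simp [ih]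
    intro k
    rw [← ev, ← ev, hsum]
  have hcount : ∀ (T : Multiset (Fin I.τ × (Fin I.t → ℤ))) i,
      (T.map fun c => φ c (Sum.inl i)).sum = (T.filter fun c => c.1 = i).card := by
    intro T i
    induction T using Multiset.induction_on with
    | empty => simp
    | cons a T ih =>
      rw [Multiset.map_cons, Multiset.sum_cons, ih]
      by_cases h : a.1 = i
      · simp [φ, h, add_comm]
      · simp [φ, h]
  have hScard : ∀ i, (S.filter fun c => c.1 = i).card = I.μ i := by
    intro i
    have h1 := hcount S i
    have h2 : (S.map fun c => φ c (Sum.inl i)).sum = I.μ i := by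
      simp only [S, Multiset.map_map]
      change ∑ p : I.Brick, (if p.1 = i then (1 : ℤ) else 0) = I.μ i
      rw [Fintype.sum_sigma, Finset.sum_eq_single i]
      · simp
      · intro j _ hj; simp [hj]
      · simp
    exact_mod_cast h1.symm.trans h2
  obtain ⟨x', hmem, hF⟩ := I.exists_bricks S' fun i => by
    have := hφ (Sum.inl i)
    rw [hcount, hcount] at this
    rw [← hScard i]
    exact_mod_cast this
  have hSF : ∀ F : Fin I.τ × (Fin I.t → ℤ) → ℤ,
      (S.map F).sum = ∑ p : I.Brick, F (p.1, fun j => x (p, j)) := fun F => by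
    simp only [S, Multiset.map_map]
    rfl
  refine ⟨x', (I.isFeasible_iff x').2 ⟨fun p => hSmem _ (hsub (hmem p)), fun a => ?_⟩, ?_, ?_⟩
  · rw [← hx.2 a]
    have h1 := hφ (Sum.inr (Sum.inl a))
    have h2 := hF fun c => φ c (Sum.inr (Sum.inl a))
    rw [hSF] at h1
    exact h2.trans h1
  · rw [objective_eq, objective_eq]
    have h1 := hφ (Sum.inr (Sum.inr ()))
    have h2 := hF fun c => φ c (Sum.inr (Sum.inr ()))
    rw [hSF] at h1
    exact congr_arg _ (h2.trans h1)
  · have : I.usedConfigurations x' ⊆ (S'.toFinset : Set (Fin I.τ × (Fin I.t → ℤ))) := by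
      rintro _ ⟨p, rfl⟩
      exact Multiset.mem_toFinset.2 (hmem p)
    refine (Set.ncard_le_ncard this (Finset.finite_toSet _)).trans ?_
    rw [Set.ncard_coe_finset]
    exact hcard.le

theorem exists_isOptimal (h : ∃ x, I.IsFeasible x) : ∃ x, I.IsOptimal x := by
  have hfin : {x | I.IsFeasible x}.Finite :=
    (Set.finite_Icc (fun q : I.Brick × Fin I.t => I.l q.1.1 q.2) (fun q => I.u q.1.1 q.2)).subset
      fun x hx => ⟨fun q => (hx.2 q.1 q.2).1, fun q => (hx.2 q.1 q.2).2⟩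
  obtain ⟨x, hx, hmin⟩ := Set.exists_min_image _ I.objective hfin h
  exact ⟨x, hx, hmin⟩

end QuadraticHugeNFoldIP

/-- The reduction keeps the objective value, so it turns an optimal solution into an optimal one. -/
theorem exists_polynomial_optimal_configurations :
    ∃ p : Polynomial ℕ, ∀ I : QuadraticHugeNFoldIP, (∃ x, I.IsFeasible x) →
      ∃ x, I.IsOptimal x ∧ (I.usedConfigurations x).ncard ≤ p.eval I.encode.length := by
  refine ⟨8 * (Polynomial.X + 1) ^ 2, fun I h => ?_⟩
  obtain ⟨x, hx⟩ := I.exists_isOptimal h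
  obtain ⟨x', hx', hobj, hcard⟩ := I.exists_few_configurations x hx.1
  exact ⟨x', ⟨hx', fun z hz => hobj.trans_le (hx.2 z hz)⟩, by simpa using hcard⟩

/-! ### The verifier -/

/-- The numeric code of an input symbol. -/
def symCode : Option Γ' → ℕ
  | none => 0
  | some (.bit true) => 1
  | some (.bit false) => 2
  | some .comma => 4
  | some .blank => 6
  | some .bra => 8
  | some .ket => 10

theorem symCode_injective : Function.Injective symCode := by
  intro a b
  rcases a with _ | _ | (_ | _) | _ | _ | _ <;> rcases b with _ | _ | (_ | _) | _ | _ | _ <;>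
    simp [symCode]

/-- The tree of an input symbol. -/
def symTree (a : Option Γ') : BinTree := BinTree.natTree (symCode a)

namespace BinTree

/-- The scalar product of two vectors of integers. -/
def dot (v w : BinTree) : ℤ :=
  ((List.zipWith node v.toList w.toList).map fun e => e.fst.intVal * e.snd.intVal).sum

/-- The encoding of an integer, as a list of trees of symbols. -/
def emitToken (a : BinTree) : List BinTree :=
  ifNil a.snd (symTree (some (.bit false))) (symTree (some (.bit true))) ::
    ((a.fst.toList ++ a.snd.toList).map fun d =>
      ifNil d (symTree (some (.bit false))) (symTree (some (.bit true)))) ++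
    [symTree (some .comma)]

/-- The sign and the binary digits of an integer are those of its encoding. -/
def IsCanonical (a : BinTree) : Prop :=
  (a.fst = nil ∨ a.snd = nil) ∧
    (ofList (a.fst.toList ++ a.snd.toList).reverse = nil ∨
      (ofList (a.fst.toList ++ a.snd.toList).reverse).fst ≠ nil)

/-- The trees of the integers in the description of a block type. A block type is a tuple that
consists of the rows of `E₁`, the pairs of an entry of `b` and the corresponding row of `E₂`, the data
of the coordinates, the multiplicity, the value of the objective function at `0`, a common
denominator of the entries of `γ`, and the configurations together with their multiplicities. The
data of a coordinate consist of the entries of `l`, `u`, `α`, `β`, `γ`, the integers `α + β`, `α - β`,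
and the multiple of `γ` by the common denominator. Rational numbers consist of numerator and
denominator and of integers that witness their being coprime. -/
def certTypeTokens (y : BinTree) : List BinTree :=
  (y.arg 0).toList.flatMap (fun row => row.toList) ++
    (y.arg 1).toList.flatMap (fun row => (row.arg 1).toList) ++
    (y.arg 2).toList.map (fun c => c.arg 0) ++ (y.arg 2).toList.map (fun c => c.arg 1) ++
    (y.arg 1).toList.map (fun row => row.arg 0) ++
    (y.arg 2).toList.flatMap (fun c => [(c.arg 2).arg 0, (c.arg 2).arg 1]) ++
    (y.arg 2).toList.flatMap (fun c => [(c.arg 3).arg 0, (c.arg 3).arg 1]) ++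
    (y.arg 2).toList.flatMap (fun c => [(c.arg 4).arg 0, (c.arg 4).arg 1]) ++ [y.arg 3]

/-- The trees of the integers in the description of an instance and of the bound `k`. -/
def certTokens (y : BinTree) : List BinTree :=
  [y.arg 0, y.arg 1, y.arg 2, y.arg 3, y.arg 4] ++ (y.arg 5).toList ++
    (y.arg 6).toList.flatMap certTypeTokens

/-- A numerator and a positive denominator are coprime. -/
def RatCheck (q : BinTree) : Prop :=
  0 < (q.arg 1).intVal ∧
    (q.arg 0).intVal * (q.arg 2).intVal + (q.arg 1).intVal * (q.arg 3).intVal = 1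

/-- The data of a coordinate of type `y` are correct. -/
def CoordCheck (y c : BinTree) : Prop :=
  RatCheck (c.arg 2) ∧ RatCheck (c.arg 3) ∧ RatCheck (c.arg 4) ∧
    0 ≤ ((c.arg 2).arg 0).intVal ∧
    ((c.arg 2).arg 0).intVal * ((c.arg 3).arg 1).intVal +
      ((c.arg 3).arg 0).intVal * ((c.arg 2).arg 1).intVal =
      (c.arg 5).intVal * (((c.arg 2).arg 1).intVal * ((c.arg 3).arg 1).intVal) ∧
    ((c.arg 2).arg 0).intVal * ((c.arg 3).arg 1).intVal -
      ((c.arg 3).arg 0).intVal * ((c.arg 2).arg 1).intVal =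
      (c.arg 6).intVal * (((c.arg 2).arg 1).intVal * ((c.arg 3).arg 1).intVal) ∧
    (c.arg 7).intVal * ((c.arg 4).arg 1).intVal = ((c.arg 4).arg 0).intVal * (y.arg 5).intVal

/-- Twice the nonconstant part of the objective function in the coordinate `c`. -/
def quadValue (c x : BinTree) : ℤ :=
  ((c.arg 5).intVal + (c.arg 6).intVal) * (x.intVal * x.intVal) +
    ((c.arg 5).intVal - (c.arg 6).intVal) * x.intVal

/-- Twice the objective value of a brick of type `y` with the value `v`. -/
def brickValue (y v : BinTree) : ℤ :=
  ((List.zipWith node (y.arg 2).toList v.toList).map fun e => quadValue e.fst e.snd).sum +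
    2 * (y.arg 4).intVal

/-- The pair `p` of a multiplicity and a vector is a configuration of type `y`. -/
def ConfigCheck (y p : BinTree) : Prop :=
  0 ≤ (p.arg 0).intVal ∧ ((p.arg 1).toList.length : ℤ) = (y.arg 2).toList.length ∧
    (∀ e ∈ List.zipWith node (y.arg 2).toList (p.arg 1).toList,
      (e.fst.arg 0).intVal ≤ e.snd.intVal ∧ e.snd.intVal ≤ (e.fst.arg 1).intVal) ∧
    ∀ row ∈ (y.arg 1).toList, dot (row.arg 1) (p.arg 1) = (row.arg 0).intVal

/-- The data of the block type `y` of the certificate `c` are correct. -/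
def TypeCheck (c y : BinTree) : Prop :=
  ((y.arg 0).toList.length : ℤ) = (c.arg 5).toList.length ∧
    (∀ row ∈ (y.arg 0).toList, (row.toList.length : ℤ) = (c.arg 4).intVal) ∧
    ((y.arg 1).toList.length : ℤ) = (c.arg 3).intVal ∧
    (∀ row ∈ (y.arg 1).toList, ((row.arg 1).toList.length : ℤ) = (c.arg 4).intVal) ∧
    ((y.arg 2).toList.length : ℤ) = (c.arg 4).intVal ∧
    (∀ d ∈ (y.arg 2).toList, CoordCheck y d) ∧
    0 < (y.arg 5).intVal ∧
    ((y.arg 2).toList.map fun d => (d.arg 7).intVal).sum = (y.arg 4).intVal * (y.arg 5).intVal ∧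
    ((y.arg 6).toList.map fun p => (p.arg 0).intVal).sum = (y.arg 3).intVal ∧
    ∀ p ∈ (y.arg 6).toList, ConfigCheck y p

/-- The certificate `c` shows that the word `w` belongs to the language. It consists of the bound
`k`, the numbers `τ`, `r`, `s`, `t`, the vector `b₀`, and the block types. -/
def Accepts (w : List BinTree) (c : BinTree) : Prop :=
  (∀ a ∈ certTokens c, IsCanonical a) ∧
    ((certTokens c).flatMap emitToken).map natVal = w.map natVal ∧
    ((c.arg 6).toList.length : ℤ) = (c.arg 1).intVal ∧
    ((c.arg 5).toList.length : ℤ) = (c.arg 2).intVal ∧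
    0 ≤ (c.arg 3).intVal ∧ 0 ≤ (c.arg 4).intVal ∧
    (∀ y ∈ (c.arg 6).toList, TypeCheck c y) ∧
    (∀ n < (c.arg 5).toList.length, ((c.arg 6).toList.map fun y =>
      ((y.arg 6).toList.map fun p =>
        (p.arg 0).intVal * dot ((y.arg 0).arg n) (p.arg 1)).sum).sum =
          ((c.arg 5).arg n).intVal) ∧
    ((c.arg 6).toList.map fun y => ((y.arg 6).toList.map fun p =>
      (p.arg 0).intVal * brickValue y (p.arg 1)).sum).sum ≤ 2 * (c.arg 0).intVal

theorem arg_eq_getD (x : BinTree) (n : ℕ) : x.arg n = x.toList.getD n nil := by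
  induction n generalizing x with
  | zero => cases x <;> rfl
  | succ n ih => cases x <;> simp [arg, ih]

end BinTree

/-! ### The checks of the verifier take polynomial time -/

namespace PolyComputable

open BinTree

variable {f g i : BinTree → BinTree}

theorem argLength (hf : PolyComputable f) (hi : PolyComputable i) :
    PolyComputable fun x => (f x).arg (i x).toList.length :=
  (hf.toList.getD hi).congr fun _ => (arg_eq_getD _ _).symm

theorem dot (hf : PolyComputable f) (hg : PolyComputable g) :
    PolyComputable fun x => dot (f x) (g x) :=
  sum (F := fun _ e => e.fst.intVal * e.snd.intVal) (hf.toList.zip hg.toList)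
    (id.snd.fst.intVal.mul id.snd.snd.intVal)

theorem emitToken (hf : PolyComputable f) : PolyComputable fun x => emitToken (f x) := by
  refine append (cons (ifNil hf.snd (tree _) (tree _)) (map (F := fun _ d => BinTree.ifNil d
    (symTree (some (.bit false))) (symTree (some (.bit true)))) (hf.fst.toList.append
    hf.snd.toList) (id.snd.ifNil (tree _) (tree _)))) (cons (tree _) nil)

theorem isCanonical (hf : PolyComputable f) : PolyComputable fun x => IsCanonical (f x) :=
  have h := (hf.fst.toList.append hf.snd.toList).reverse.ofList
  and (or hf.fst.eq_nil hf.snd.eq_nil) (or h.eq_nil h.fst.ne_nil)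

theorem certTypeTokens (hf : PolyComputable f) :
    PolyComputable fun x => certTypeTokens (f x) := by
  have h (n : ℕ) := (hf.arg n).toList
  have ht (n : ℕ) : PolyComputable fun x => ((f x).arg 2).toList.flatMap
      fun c => [(c.arg n).arg 0, (c.arg n).arg 1] :=
    flatMap (F := fun _ c => [(c.arg n).arg 0, (c.arg n).arg 1]) (h 2)
      (cons ((id.snd.arg n).arg 0) (cons ((id.snd.arg n).arg 1) nil))
  exact ((((((((flatMap (F := fun _ row => row.toList) (h 0) id.snd.toList).append
    (flatMap (F := fun _ row => (row.arg 1).toList) (h 1) (id.snd.arg 1).toList)).append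
    (map (F := fun _ c => c.arg 0) (h 2) (id.snd.arg 0))).append
    (map (F := fun _ c => c.arg 1) (h 2) (id.snd.arg 1))).append
    (map (F := fun _ c => c.arg 0) (h 1) (id.snd.arg 0))).append (ht 2)).append (ht 3)).append
    (ht 4)).append (cons (hf.arg 3) nil)

theorem certTokens (hf : PolyComputable f) : PolyComputable fun x => certTokens (f x) :=
  ((cons (hf.arg 0) (cons (hf.arg 1) (cons (hf.arg 2) (cons (hf.arg 3)
    (cons (hf.arg 4) nil))))).append (hf.arg 5).toList).append
    (flatMap (F := fun _ y => BinTree.certTypeTokens y) (hf.arg 6).toList id.snd.certTypeTokens)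

theorem ratCheck (hf : PolyComputable f) : PolyComputable fun x => RatCheck (f x) :=
  have h (n : ℕ) := (hf.arg n).intVal
  (zero.lt (h 1)).and ((((h 0).mul (h 2)).add ((h 1).mul (h 3))).eq one)

theorem coordCheck (hf : PolyComputable f) (hg : PolyComputable g) :
    PolyComputable fun x => CoordCheck (f x) (g x) :=
  have h (m n : ℕ) := ((hg.arg m).arg n).intVal
  have h' (m : ℕ) := (hg.arg m).intVal
  have p := (h 2 0).mul (h 3 1)
  have q := (h 3 0).mul (h 2 1)
  have d := (h 2 1).mul (h 3 1)
  (hg.arg 2).ratCheck.and ((hg.arg 3).ratCheck.and ((hg.arg 4).ratCheck.and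
    ((zero.le (h 2 0)).and (((p.add q).eq ((h' 5).mul d)).and (((p.sub q).eq
      ((h' 6).mul d)).and (((h' 7).mul (h 4 1)).eq ((h 4 0).mul (hf.arg 5).intVal)))))))

theorem quadValue (hf : PolyComputable f) (hg : PolyComputable g) :
    PolyComputable fun x => quadValue (f x) (g x) :=
  have h (n : ℕ) := (hf.arg n).intVal
  (((h 5).add (h 6)).mul (hg.intVal.mul hg.intVal)).add (((h 5).sub (h 6)).mul hg.intVal)

theorem brickValue (hf : PolyComputable f) (hg : PolyComputable g) :
    PolyComputable fun x => brickValue (f x) (g x) :=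
  (sum (F := fun _ e => BinTree.quadValue e.fst e.snd) ((hf.arg 2).toList.zip hg.toList)
    (id.snd.fst.quadValue id.snd.snd)).add (two.mul (hf.arg 4).intVal)

theorem configCheck (hf : PolyComputable f) (hg : PolyComputable g) :
    PolyComputable fun x => ConfigCheck (f x) (g x) :=
  (zero.le (hg.arg 0).intVal).and (((hg.arg 1).toList.length.eq (hf.arg 2).toList.length).and
    ((forall_mem (p := fun _ e => (e.fst.arg 0).intVal ≤ e.snd.intVal ∧
      e.snd.intVal ≤ (e.fst.arg 1).intVal) ((hf.arg 2).toList.zip (hg.arg 1).toList)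
      (((id.snd.fst.arg 0).intVal.le id.snd.snd.intVal).and
        (id.snd.snd.intVal.le (id.snd.fst.arg 1).intVal))).and
    (forall_mem (p := fun x row => BinTree.dot (row.arg 1) ((g x).arg 1) = (row.arg 0).intVal)
      (hf.arg 1).toList (((id.snd.arg 1).dot ((hg.comp id.fst).arg 1)).eq
        (id.snd.arg 0).intVal))))

theorem typeCheck (hf : PolyComputable f) (hg : PolyComputable g) :
    PolyComputable fun x => TypeCheck (f x) (g x) :=
  have hf' := hf.comp id.fst
  have hg' := hg.comp id.fst
  (((hg.arg 0).toList.length.eq (hf.arg 5).toList.length)).and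
  ((forall_mem (p := fun x row => (row.toList.length : ℤ) = ((f x).arg 4).intVal)
    (hg.arg 0).toList (id.snd.toList.length.eq (hf'.arg 4).intVal)).and
  (((hg.arg 1).toList.length.eq (hf.arg 3).intVal).and
  ((forall_mem (p := fun x row => ((row.arg 1).toList.length : ℤ) = ((f x).arg 4).intVal)
    (hg.arg 1).toList ((id.snd.arg 1).toList.length.eq (hf'.arg 4).intVal)).and
  (((hg.arg 2).toList.length.eq (hf.arg 4).intVal).and
  ((forall_mem (p := fun x d => CoordCheck (g x) d) (hg.arg 2).toList
    (hg'.coordCheck id.snd)).and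
  ((zero.lt (hg.arg 5).intVal).and
  (((sum (F := fun _ d => (d.arg 7).intVal) (hg.arg 2).toList (id.snd.arg 7).intVal).eq
    ((hg.arg 4).intVal.mul (hg.arg 5).intVal)).and
  (((sum (F := fun _ p => (p.arg 0).intVal) (hg.arg 6).toList (id.snd.arg 0).intVal).eq
    (hg.arg 3).intVal).and
  (forall_mem (p := fun x p => ConfigCheck (g x) p) (hg.arg 6).toList
    (hg'.configCheck id.snd))))))))))

theorem accepts {w : BinTree → List BinTree} (hw : PolyComputable w) (hf : PolyComputable f) :
    PolyComputable fun x => Accepts (w x) (f x) :=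
  have hf' := hf.comp id.fst
  (forall_mem (p := fun _ a => IsCanonical a) hf.certTokens id.snd.isCanonical).and
  ((map_natVal_eq (flatMap (F := fun _ a => BinTree.emitToken a) hf.certTokens
    id.snd.emitToken) hw).and
  (((hf.arg 6).toList.length.eq (hf.arg 1).intVal).and
  (((hf.arg 5).toList.length.eq (hf.arg 2).intVal).and
  ((zero.le (hf.arg 3).intVal).and
  ((zero.le (hf.arg 4).intVal).and
  ((forall_mem (p := fun x y => TypeCheck (f x) y) (hf.arg 6).toList
    (hf'.typeCheck id.snd)).and
  ((forall_lt (p := fun x n => (((f x).arg 6).toList.map fun y =>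
      ((y.arg 6).toList.map fun p =>
        (p.arg 0).intVal * BinTree.dot ((y.arg 0).arg n) (p.arg 1)).sum).sum =
          (((f x).arg 5).arg n).intVal) (hf.arg 5).toList
    ((sum (F := fun z y => ((y.arg 6).toList.map fun p =>
        (p.arg 0).intVal * BinTree.dot ((y.arg 0).arg z.snd.toList.length) (p.arg 1)).sum)
      (hf'.arg 6).toList
      (sum (F := fun z p => (p.arg 0).intVal *
        BinTree.dot ((z.snd.arg 0).arg z.fst.snd.toList.length) (p.arg 1))
        (id.snd.arg 6).toList
        ((id.snd.arg 0).intVal.mul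
          (((id.fst.snd.arg 0).argLength id.fst.fst.snd).dot (id.snd.arg 1))))).eq
      ((hf'.arg 5).argLength id.snd).intVal)).and
  ((sum (F := fun _ y => ((y.arg 6).toList.map fun p =>
      (p.arg 0).intVal * BinTree.brickValue y (p.arg 1)).sum) (hf.arg 6).toList
    (sum (F := fun z p => (p.arg 0).intVal * BinTree.brickValue z.snd (p.arg 1))
      (id.snd.arg 6).toList
      ((id.snd.arg 0).intVal.mul (id.fst.snd.brickValue (id.snd.arg 1))))).le
    (two.mul (hf.arg 0).intVal)))))))))

end PolyComputable

/-! ### The encoding of integers -/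

/-- The digit lists that encode positive numbers are exactly those whose most significant digit is
one; the converse is `getLast?_encodePosNum`. -/
theorem exists_encodePosNum_eq {l : List Bool} (h : l.getLast? = some true) :
    ∃ n, encodePosNum n = l := by
  induction l with
  | nil => simp at h
  | cons a l ih =>
    cases l with
    | nil =>
      obtain rfl : a = true := by simpa using h
      exact ⟨.one, rfl⟩
    | cons b l =>
      obtain ⟨n, hn⟩ := ih (by simpa using h)
      cases a
      · exact ⟨.bit0 n, by rw [encodePosNum, hn]⟩
      · exact ⟨.bit1 n, by rw [encodePosNum, hn]⟩

theorem getLast?_encodePosNum (n : PosNum) : (encodePosNum n).getLast? = some true := by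
  induction n with
  | one => rfl
  | bit1 n ih => simp [encodePosNum, List.getLast?_cons, ih]
  | bit0 n ih => simp [encodePosNum, List.getLast?_cons, ih]

theorem getLast?_encodeNat_ne (n : ℕ) : (encodeNat n).getLast? ≠ some false := by
  unfold encodeNat
  cases (n : Num) with
  | zero => simp [encodeNum]
  | pos p => simp [encodeNum, getLast?_encodePosNum]

namespace BinTree

/-- Whether a tree represents the digit `1`. -/
def isNode : BinTree → Bool
  | nil => false
  | node _ _ => true

theorem bit_bitTree_isNode (d : BinTree) : (bitTree d.isNode).bit = d.bit := by cases d <;> rfl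

theorem natVal_map_bitTree_isNode (x : BinTree) :
    (ofList ((x.toList.map isNode).map bitTree)).natVal = x.natVal := by
  induction x with
  | nil => rfl
  | node h t _ ih => simpa [ofList, bit_bitTree_isNode] using ih

/-- Uniqueness of the binary expansion without leading zeros. -/
theorem encodeNat_natVal {x : BinTree} (h : (x.toList.map isNode).getLast? ≠ some false) :
    encodeNat x.natVal = x.toList.map isNode := by
  cases hl : (x.toList.map isNode).getLast? with
  | none =>
    obtain rfl : x = nil := by
      cases x with
      | nil => rfl
      | node l r => simp at hl
    rfl
  | some b =>
    cases b with
    | false => exact absurd hl h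
    | true =>
      obtain ⟨n, hn⟩ := exists_encodePosNum_eq hl
      rw [← natVal_map_bitTree_isNode, ← hn, natVal_encodePosNum, encodeNat]
      have : ((n : ℕ) : Num) = Num.pos n := by
        simp
      rw [this, encodeNum]

theorem isCanonical_iff (a : BinTree) : IsCanonical a ↔ (a.fst = nil ∨ a.snd = nil) ∧
    ((a.fst.toList ++ a.snd.toList).map isNode).getLast? ≠ some false := by
  unfold IsCanonical
  refine and_congr_right fun _ => ?_
  rw [← List.head?_reverse, ← List.map_reverse]
  cases (a.fst.toList ++ a.snd.toList).reverse with
  | nil => simp [ofList]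
  | cons d l => cases d <;> simp [ofList, isNode]

theorem natVal_symTree (a : Option Γ') : (symTree a).natVal = symCode a := natVal_natTree _

theorem ifNil_symTree (d : BinTree) :
    (ifNil d (symTree (some (.bit false))) (symTree (some (.bit true)))).natVal =
      symCode (some (.bit d.isNode)) := by
  cases d <;> exact natVal_symTree _

/-- In a canonical tree one of the two components is empty, so the other one holds the digits of the
absolute value, and the second component is nonempty exactly for negative numbers. -/
theorem map_natVal_emitToken {a : BinTree} (h : IsCanonical a) :
    (emitToken a).map natVal = (encodeInteger a.intVal).map fun c => symCode (some c) := by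
  rw [isCanonical_iff] at h
  have key : a.snd.isNode = decide (a.intVal < 0) ∧
      (a.fst.toList ++ a.snd.toList).map isNode = encodeNat a.intVal.natAbs := by
    rcases h with ⟨h1 | h1, h2⟩
    · simp only [intVal, h1, toList_nil, List.nil_append, natVal_nil, Nat.cast_zero, zero_sub,
        Int.natAbs_neg, Int.natAbs_natCast] at h2 ⊢
      refine ⟨?_, (encodeNat_natVal h2).symm⟩
      have h3 := encodeNat_natVal h2
      cases hs : a.snd with
      | nil => simp [isNode]
      | node l r =>
        -- A nonempty digit list without leading zeros does not have the value zero, because zero is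
        -- encoded by the empty list; thus there is no negative zero.
        have h4 : a.snd.natVal ≠ 0 := fun h0 => by
          rw [h0, hs] at h3
          simp [encodeNat, encodeNum] at h3
        rw [hs] at h4
        simp only [isNode, Left.neg_neg_iff, Bool.true_eq, decide_eq_true_eq]
        omega
    · simp only [intVal, h1, toList_nil, List.append_nil, natVal_nil, Nat.cast_zero, sub_zero,
        Int.natAbs_natCast] at h2 ⊢
      exact ⟨by simp [isNode], (encodeNat_natVal h2).symm⟩
  unfold emitToken encodeInteger
  rw [← key.1, ← key.2]
  have h1 : (natVal ∘ fun d => ifNil d (symTree (some (.bit false))) (symTree (some (.bit true)))) =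
      (fun c => symCode (some c)) ∘ Γ'.bit ∘ isNode := funext ifNil_symTree
  simp only [List.map_append, List.map_cons, List.map_map, List.map_nil, ifNil_symTree,
    natVal_symTree, List.cons_append, h1]

/-- This replaces a parser of instances: the certified integers are encoded again and compared with
the word, symbol by symbol. Canonicity makes the new encoding the prescribed one, and injectivity of
the symbol codes makes the comparison exact. -/
theorem eq_of_map_natVal_eq {l : List BinTree} (h : ∀ a ∈ l, IsCanonical a) {w : List Γ'} :
    (l.flatMap emitToken).map natVal = (w.map fun c => symTree (some c)).map natVal ↔
      w = (l.map intVal).flatMap encodeInteger := by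
  have h1 : (l.flatMap emitToken).map natVal =
      ((l.map intVal).flatMap encodeInteger).map fun c => symCode (some c) := by
    rw [List.map_flatMap, List.map_flatMap, List.flatMap_map]
    exact List.flatMap_congr fun a ha => map_natVal_emitToken (h a ha)
  rw [h1, List.map_map]
  have h2 : (natVal ∘ fun c : Γ' => symTree (some c)) = fun c => symCode (some c) :=
    funext fun c => natVal_symTree _
  have h3 : Function.Injective fun c : Γ' => symCode (some c) :=
    symCode_injective.comp (Option.some_injective _)
  rw [h2, (List.map_injective_iff.2 h3).eq_iff, eq_comm]

/-- The canonical tree of an integer. -/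
def intTree : ℤ → BinTree
  | .ofNat n => node (natTree n) nil
  | .negSucc n => node nil (natTree (n + 1))

@[simp] theorem intVal_intTree (z : ℤ) : (intTree z).intVal = z := by
  cases z <;> simp [intTree, intVal]; omega

theorem isNode_bitTree (b : Bool) : (bitTree b).isNode = b := by cases b <;> rfl

theorem map_isNode_natTree (n : ℕ) : (natTree n).toList.map isNode = encodeNat n := by
  simp [natTree, Function.comp_def, isNode_bitTree]

theorem isCanonical_intTree (z : ℤ) : IsCanonical (intTree z) := by
  rw [isCanonical_iff]
  cases z <;> simpa [intTree, map_isNode_natTree] using getLast?_encodeNat_ne _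

/-! ### Components of tuples -/

theorem toList_eq_ofFn {x : BinTree} {n : ℕ} (h : x.toList.length = n) :
    x.toList = List.ofFn fun j : Fin n => x.arg j := by
  subst h
  refine List.ext_getElem (by simp) fun i h1 h2 => ?_
  simp [arg_eq_getD]

theorem forall_mem_toList {x : BinTree} {n : ℕ} (h : x.toList.length = n) {p : BinTree → Prop} :
    (∀ a ∈ x.toList, p a) ↔ ∀ j : Fin n, p (x.arg j) := by
  rw [toList_eq_ofFn h, List.forall_mem_ofFn_iff]

theorem sum_map_toList {M : Type*} [AddCommMonoid M] {x : BinTree} {n : ℕ}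
    (h : x.toList.length = n) (F : BinTree → M) :
    (x.toList.map F).sum = ∑ j : Fin n, F (x.arg j) := by
  rw [toList_eq_ofFn h, List.map_ofFn, List.sum_ofFn]
  rfl

theorem zipWith_node_toList {x y : BinTree} {n : ℕ} (hx : x.toList.length = n)
    (hy : y.toList.length = n) :
    List.zipWith node x.toList y.toList = List.ofFn fun j : Fin n => node (x.arg j) (y.arg j) := by
  rw [toList_eq_ofFn hx, toList_eq_ofFn hy]
  exact List.ext_getElem (by simp) fun i h1 h2 => by simp

theorem dot_eq_sum {x y : BinTree} {n : ℕ} (hx : x.toList.length = n) (hy : y.toList.length = n) :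
    dot x y = ∑ j : Fin n, (x.arg j).intVal * (y.arg j).intVal := by
  rw [dot, zipWith_node_toList hx hy, List.map_ofFn, List.sum_ofFn]
  rfl

@[simp] theorem arg_ofList_ofFn {n : ℕ} (g : Fin n → BinTree) (j : Fin n) :
    (ofList (List.ofFn g)).arg j = g j := by
  rw [arg_eq_getD]
  simp

theorem length_toList_ofFn {n : ℕ} (g : Fin n → BinTree) :
    (ofList (List.ofFn g)).toList.length = n := by
  simp

end BinTree

/-! ### Separable quadratic functions -/

section separableQuadratic

variable {t : ℕ} {α β γ : Fin t → ℚ}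

theorem convexOn_separableQuadratic (h : ∀ j, 0 ≤ α j) :
    ConvexOn ℝ Set.univ (separableQuadratic α β γ) := by
  refine ⟨convex_univ, fun x _ y _ a b ha hb hab => ?_⟩
  simp only [separableQuadratic, smul_eq_mul, Finset.mul_sum, ← Finset.sum_add_distrib]
  refine Finset.sum_le_sum fun j _ => ?_
  have hj : (0 : ℝ) ≤ α j := by exact_mod_cast h j
  obtain rfl : b = 1 - a := by linarith
  -- This is the gap in the convexity inequality of coordinate `j`; the linear and constant terms
  -- cancel.
  have : 0 ≤ (α j : ℝ) * (a * (1 - a) * (x j - y j) ^ 2) := by positivity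
  simp only [Pi.add_apply, Pi.smul_apply, smul_eq_mul]
  nlinarith

theorem separableQuadratic_single (j : Fin t) (z : ℝ) : separableQuadratic α β γ (Pi.single j z) =
    α j * z ^ 2 + β j * z + ∑ i, (γ i : ℝ) := by
  simp only [separableQuadratic, Finset.sum_add_distrib]
  congr 2
  · rw [Finset.sum_eq_single j] <;> simp +contextual
  · rw [Finset.sum_eq_single j] <;> simp +contextual

theorem nonneg_of_convexOn_separableQuadratic
    (h : ConvexOn ℝ Set.univ (separableQuadratic α β γ)) (j : Fin t) : 0 ≤ α j := by
  -- At the midpoint `0` of the unit vector and its negative, convexity says `∑ i, γ i ≤ α j + ∑ i,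
  -- γ i`.
  have h1 := h.2 (Set.mem_univ (Pi.single j 1)) (Set.mem_univ (Pi.single j (-1)))
    (by norm_num : (0 : ℝ) ≤ 1 / 2) (by norm_num : (0 : ℝ) ≤ 1 / 2) (by norm_num)
  rw [← Pi.single_smul, ← Pi.single_smul, ← Pi.single_add] at h1
  simp only [separableQuadratic_single, smul_eq_mul] at h1
  have : (0 : ℝ) ≤ α j := by linarith
  exact_mod_cast this

/-- Since `2 * α j = P j + Q j` and `2 * β j = P j - Q j`, twice the objective function has integer
coefficients, and the verifier can evaluate it without rational arithmetic. -/
theorem two_mul_separableQuadratic {P Q : Fin t → ℤ} {G : ℤ} (hP : ∀ j, (P j : ℚ) = α j + β j)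
    (hQ : ∀ j, (Q j : ℚ) = α j - β j) (hG : (G : ℚ) = ∑ j, γ j) (x : Fin t → ℤ) :
    2 * separableQuadratic α β γ (fun j => (x j : ℝ)) =
      ((∑ j, ((P j + Q j) * (x j * x j) + (P j - Q j) * x j) + 2 * G : ℤ) : ℝ) := by
  have hG' : (G : ℝ) = ∑ j, (γ j : ℝ) := by exact_mod_cast congr_arg (Rat.cast : ℚ → ℝ) hG
  push_cast
  rw [separableQuadratic, Finset.sum_add_distrib, ← hG', mul_add, Finset.mul_sum]
  refine congr_arg (· + _) (Finset.sum_congr rfl fun j _ => ?_)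
  have h1 : (P j : ℝ) = α j + β j := by exact_mod_cast congr_arg (Rat.cast : ℚ → ℝ) (hP j)
  have h2 : (Q j : ℝ) = α j - β j := by exact_mod_cast congr_arg (Rat.cast : ℚ → ℝ) (hQ j)
  rw [h1, h2]
  ring

/-- Twice the function equals `∑ j, (P j * x j * (x j + 1) + Q j * x j * (x j - 1)) + 2 * G`, and
products of consecutive integers are even. -/
theorem exists_int_eq_separableQuadratic {P Q : Fin t → ℤ} {G : ℤ}
    (hP : ∀ j, (P j : ℚ) = α j + β j) (hQ : ∀ j, (Q j : ℚ) = α j - β j)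
    (hG : (G : ℚ) = ∑ j, γ j) (x : Fin t → ℤ) :
    ∃ z : ℤ, separableQuadratic α β γ (fun j => (x j : ℝ)) = z := by
  have h1 : Even (∑ j, ((P j + Q j) * (x j * x j) + (P j - Q j) * x j) + 2 * G) := by
    refine Even.add (Finset.even_sum _ fun j _ => ?_) (even_two_mul G)
    have h1 := Int.even_mul_succ_self (x j)
    have h2 := (Int.even_mul_succ_self (x j)).sub (even_two_mul (x j))
    have : (P j + Q j) * (x j * x j) + (P j - Q j) * x j =
      P j * (x j * (x j + 1)) + Q j * (x j * (x j + 1) - 2 * x j) := by ring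
    rw [this]
    exact (h1.mul_left _).add (h2.mul_left _)
  obtain ⟨z, hz⟩ := h1
  refine ⟨z, ?_⟩
  have h2 := two_mul_separableQuadratic hP hQ hG x
  rw [hz] at h2
  push_cast at h2
  linarith

/-- Evaluation at `0` gives `G`; subtracting `G` from the values at the unit vectors and their
negatives gives `P` and `Q`. Hence the finitely many conditions on coefficients that the verifier
checks are also necessary. -/
theorem exists_int_coefficients (h : ∀ x : Fin t → ℤ, ∃ z : ℤ,
    separableQuadratic α β γ (fun j => (x j : ℝ)) = z) :
    ∃ (P Q : Fin t → ℤ) (G : ℤ), (∀ j, (P j : ℚ) = α j + β j) ∧ (∀ j, (Q j : ℚ) = α j - β j) ∧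
      (G : ℚ) = ∑ j, γ j := by
  obtain ⟨G, hG⟩ := h 0
  replace hG : ∑ j, (γ j : ℝ) = G := by simpa [separableQuadratic] using hG
  have key : ∀ (c : ℤ) j, ∃ z : ℤ, (α j : ℝ) * c ^ 2 + β j * c = z := fun c j => by
    obtain ⟨z, hz⟩ := h (Pi.single j c)
    have : (fun i => ((Pi.single j c : Fin t → ℤ) i : ℝ)) = Pi.single j (c : ℝ) := by
      ext i
      by_cases hi : i = j
      · subst hi; simp
      · simp [hi]
    rw [this, separableQuadratic_single, hG] at hz
    exact ⟨z - G, by push_cast; linarith⟩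
  choose P hP using key 1
  choose Q hQ using key (-1)
  refine ⟨P, Q, G, fun j => ?_, fun j => ?_, ?_⟩
  · have := hP j
    have : ((P j : ℚ) : ℝ) = ((α j + β j : ℚ) : ℝ) := by push_cast at *; linarith
    exact_mod_cast this
  · have := hQ j
    have : ((Q j : ℚ) : ℝ) = ((α j - β j : ℚ) : ℝ) := by push_cast at *; linarith
    exact_mod_cast this
  · have : ((G : ℚ) : ℝ) = ((∑ j, γ j : ℚ) : ℝ) := by push_cast; exact hG.symm
    exact_mod_cast this

end separableQuadratic

/-! ### Trees that describe instances -/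

namespace BinTree

/-- Numerator and denominator of a rational number. -/
def IsRat (q : BinTree) (v : ℚ) : Prop :=
  (q.arg 0).intVal = v.num ∧ (q.arg 1).intVal = v.den

/-- The rational number with the given numerator and denominator. -/
def ratVal (q : BinTree) : ℚ := (q.arg 0).intVal / (q.arg 1).intVal

theorem RatCheck.isRat {q : BinTree} (h : RatCheck q) : IsRat q q.ratVal := by
  have hc : Nat.Coprime (q.arg 0).intVal.natAbs (q.arg 1).intVal.natAbs := by
    rw [← Int.isCoprime_iff_nat_coprime]
    exact ⟨(q.arg 2).intVal, (q.arg 3).intVal, by linarith [h.2]⟩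
  exact ⟨(Rat.num_div_eq_of_coprime h.1 hc).symm, (Rat.den_div_eq_of_coprime h.1 hc).symm⟩

/-- The tree `c` describes coordinate `j` of the blocks of type `i`. -/
structure IsCoord (I : QuadraticHugeNFoldIP) (i : Fin I.τ) (j : Fin I.t) (c : BinTree) : Prop where
  l : (c.arg 0).intVal = I.l i j
  u : (c.arg 1).intVal = I.u i j
  α : IsRat (c.arg 2) (I.α i j)
  β : IsRat (c.arg 3) (I.β i j)
  γ : IsRat (c.arg 4) (I.γ i j)
  P : ((c.arg 5).intVal : ℚ) = I.α i j + I.β i j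
  Q : ((c.arg 6).intVal : ℚ) = I.α i j - I.β i j

/-- The tree `y` describes block type `i`. -/
structure IsBlockType (I : QuadraticHugeNFoldIP) (i : Fin I.τ) (y : BinTree) : Prop where
  E₁_length : (y.arg 0).toList.length = I.r
  E₁_row : ∀ a : Fin I.r, ((y.arg 0).arg a).toList.length = I.t
  E₁ : ∀ (a : Fin I.r) (j : Fin I.t), (((y.arg 0).arg a).arg j).intVal = I.E₁ i a j
  E₂_length : (y.arg 1).toList.length = I.s
  E₂_row : ∀ a : Fin I.s, (((y.arg 1).arg a).arg 1).toList.length = I.t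
  E₂ : ∀ (a : Fin I.s) (j : Fin I.t), ((((y.arg 1).arg a).arg 1).arg j).intVal = I.E₂ i a j
  b : ∀ a : Fin I.s, (((y.arg 1).arg a).arg 0).intVal = I.b i a
  coord_length : (y.arg 2).toList.length = I.t
  coord : ∀ j : Fin I.t, IsCoord I i j ((y.arg 2).arg j)
  μ : (y.arg 3).intVal = I.μ i
  G : ((y.arg 4).intVal : ℚ) = ∑ j, I.γ i j

theorem flatMap_toList_eq {x : BinTree} {n : ℕ} (h : x.toList.length = n)
    (F : BinTree → List BinTree) :
    ((x.toList.flatMap F).map intVal) =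
      (List.ofFn fun j : Fin n => (F (x.arg j)).map intVal).flatten := by
  rw [toList_eq_ofFn h, List.map_flatMap, List.flatMap_def, List.map_ofFn]
  rfl

theorem map_intVal_toList {x : BinTree} {n : ℕ} (h : x.toList.length = n) :
    x.toList.map intVal = List.ofFn fun j : Fin n => (x.arg j).intVal := by
  rw [toList_eq_ofFn h, List.map_ofFn]
  rfl

theorem ratTokens_eq {n : ℕ} (v : Fin n → ℚ) : QuadraticHugeNFoldIP.ratTokens v =
    (List.ofFn fun j => [(v j).num, ((v j).den : ℤ)]).flatten := by
  rw [QuadraticHugeNFoldIP.ratTokens, List.flatMap_def, List.map_ofFn]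
  rfl

namespace IsBlockType

variable {I : QuadraticHugeNFoldIP} {i : Fin I.τ} {y v p : BinTree}

theorem map_intVal_certTypeTokens (h : IsBlockType I i y) :
    (certTypeTokens y).map intVal = I.typeTokens i := by
  have hm (n : ℕ) : ((y.arg 2).toList.map fun c => c.arg n).map intVal =
      List.ofFn fun j : Fin I.t => (((y.arg 2).arg j).arg n).intVal := by
    rw [toList_eq_ofFn h.coord_length, List.map_map, List.map_ofFn]; rfl
  have hb : ((y.arg 1).toList.map fun c => c.arg 0).map intVal =
      List.ofFn fun j : Fin I.s => (((y.arg 1).arg j).arg 0).intVal := by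
    rw [toList_eq_ofFn h.E₂_length, List.map_map, List.map_ofFn]; rfl
  simp only [certTypeTokens, QuadraticHugeNFoldIP.typeTokens, List.map_append,
    flatMap_toList_eq h.E₁_length, flatMap_toList_eq h.E₂_length, flatMap_toList_eq h.coord_length,
    map_intVal_toList (h.E₁_row _), map_intVal_toList (h.E₂_row _), hm, hb,
    QuadraticHugeNFoldIP.matrixTokens, ratTokens_eq, h.E₁, h.E₂, h.b, h.μ, (h.coord _).l,
    (h.coord _).u, List.map_cons, List.map_nil, (h.coord _).α.1, (h.coord _).α.2, (h.coord _).β.1,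
    (h.coord _).β.2, (h.coord _).γ.1, (h.coord _).γ.2]

theorem dot_E₁ (h : IsBlockType I i y) (hv : v.toList.length = I.t) (a : Fin I.r) :
    dot ((y.arg 0).arg a) v = ∑ j, I.E₁ i a j * (v.arg j).intVal := by
  rw [dot_eq_sum (h.E₁_row a) hv]
  simp only [h.E₁]

theorem brickValue_eq (h : IsBlockType I i y) (hv : v.toList.length = I.t) :
    brickValue y v = 2 * I.value i fun j => (v.arg j).intVal := by
  have h1 := two_mul_separableQuadratic (fun j => (h.coord j).P) (fun j => (h.coord j).Q) h.G
    fun j => (v.arg j).intVal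
  rw [← QuadraticHugeNFoldIP.f, QuadraticHugeNFoldIP.f_eq_value] at h1
  rw [brickValue, zipWith_node_toList h.coord_length hv, List.map_ofFn, List.sum_ofFn]
  exact (by exact_mod_cast h1.symm)

theorem configCheck_iff (h : IsBlockType I i y) : ConfigCheck y p ↔ 0 ≤ (p.arg 0).intVal ∧
    (p.arg 1).toList.length = I.t ∧ I.IsConfiguration i fun j => ((p.arg 1).arg j).intVal := by
  rw [ConfigCheck, Nat.cast_inj, h.coord_length]
  refine and_congr_right fun _ => and_congr_right fun hv => ?_
  rw [zipWith_node_toList h.coord_length hv, List.forall_mem_ofFn_iff,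
    forall_mem_toList h.E₂_length, and_comm, QuadraticHugeNFoldIP.IsConfiguration]
  refine and_congr (forall_congr' fun a => ?_) (forall_congr' fun j => ?_)
  · rw [dot_eq_sum (h.E₂_row a) hv, h.b]
    simp only [h.E₂]
  · rw [fst_node, snd_node, (h.coord j).l, (h.coord j).u]

end IsBlockType

/-- The tree `c` describes an instance and the bound `k`. -/
structure IsInstance (I : QuadraticHugeNFoldIP) (k : ℤ) (c : BinTree) : Prop where
  k : (c.arg 0).intVal = k
  τ : (c.arg 1).intVal = I.τ
  r : (c.arg 2).intVal = I.r
  s : (c.arg 3).intVal = I.s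
  t : (c.arg 4).intVal = I.t
  b₀_length : (c.arg 5).toList.length = I.r
  b₀ : ∀ a : Fin I.r, ((c.arg 5).arg a).intVal = I.b₀ a
  blockType_length : (c.arg 6).toList.length = I.τ
  blockType : ∀ i : Fin I.τ, IsBlockType I i ((c.arg 6).arg i)

theorem IsInstance.map_intVal_certTokens {I : QuadraticHugeNFoldIP} {k : ℤ} {c : BinTree}
    (h : IsInstance I k c) : (certTokens c).map intVal = k :: I.tokens := by
  simp only [certTokens, QuadraticHugeNFoldIP.tokens, List.map_append,
    flatMap_toList_eq h.blockType_length, map_intVal_toList h.b₀_length, h.b₀,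
    (h.blockType _).map_intVal_certTypeTokens, List.map_cons, h.k, h.τ, h.r, h.s, h.t,
    List.cons_append, List.nil_append]

end BinTree

/-! ### Soundness of the verifier -/

namespace BinTree

theorem CoordCheck.coefficients {y c : BinTree} (h : CoordCheck y c) :
    0 ≤ (c.arg 2).ratVal ∧
      ((c.arg 5).intVal : ℚ) = (c.arg 2).ratVal + (c.arg 3).ratVal ∧
      ((c.arg 6).intVal : ℚ) = (c.arg 2).ratVal - (c.arg 3).ratVal ∧
      ((c.arg 7).intVal : ℚ) = (c.arg 4).ratVal * (y.arg 5).intVal := by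
  obtain ⟨hα, hβ, hγ, h0, hP, hQ, hg⟩ := h
  have h1 : (0 : ℚ) < ((c.arg 2).arg 1).intVal := by exact_mod_cast hα.1
  have h2 : (0 : ℚ) < ((c.arg 3).arg 1).intVal := by exact_mod_cast hβ.1
  have h3 : (0 : ℚ) < ((c.arg 4).arg 1).intVal := by exact_mod_cast hγ.1
  have h0' : (0 : ℚ) ≤ ((c.arg 2).arg 0).intVal := by exact_mod_cast h0
  have hP' := congr_arg (Int.cast : ℤ → ℚ) hP
  have hQ' := congr_arg (Int.cast : ℤ → ℚ) hQ
  have hg' := congr_arg (Int.cast : ℤ → ℚ) hg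
  push_cast at hP' hQ' hg'
  refine ⟨div_nonneg h0' h1.le, ?_, ?_, ?_⟩ <;> unfold ratVal <;> field_simp <;> linarith

/-- The check compares the integers `γ j * D`, for a common denominator `D`, with `G * D`; dividing
by `D > 0` gives the claim. -/
theorem TypeCheck.sum_ratVal {c y : BinTree} (h : TypeCheck c y) {t : ℕ}
    (ht : (y.arg 2).toList.length = t) :
    ((y.arg 4).intVal : ℚ) = ∑ j : Fin t, (((y.arg 2).arg j).arg 4).ratVal := by
  obtain ⟨-, -, -, -, -, hc, hD, hG, -⟩ := h
  rw [sum_map_toList ht] at hG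
  have hD' : (0 : ℚ) < (y.arg 5).intVal := by exact_mod_cast hD
  have hG' := congr_arg (Int.cast : ℤ → ℚ) hG
  push_cast at hG'
  rw [Finset.sum_congr rfl fun j _ => (((forall_mem_toList ht).1 hc j).coefficients.2.2.2),
    ← Finset.sum_mul] at hG'
  exact (mul_right_cancel₀ hD'.ne' hG').symm

/-- The data are read off the certificate; the checks on coefficients provide the proofs of
convexity and integrality that an instance must contain. -/
theorem Accepts.exists_isInstance {w : List BinTree} {c : BinTree} (h : Accepts w c) :
    ∃ I, IsInstance I (c.arg 0).intVal c := by
  obtain ⟨-, -, hτ, hr, hs, ht, hT, -⟩ := h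
  obtain ⟨s, hs⟩ := Int.eq_ofNat_of_zero_le hs
  obtain ⟨t, ht⟩ := Int.eq_ofNat_of_zero_le ht
  rw [forall_mem_toList rfl] at hT
  have hl (i : Fin (c.arg 6).toList.length) : (((c.arg 6).arg i).arg 2).toList.length = t := by
    exact_mod_cast (hT i).2.2.2.2.1.trans ht
  have hc (i : Fin (c.arg 6).toList.length) (j : Fin t) :
      CoordCheck ((c.arg 6).arg i) ((((c.arg 6).arg i).arg 2).arg j) :=
    (forall_mem_toList (hl i)).1 (hT i).2.2.2.2.2.1 j
  -- The multiplicity of a type is not tested for its sign: it is the sum of the nonnegative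
  -- multiplicities of its configurations.
  have hμ (i : Fin (c.arg 6).toList.length) : 0 ≤ (((c.arg 6).arg i).arg 3).intVal := by
    have h1 := (hT i).2.2.2.2.2.2.2.2
    rw [← h1.1]
    refine List.sum_nonneg fun z hz => ?_
    obtain ⟨p, hp, rfl⟩ := List.mem_map.1 hz
    exact (h1.2 p hp).1
  refine ⟨{
    τ := (c.arg 6).toList.length
    r := (c.arg 5).toList.length
    s := s
    t := t
    E₁ := fun i a j => ((((c.arg 6).arg i).arg 0).arg a).arg j |>.intVal
    E₂ := fun i a j => (((((c.arg 6).arg i).arg 1).arg a).arg 1).arg j |>.intVal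
    l := fun i j => (((((c.arg 6).arg i).arg 2).arg j).arg 0).intVal
    u := fun i j => (((((c.arg 6).arg i).arg 2).arg j).arg 1).intVal
    b₀ := fun a => ((c.arg 5).arg a).intVal
    b := fun i a => (((((c.arg 6).arg i).arg 1).arg a).arg 0).intVal
    α := fun i j => (((((c.arg 6).arg i).arg 2).arg j).arg 2).ratVal
    β := fun i j => (((((c.arg 6).arg i).arg 2).arg j).arg 3).ratVal
    γ := fun i j => (((((c.arg 6).arg i).arg 2).arg j).arg 4).ratVal
    μ := fun i => (((c.arg 6).arg i).arg 3).intVal.toNat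
    convex := fun i => convexOn_separableQuadratic fun j => (hc i j).coefficients.1
    integral := fun i => exists_int_eq_separableQuadratic
      (fun j => (hc i j).coefficients.2.1) (fun j => (hc i j).coefficients.2.2.1)
      ((hT i).sum_ratVal (hl i)) }, rfl, hτ.symm, hr.symm, hs, ht, rfl, fun _ => rfl, rfl,
    fun i => ?_⟩
  obtain ⟨h1, h2, h3, h4, -⟩ := hT i
  rw [Nat.cast_inj] at h1
  have h3' : (((c.arg 6).arg i).arg 1).toList.length = s := by exact_mod_cast h3.trans hs
  refine ⟨h1, fun a => ?_, fun _ _ => rfl, h3', fun a => ?_, fun _ _ => rfl, fun _ => rfl, hl i,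
    fun j => ⟨rfl, rfl, (hc i j).1.isRat, (hc i j).2.1.isRat, (hc i j).2.2.1.isRat,
      (hc i j).coefficients.2.1, (hc i j).coefficients.2.2.1⟩, ?_, (hT i).sum_ratVal (hl i)⟩
  · exact_mod_cast ((forall_mem_toList h1).1 h2 a).trans ht
  · exact_mod_cast ((forall_mem_toList h3').1 h4 a).trans ht
  · exact (Int.toNat_of_nonneg (hμ i)).symm

theorem _root_.Multiset.card_filter_eq_sum {C ι : Type*} [DecidableEq ι] (S : Multiset C) (φ : C → ι) (i : ι) :
    (S.filter fun c => φ c = i).card = (S.map fun c => if φ c = i then 1 else 0).sum := by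
  induction S using Multiset.induction_on with
  | empty => simp
  | cons a T ih => by_cases h : φ a = i <;> simp [h, ih, add_comm]

theorem _root_.Multiset.exists_mem_of_mem_list_sum {C : Type*} {q : C} {l : List (Multiset C)} (h : q ∈ l.sum) :
    ∃ S ∈ l, q ∈ S := by
  induction l with
  | nil => simp at h
  | cons a l ih =>
    rw [List.sum_cons, Multiset.mem_add] at h
    rcases h with h | h
    · exact ⟨a, by simp, h⟩
    · obtain ⟨S, hS, hq⟩ := ih h
      exact ⟨S, by simp [hS], hq⟩

/-- The weighted configurations of the certificate form a multiset with the right number of members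
of each type, which `exists_bricks` expands to a solution. -/
theorem Accepts.mem_language {w : List Γ'} {c : BinTree}
    (h : Accepts (w.map fun a => symTree (some a)) c) : w ∈ quadraticHugeNFoldIPLanguage := by
  obtain ⟨I, hI⟩ := h.exists_isInstance
  obtain ⟨hcan, hw, -, -, -, -, hT, hlink, hobj⟩ := h
  rw [eq_of_map_natVal_eq hcan, hI.map_intVal_certTokens, List.flatMap_cons] at hw
  refine ⟨I, (c.arg 0).intVal, hw, ?_⟩
  rw [forall_mem_toList hI.blockType_length] at hT
  set L : Fin I.τ → List BinTree := fun i => (((c.arg 6).arg i).arg 6).toList with hL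
  set vec : BinTree → Fin I.t → ℤ := fun p j => ((p.arg 1).arg j).intVal with hvec
  have hconf : ∀ i, ∀ p ∈ L i, 0 ≤ (p.arg 0).intVal ∧ (p.arg 1).toList.length = I.t ∧
      I.IsConfiguration i (vec p) := fun i p hp =>
    ((hI.blockType i).configCheck_iff).1 ((hT i).2.2.2.2.2.2.2.2.2 p hp)
  -- `S` may be exponentially large, but it exists only in the proof; by `hSF` all sums over it are
  -- the weighted sums that the verifier computes.
  set S : Multiset (Fin I.τ × (Fin I.t → ℤ)) :=
    ∑ i, ((L i).map fun p => (p.arg 0).intVal.toNat • {(i, vec p)}).sum with hS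
  have hSF : ∀ F : Fin I.τ × (Fin I.t → ℤ) → ℤ, (S.map F).sum =
      ∑ i, ((L i).map fun p => (p.arg 0).intVal * F (i, vec p)).sum := by
    intro F
    let Φ : Multiset (Fin I.τ × (Fin I.t → ℤ)) →+ ℤ :=
      Multiset.sumAddMonoidHom.comp (Multiset.mapAddMonoidHom F)
    change Φ S = _
    rw [hS, map_sum]
    refine Finset.sum_congr rfl fun i _ => ?_
    rw [map_list_sum, List.map_map]
    refine congr_arg _ (List.map_congr_left fun p hp => ?_)
    have h0 := Int.toNat_of_nonneg (hconf i p hp).1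
    change Φ ((p.arg 0).intVal.toNat • {(i, vec p)}) = _
    rw [map_nsmul, nsmul_eq_mul]
    change (((p.arg 0).intVal.toNat : ℕ) : ℤ) * _ = _
    rw [h0]
    exact congr_arg _ (by simp [Φ])
  have hSmem : ∀ q ∈ S, I.IsConfiguration q.1 q.2 := by
    intro q hq
    obtain ⟨i, -, hq⟩ := Multiset.mem_sum.1 hq
    obtain ⟨_, hl, hq⟩ := Multiset.exists_mem_of_mem_list_sum hq
    obtain ⟨p, hp, rfl⟩ := List.mem_map.1 hl
    obtain rfl := Multiset.mem_singleton.1 (Multiset.mem_of_mem_nsmul hq)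
    exact (hconf i p hp).2.2
  obtain ⟨x, hx, hxF⟩ := I.exists_bricks S fun i => by
    have h1 := hSF fun q => if q.1 = i then 1 else 0
    rw [Finset.sum_eq_single i] at h1
    · rw [Multiset.card_filter_eq_sum]
      have h2 := (hT i).2.2.2.2.2.2.2.2.1
      rw [(hI.blockType i).μ] at h2
      have h3 : (S.map fun q => if q.1 = i then (1 : ℤ) else 0).sum = I.μ i := by
        rw [h1, ← h2]; simp [hL]
      zify
      rw [← h3, Multiset.map_map]
      congr 1
      refine Multiset.map_congr rfl fun q _ => ?_
      simp
    · intro j _ hj; simp [hj]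
    · simp
  refine ⟨x, (I.isFeasible_iff x).2 ⟨fun p => hSmem _ (hx p), fun a => ?_⟩, ?_⟩
  · rw [hxF fun q => ∑ j, I.E₁ q.1 a j * q.2 j, hSF, ← hI.b₀ a, ← hlink a (by
      rw [hI.b₀_length]; exact a.2), sum_map_toList hI.blockType_length]
    refine Finset.sum_congr rfl fun i _ => congr_arg _ (List.map_congr_left fun p hp => ?_)
    rw [(hI.blockType i).dot_E₁ (hconf i p hp).2.1]
  · rw [I.objective_eq]
    norm_cast
    rw [hxF fun q => I.value q.1 q.2, hSF]
    rw [sum_map_toList hI.blockType_length] at hobj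
    have h1 : ∑ i : Fin I.τ, (((((c.arg 6).arg i).arg 6)).toList.map fun p =>
        (p.arg 0).intVal * brickValue ((c.arg 6).arg i) (p.arg 1)).sum =
        2 * ∑ i, ((L i).map fun p => (p.arg 0).intVal * I.value i (vec p)).sum := by
      rw [Finset.mul_sum]
      refine Finset.sum_congr rfl fun i _ => ?_
      rw [← List.sum_map_mul_left]
      refine congr_arg _ (List.map_congr_left fun p hp => ?_)
      rw [(hI.blockType i).brickValue_eq (hconf i p hp).2.1]
      ring
    rw [h1] at hobj
    linarith

end BinTree

/-! ### Sizes of certificates -/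

theorem two_pow_length_encodePosNum_le (n : PosNum) :
    2 ^ (encodePosNum n).length ≤ 2 * (n : ℕ) := by
  induction n with
  | one => simp [encodePosNum]
  | bit1 n ih => simp only [encodePosNum, List.length_cons, pow_succ, PosNum.cast_bit1]; omega
  | bit0 n ih => simp only [encodePosNum, List.length_cons, pow_succ, PosNum.cast_bit0]; omega

theorem length_encodeNat_le {n B : ℕ} (h : n < 2 ^ B) : (encodeNat n).length ≤ B := by
  have h1 := Num.to_of_nat n
  unfold encodeNat
  cases hn : (n : Num) with
  | zero => simp [encodeNum]
  | pos p =>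
    rw [hn] at h1
    have h2 := two_pow_length_encodePosNum_le p
    rw [encodeNum]
    replace h1 : (p : ℕ) = n := by simpa using h1
    have h3 : 2 ^ (encodePosNum p).length < 2 ^ (B + 1) := by rw [pow_succ]; omega
    have := (Nat.pow_lt_pow_iff_right (by norm_num)).1 h3
    omega

namespace BinTree

theorem size_ofList_le {l : List BinTree} {N M : ℕ} (hl : l.length ≤ N)
    (h : ∀ a ∈ l, a.size ≤ M) : (ofList l).size ≤ N * (M + 1) + 1 := by
  rw [size_ofList, Nat.add_le_add_iff_right]
  refine (List.sum_le_card_nsmul _ (M + 1) fun n hn => ?_).trans ?_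
  · obtain ⟨a, ha, rfl⟩ := List.mem_map.1 hn
    exact Nat.add_le_add_right (h a ha) 1
  · rw [List.length_map, smul_eq_mul]
    exact Nat.mul_le_mul_right _ hl

theorem size_natTree_le {n B : ℕ} (h : n < 2 ^ B) : (natTree n).size ≤ 4 * B + 1 := by
  have h1 := length_encodeNat_le h
  refine (size_ofList_le (N := B) (M := 3) (by simpa using h1) fun a ha => ?_).trans (by omega)
  obtain ⟨b, -, rfl⟩ := List.mem_map.1 ha
  cases b <;> simp [bitTree, tt, size]

theorem size_intTree_le {z : ℤ} {B : ℕ} (h : |z| < 2 ^ B) : (intTree z).size ≤ 4 * B + 3 := by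
  rw [Int.abs_eq_natAbs] at h
  have h1 : z.natAbs < 2 ^ B := by exact_mod_cast h
  cases z with
  | ofNat n =>
    have := size_natTree_le (n := n) h1
    simp only [intTree, size]; omega
  | negSucc n =>
    have := size_natTree_le (n := n + 1) h1
    simp only [intTree, size]; omega

/-- `x` is a nested list of depth at most `d` of at most `N` entries each, which are
integers with at most `B` binary digits. -/
def IsSmall (N B : ℕ) : ℕ → BinTree → Prop
  | 0, x => ∃ z : ℤ, |z| < 2 ^ B ∧ x = intTree z
  | d + 1, x => IsSmall N B d x ∨ x.toList.length ≤ N ∧ ∀ a ∈ x.toList, IsSmall N B d a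

namespace IsSmall

variable {N B d d' : ℕ} {x : BinTree}

theorem mono (h : IsSmall N B d x) (hd : d ≤ d') : IsSmall N B d' x := by
  induction hd with
  | refl => exact h
  | step _ ih => exact Or.inl ih

theorem intTree {z : ℤ} (h : |z| < 2 ^ B) : IsSmall N B d (intTree z) :=
  mono (d := 0) ⟨z, h, rfl⟩ d.zero_le

theorem ofList {l : List BinTree} (hl : l.length ≤ N) (h : ∀ a ∈ l, IsSmall N B d a) :
    IsSmall N B (d + 1) (ofList l) :=
  Or.inr ⟨by simpa using hl, by simpa using h⟩

theorem ofFn {n : ℕ} {g : Fin n → BinTree} (hn : n ≤ N) (h : ∀ j, IsSmall N B d (g j)) :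
    IsSmall N B (d + 1) (BinTree.ofList (List.ofFn g)) :=
  .ofList (by simpa using hn) (List.forall_mem_ofFn_iff.2 h)

/-- `4 * B + 3` bounds an integer, and each level of nesting applies `M ↦ N * (M + 1) + 1`. As `1 ≤
N`, this map only enlarges its argument, which covers trees of smaller depth. -/
theorem size_le (hN : 1 ≤ N) (h : IsSmall N B d x) :
    x.size ≤ (fun M => N * (M + 1) + 1)^[d] (4 * B + 3) := by
  induction d generalizing x with
  | zero =>
    obtain ⟨z, hz, rfl⟩ := h
    exact size_intTree_le hz
  | succ d ih =>
    rw [Function.iterate_succ_apply']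
    rcases h with h | ⟨h1, h2⟩
    · have h1 := ih h
      have h2 := Nat.mul_le_mul_right ((fun M => N * (M + 1) + 1)^[d] (4 * B + 3) + 1) hN
      omega
    · rw [← ofList_toList x]
      exact size_ofList_le h1 fun a ha => ih (h2 a ha)

end IsSmall

/-! ### Completeness of the verifier -/

/-- Certificates need small Bézout coefficients: reducing the first one modulo the denominator
bounds it, and the identity then bounds the second. -/
theorem _root_.Rat.exists_bezout (q : ℚ) :
    ∃ a b : ℤ, q.num * a + q.den * b = 1 ∧ |a| ≤ q.den ∧ |b| ≤ |q.num| + 1 := by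
  have hd : (0 : ℤ) < q.den := by exact_mod_cast q.pos
  have hc : IsCoprime q.num q.den := by
    rw [Int.isCoprime_iff_nat_coprime]
    exact q.reduced
  obtain ⟨u, v, huv⟩ := hc
  have h1 : q.num * (u % q.den) + q.den * (v + q.num * (u / q.den)) = 1 := by
    have := Int.emod_add_mul_ediv u q.den
    linear_combination huv + q.num * this
  have h2 := Int.emod_nonneg u hd.ne'
  have h3 := Int.emod_lt_of_pos u hd
  refine ⟨_, _, h1, by rw [abs_of_nonneg h2]; exact h3.le, ?_⟩
  set b := v + q.num * (u / q.den)
  have h4 : (q.den : ℤ) * |b| ≤ q.den * (|q.num| + 1) := by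
    calc (q.den : ℤ) * |b| = |1 - q.num * (u % q.den)| := by
          rw [← abs_of_pos hd, ← abs_mul, abs_of_pos hd]
          congr 1; linarith
      _ ≤ |1| + |q.num * (u % q.den)| := abs_sub _ _
      _ = 1 + |q.num| * (u % q.den) := by rw [abs_one, abs_mul, abs_of_nonneg h2]
      _ ≤ q.den * 1 + |q.num| * q.den := by
          gcongr
          omega
      _ = q.den * (|q.num| + 1) := by ring
  exact le_of_mul_le_mul_left h4 hd

theorem exists_ratCheck (q : ℚ) {N B : ℕ} (hN : 8 ≤ N) (hnum : |q.num| + 1 < 2 ^ B)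
    (hden : (q.den : ℤ) < 2 ^ B) : ∃ x, RatCheck x ∧ IsRat x q ∧ IsSmall N B 1 x ∧
      IsCanonical (x.arg 0) ∧ IsCanonical (x.arg 1) := by
  obtain ⟨a, b, hab, ha, hb⟩ := q.exists_bezout
  refine ⟨ofList [intTree q.num, intTree q.den, intTree a, intTree b], ⟨?_, ?_⟩, ⟨?_, ?_⟩, ?_,
    by simp [ofList, arg, isCanonical_intTree], by simp [ofList, arg, isCanonical_intTree]⟩
  · simpa [ofList, arg] using q.pos
  · simpa [ofList, arg] using hab
  · simp [ofList, arg]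
  · simp [ofList, arg]
  · refine .ofList (by simp; omega) ?_
    simp only [List.mem_cons, List.not_mem_nil, or_false, forall_eq_or_imp, forall_eq]
    exact ⟨.intTree (by omega), .intTree (by simpa using hden), .intTree (by omega),
      .intTree (by omega)⟩

end BinTree

namespace BinTree

open QuadraticHugeNFoldIP

variable (I : QuadraticHugeNFoldIP) {N B : ℕ}

/-- The largest entry is `γ * D`, with `D` up to `2 ^ (L * L)` and the numerator of `γ` below `2 ^
L`; this dictates the bound on `B`. The bound `8 ≤ N` is the number of components of a coordinate.
-/
theorem exists_coordCheck (i : Fin I.τ) (j : Fin I.t) {P Q D : ℤ}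
    (hP : (P : ℚ) = I.α i j + I.β i j) (hQ : (Q : ℚ) = I.α i j - I.β i j)
    (hD : ((I.γ i j).den : ℤ) ∣ D) (hDB : |D| ≤ 2 ^ (I.encode.length * I.encode.length))
    (hN : 8 ≤ N) (hB : I.encode.length * I.encode.length + I.encode.length + 3 ≤ B) :
    ∃ c, (∀ y, (y.arg 5).intVal = D → CoordCheck y c) ∧ IsCoord I i j c ∧
      ((c.arg 7).intVal : ℚ) = I.γ i j * D ∧ IsSmall N B 2 c ∧
      (∀ n < 2, IsCanonical (c.arg n)) ∧
      ∀ n, 2 ≤ n → n < 5 → IsCanonical ((c.arg n).arg 0) ∧ IsCanonical ((c.arg n).arg 1) := by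
  set L := I.encode.length
  have hpow {z : ℤ} (n : ℕ) (hn : n ≤ B) (h : |z| < 2 ^ n) : |z| < 2 ^ B :=
    h.trans_le (pow_le_pow_right₀ (by norm_num) hn)
  have h1L : (1 : ℤ) ≤ 2 ^ L := one_le_pow₀ (by norm_num)
  have hpow' {z : ℤ} (h : z < 2 ^ L) : z + 1 < 2 ^ B := by
    refine lt_of_lt_of_le ?_ (pow_le_pow_right₀ (by norm_num) (show L + 1 ≤ B by omega))
    rw [pow_succ]; omega
  -- With `D = den * e`, the integer `γ * D` is the numerator times `e`.
  obtain ⟨e, rfl⟩ := hD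
  obtain ⟨α, hα, hα', hαs, hα0, hα1⟩ := exists_ratCheck (I.α i j) hN
    (hpow' (abs_α_lt (i := i) j).1) (by linarith [hpow' (abs_α_lt (i := i) j).2])
  obtain ⟨β, hβ, hβ', hβs, hβ0, hβ1⟩ := exists_ratCheck (I.β i j) hN
    (hpow' (abs_β_lt (i := i) j).1) (by linarith [hpow' (abs_β_lt (i := i) j).2])
  obtain ⟨γ, hγ, hγ', hγs, hγ0, hγ1⟩ := exists_ratCheck (I.γ i j) hN
    (hpow' (abs_γ_lt (i := i) j).1) (by linarith [hpow' (abs_γ_lt (i := i) j).2])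
  have eα := Rat.mul_den_eq_num (I.α i j)
  have eβ := Rat.mul_den_eq_num (I.β i j)
  have eγ := Rat.mul_den_eq_num (I.γ i j)
  have habs (q : ℚ) (hq : |q.num| < 2 ^ L) : |q| < 2 ^ L := by
    have h1 := Rat.abs_le_abs_num q
    have h2 : |q| ≤ |(q.num : ℚ)| := by exact_mod_cast h1
    refine h2.trans_lt ?_
    exact_mod_cast hq
  have haα := habs _ (abs_α_lt (i := i) j).1
  have haβ := habs _ (abs_β_lt (i := i) j).1
  have hbound {z : ℤ} (hz : |(z : ℚ)| < 2 ^ L + 2 ^ L) : |z| < 2 ^ B := by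
    refine hpow (L + 1) (by omega) ?_
    rw [pow_succ, mul_two]
    exact_mod_cast hz
  have hPs : |P| < 2 ^ B := hbound (by rw [hP]; exact (abs_add_le _ _).trans_lt (add_lt_add haα haβ))
  have hQs : |Q| < 2 ^ B := hbound (by rw [hQ]; exact (abs_sub _ _).trans_lt (add_lt_add haα haβ))
  have hgs : |(I.γ i j).num * e| < 2 ^ B := by
    refine hpow (L + L * L) (by omega) ?_
    rw [abs_mul, pow_add]
    have he : |e| ≤ 2 ^ (L * L) := by
      refine le_trans ?_ hDB
      rw [abs_mul, Nat.abs_cast]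
      have : (1 : ℤ) ≤ (I.γ i j).den := by exact_mod_cast (I.γ i j).pos
      exact le_mul_of_one_le_left (abs_nonneg _) this
    exact mul_lt_mul_of_lt_of_le_of_nonneg_of_pos (abs_γ_lt j).1 he (abs_nonneg _) (by positivity)
  refine ⟨ofList [intTree (I.l i j), intTree (I.u i j), α, β, γ, intTree P, intTree Q,
    intTree ((I.γ i j).num * e)], fun y hy => ?_, ?_, ?_, ?_, ?_, ?_⟩
  · refine ⟨by simpa [ofList, arg] using hα, by simpa [ofList, arg] using hβ,
      by simpa [ofList, arg] using hγ, ?_⟩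
    have hc := nonneg_of_convexOn_separableQuadratic (I.convex i) j
    rw [← Rat.num_nonneg] at hc
    have e0 := hα'.1
    have e1 := hα'.2
    have e2 := hβ'.1
    have e3 := hβ'.2
    have e4 := hγ'.1
    have e5 := hγ'.2
    simp only [arg] at e0 e1 e2 e3 e4 e5
    simp only [ofList, arg, fst_node, snd_node, intVal_intTree, e0, e1, e2, e3, e4, e5] at hy ⊢
    refine ⟨hc, ?_, ?_, ?_⟩
    · have : ((I.α i j).num * (I.β i j).den + (I.β i j).num * (I.α i j).den : ℚ) =
          P * ((I.α i j).den * (I.β i j).den) := by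
        rw [hP]
        linear_combination -((I.β i j).den : ℚ) * eα - (I.α i j).den * eβ
      exact_mod_cast this
    · have : ((I.α i j).num * (I.β i j).den - (I.β i j).num * (I.α i j).den : ℚ) =
          Q * ((I.α i j).den * (I.β i j).den) := by
        rw [hQ]
        linear_combination -((I.β i j).den : ℚ) * eα + (I.α i j).den * eβ
      exact_mod_cast this
    · rw [hy]; ring
  · refine ⟨?_, ?_, ?_, ?_, ?_, ?_, ?_⟩ <;> simp only [ofList, arg, fst_node, snd_node,
      intVal_intTree, hα', hβ', hγ', hP, hQ]
  · simp only [ofList, arg, fst_node, snd_node, intVal_intTree]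
    push_cast
    linear_combination -(e : ℚ) * eγ
  · refine .ofList (by simpa using hN) ?_
    simp only [List.mem_cons, List.not_mem_nil, or_false, forall_eq_or_imp, forall_eq]
    exact ⟨.intTree (hpow L (by omega) (abs_l_lt j)), .intTree (hpow L (by omega) (abs_u_lt j)),
      hαs, hβs, hγs, .intTree hPs, .intTree hQs, .intTree hgs⟩
  · intro n hn
    interval_cases n <;> simp [ofList, arg, isCanonical_intTree]
  · intro n hn hn'
    interval_cases n <;> [exact ⟨hα0, hα1⟩; exact ⟨hβ0, hβ1⟩; exact ⟨hγ0, hγ1⟩]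

/-- The bricks of type `i` are grouped by value: only the distinct values are listed, with their
frequencies, so the size depends on the number of configurations and not on `μ i`. The last clause
says that weighted sums over this list are sums over the bricks. -/
theorem exists_blockType (x : I.Brick × Fin I.t → ℤ) (hx : I.IsFeasible x) (i : Fin I.τ)
    (hN : 8 ≤ N) (hNL : I.encode.length ≤ N) (hxN : (I.usedConfigurations x).ncard ≤ N)
    (hB : I.encode.length * I.encode.length + I.encode.length + 3 ≤ B) :
    ∃ y, IsBlockType I i y ∧ IsSmall N B 4 y ∧ (∀ a ∈ certTypeTokens y, IsCanonical a) ∧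
      (∀ c : BinTree, (c.arg 5).toList.length = I.r → (c.arg 4).intVal = I.t →
        (c.arg 3).intVal = I.s → TypeCheck c y) ∧
      ∀ F : (Fin I.t → ℤ) → ℤ, ((y.arg 6).toList.map fun p =>
        (p.arg 0).intVal * F fun j => ((p.arg 1).arg j).intVal).sum =
          ∑ m, F fun j => x (⟨i, m⟩, j) := by
  classical
  set L := I.encode.length
  have hpow {z : ℤ} (n : ℕ) (hn : n ≤ B) (h : |z| < 2 ^ n) : |z| < 2 ^ B :=
    h.trans_le (pow_le_pow_right₀ (by norm_num) hn)
  have hpowL {z : ℤ} (h : |z| < 2 ^ L) : |z| < 2 ^ B := hpow L (by omega) h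
  obtain ⟨P, Q, G, hP, hQ, hG⟩ := exists_int_coefficients (I.integral i)
  -- The product of the denominators is a common denominator. It has at most `L` factors, each below
  -- `2 ^ L`.
  set D : ℤ := ∏ j, ((I.γ i j).den : ℤ) with hD
  have hD0 : 0 < D := Finset.prod_pos fun j _ => by exact_mod_cast (I.γ i j).pos
  have hDs : |D| ≤ 2 ^ (L * L) := by
    rw [abs_of_pos hD0]
    refine (Finset.prod_le_prod (fun j _ => by positivity) fun j _ =>
      (abs_γ_lt (i := i) j).2.le).trans ?_
    rw [Finset.prod_const, Finset.card_univ, Fintype.card_fin, ← pow_mul]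
    exact pow_le_pow_right₀ (by norm_num) (Nat.mul_le_mul_left _ (I.t_le i))
  have hGs : |G| < 2 ^ B := by
    have h1 : |(G : ℚ)| ≤ ∑ _j : Fin I.t, (2 : ℚ) ^ L := by
      rw [hG]
      refine (Finset.abs_sum_le_sum_abs _ _).trans (Finset.sum_le_sum fun j _ => ?_)
      have h1 : |I.γ i j| ≤ |((I.γ i j).num : ℚ)| := by
        exact_mod_cast Rat.abs_le_abs_num (I.γ i j)
      refine h1.trans ?_
      exact_mod_cast (abs_γ_lt j).1.le
    rw [Finset.sum_const, Finset.card_univ, Fintype.card_fin, nsmul_eq_mul] at h1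
    have h2 : |G| ≤ I.t * 2 ^ L := by exact_mod_cast h1
    have h3 : (I.t : ℤ) < 2 ^ L := by
      exact_mod_cast (I.t_le i).trans_lt Nat.lt_two_pow_self
    refine hpow (L + L) (by have := Nat.le_mul_self L; omega) (h2.trans_lt ?_)
    rw [pow_add]
    gcongr
  choose c hc1 hc2 hc3 hc4 hc5 hc6 using fun j => exists_coordCheck I i j (D := D) (hP j) (hQ j)
    (Finset.dvd_prod_of_mem (fun j => ((I.γ i j).den : ℤ)) (Finset.mem_univ j)) hDs hN hB
  set conf : Fin (I.μ i) → Fin I.t → ℤ := fun m j => x (⟨i, m⟩, j) with hconf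
  set V : Finset (Fin I.t → ℤ) := Finset.univ.image conf with hV
  set M : (Fin I.t → ℤ) → ℤ := fun v => ((Finset.univ.filter fun m => conf m = v).card : ℤ)
    with hM
  have hI := (I.isFeasible_iff x).1 hx
  have hVconf : ∀ v ∈ V, I.IsConfiguration i v := by
    intro v hv
    obtain ⟨m, -, rfl⟩ := Finset.mem_image.1 hv
    exact hI.1 ⟨i, m⟩
  have hVcard : V.card ≤ N := by
    refine le_trans ?_ hxN
    rw [← Set.ncard_coe_finset V]
    refine Set.ncard_le_ncard_of_injOn (fun v => (i, v)) ?_ (fun v _ v' _ h => (Prod.ext_iff.1 h).2)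
      (Set.finite_range _)
    intro v hv
    obtain ⟨m, -, rfl⟩ := Finset.mem_image.1 hv
    exact ⟨⟨i, m⟩, rfl⟩
  have hMs : ∀ v, |M v| < 2 ^ B := by
    intro v
    rw [hM, Nat.abs_cast]
    have h1 : (Finset.univ.filter fun m => conf m = v).card ≤ I.μ i := by
      simpa using Finset.card_le_univ (Finset.univ.filter fun m => conf m = v)
    have h2 := hpowL (z := I.μ i) (by rw [Nat.abs_cast]; exact μ_lt i)
    rw [Nat.abs_cast] at h2
    exact lt_of_le_of_lt (by exact_mod_cast h1) h2
  have hMsum : ∀ F : (Fin I.t → ℤ) → ℤ, ∑ v ∈ V, M v * F v = ∑ m, F (conf m) := by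
    intro F
    rw [hV, Finset.sum_comp F conf]
    simp [hM]
  have ht := (I.t_le i).trans hNL
  have hs := (I.s_le i).trans hNL
  have hr : I.r ≤ N := le_trans (by have := I.card_index_le; omega) hNL
  obtain ⟨y, hys, y0, y1, y2, y3, y4, y5, y6⟩ : ∃ y, IsSmall N B 4 y ∧
      y.arg 0 = ofList (List.ofFn fun a => ofList (List.ofFn fun j => intTree (I.E₁ i a j))) ∧
      y.arg 1 = ofList (List.ofFn fun a => ofList [intTree (I.b i a),
        ofList (List.ofFn fun j => intTree (I.E₂ i a j))]) ∧
      y.arg 2 = ofList (List.ofFn c) ∧ y.arg 3 = intTree (I.μ i) ∧ y.arg 4 = intTree G ∧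
      y.arg 5 = intTree D ∧
      y.arg 6 = ofList (V.toList.map fun v => ofList [intTree (M v),
        ofList (List.ofFn fun j => intTree (v j))]) := by
    refine ⟨ofList [_, _, _, _, _, _, _], ?_, rfl, rfl, rfl, rfl, rfl, rfl, rfl⟩
    refine .ofList (by simp; omega) ?_
    simp only [List.mem_cons, List.not_mem_nil, or_false, forall_eq_or_imp, forall_eq]
    refine ⟨.ofFn hr fun a => .ofFn ht fun j => .intTree (hpowL (abs_E₁_lt j a)),
      .ofFn hs fun a => .ofList (by simp; omega) ?_, .ofFn ht hc4,
      .intTree (hpowL (by rw [Nat.abs_cast]; exact μ_lt i)), .intTree hGs,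
      .intTree (hpow (L * L + 1) (by omega) (hDs.trans_lt (by gcongr <;> simp))),
      .ofList (by simpa using hVcard) ?_⟩
    · simp only [List.mem_cons, List.not_mem_nil, or_false, forall_eq_or_imp, forall_eq]
      exact ⟨.intTree (hpowL (abs_b_lt a)), .ofFn ht fun j => .intTree (hpowL (abs_E₂_lt j a))⟩
    · intro p hp
      obtain ⟨v, hv, rfl⟩ := List.mem_map.1 hp
      refine .ofList (by simp; omega) ?_
      simp only [List.mem_cons, List.not_mem_nil, or_false, forall_eq_or_imp, forall_eq]
      exact ⟨.intTree (hMs v), .ofFn ht fun j => .intTree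
        (hpowL ((hVconf v (Finset.mem_toList.1 hv)).abs_coord_lt j))⟩
  have hy : IsBlockType I i y := by
    refine ⟨?_, ?_, ?_, ?_, ?_, ?_, ?_, ?_, ?_, ?_, ?_⟩ <;>
      simp only [y0, y1, y2, y3, y4] <;> simp only [length_toList_ofFn, arg_ofList_ofFn, intVal_intTree,
        implies_true, hc2, hG, ofList, arg, fst_node, snd_node]
  refine ⟨y, hy, hys, ?_, fun c' h5 h4 h3 => ?_, fun F => ?_⟩
  · simp only [certTypeTokens, y0, y1, y2, y3, toList_ofList, List.forall_mem_append,
      List.forall_mem_flatMap, List.forall_mem_map, List.forall_mem_ofFn_iff, List.forall_mem_cons]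
    have hnil : ∀ a ∈ ([] : List BinTree), IsCanonical a := by simp
    have hn (n : ℕ) (h2 : 2 ≤ n) (h5 : n < 5) (j : Fin I.t) :=
      (⟨(hc6 j n h2 h5).1, (hc6 j n h2 h5).2, hnil⟩ : _ ∧ _ ∧ _)
    refine ⟨⟨⟨⟨⟨⟨⟨⟨fun _ _ => isCanonical_intTree _, fun a => ?_⟩, fun j => hc5 j 0 (by norm_num)⟩,
      fun j => hc5 j 1 (by norm_num)⟩, fun a => isCanonical_intTree _⟩, hn 2 le_rfl (by norm_num)⟩,
      hn 3 (by norm_num) (by norm_num)⟩, hn 4 (by norm_num) (by norm_num)⟩,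
      isCanonical_intTree _, hnil⟩
    simp [ofList, arg, isCanonical_intTree]
  · refine ⟨by rw [hy.E₁_length, h5], ?_, by rw [hy.E₂_length, h3], ?_,
      by rw [hy.coord_length, h4], ?_, by rwa [y5, intVal_intTree], ?_, ?_, ?_⟩
    · rw [forall_mem_toList hy.E₁_length]
      intro a; rw [hy.E₁_row, h4]
    · rw [forall_mem_toList hy.E₂_length]
      intro a; rw [hy.E₂_row, h4]
    · rw [forall_mem_toList hy.coord_length]
      intro j
      rw [y2, arg_ofList_ofFn]
      exact hc1 j y (by rw [y5, intVal_intTree])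
    · rw [sum_map_toList hy.coord_length]
      simp only [y2, arg_ofList_ofFn, y4, y5, intVal_intTree]
      have : ((∑ j, ((c j).arg 7).intVal : ℤ) : ℚ) = ((G * D : ℤ) : ℚ) := by
        push_cast
        simp only [hc3, hG, Finset.sum_mul]
      exact_mod_cast this
    · have := hMsum fun _ => 1
      simp only [mul_one, Finset.sum_const, Finset.card_univ, Fintype.card_fin, nsmul_eq_mul] at this
      rw [y6, toList_ofList, List.map_map, y3, intVal_intTree, ← this]
      simp [Function.comp_def, ofList, arg]
    · rw [y6, toList_ofList]
      intro p hp
      obtain ⟨v, hv, rfl⟩ := List.mem_map.1 hp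
      rw [hy.configCheck_iff]
      refine ⟨by simp [ofList, arg, hM], by simp [ofList, arg], ?_⟩
      simpa [ofList, arg] using hVconf v (Finset.mem_toList.1 hv)
  · rw [← hMsum F, y6, toList_ofList, List.map_map]
    simp [Function.comp_def, ofList, arg]

end BinTree

/-! ### Short certificates for all words of the language -/

namespace BinTree

open QuadraticHugeNFoldIP

/-- The depth is 6: rational numbers have depth 1, coordinates 2, lists of coordinates 3, block
types 4, the list of block types 5. -/
theorem exists_accepts (I : QuadraticHugeNFoldIP) (k : ℤ) (x : I.Brick × Fin I.t → ℤ)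
    (hx : I.IsFeasible x) (hk : I.objective x ≤ k) {N B : ℕ} (hN : 8 ≤ N)
    (hNL : I.encode.length ≤ N) (hxN : (I.usedConfigurations x).ncard ≤ N)
    (hB : I.encode.length * I.encode.length + I.encode.length + 3 ≤ B) (hkB : |k| < 2 ^ B) :
    ∃ c, Accepts ((encodeInteger k ++ I.encode).map fun a => symTree (some a)) c ∧
      IsSmall N B 6 c := by
  choose y hy hys hyc hyt hyF using fun i => exists_blockType I x hx i hN hNL hxN hB
  have hpow {z : ℤ} (hz : z ∈ I.tokens) : |z| < 2 ^ B :=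
    (I.abs_lt_of_mem_tokens hz).trans_le (pow_le_pow_right₀ (by norm_num) (by omega))
  have hτr := I.card_index_le
  obtain ⟨c, hcs, c0, c1, c2, c3, c4, c5, c6⟩ : ∃ c, IsSmall N B 6 c ∧
      c.arg 0 = intTree k ∧ c.arg 1 = intTree I.τ ∧ c.arg 2 = intTree I.r ∧
      c.arg 3 = intTree I.s ∧ c.arg 4 = intTree I.t ∧
      c.arg 5 = ofList (List.ofFn fun a => intTree (I.b₀ a)) ∧ c.arg 6 = ofList (List.ofFn y) := by
    refine ⟨ofList [_, _, _, _, _, _, _], ?_, rfl, rfl, rfl, rfl, rfl, rfl, rfl⟩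
    refine .ofList (by simp; omega) ?_
    simp only [List.mem_cons, List.not_mem_nil, or_false, forall_eq_or_imp, forall_eq]
    exact ⟨.intTree hkB, .intTree (hpow (z := I.τ) (by simp [tokens])),
      .intTree (hpow (z := I.r) (by simp [tokens])), .intTree (hpow (z := I.s) (by simp [tokens])),
      .intTree (hpow (z := I.t) (by simp [tokens])),
      .ofFn (by omega) fun a => .intTree (hpow (z := I.b₀ a) (by simp [tokens])),
      .ofFn (by omega) hys⟩
  have hI : IsInstance I k c := by
    refine ⟨?_, ?_, ?_, ?_, ?_, ?_, ?_, ?_, ?_⟩ <;>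
      simp only [c0, c1, c2, c3, c4, c5, c6] <;>
      simp only [length_toList_ofFn, arg_ofList_ofFn, intVal_intTree, implies_true, hy]
  have hlen (i : Fin I.τ) : ∀ p ∈ ((y i).arg 6).toList, (p.arg 1).toList.length = I.t := by
    have h1 := (hyt i c hI.b₀_length hI.t hI.s).2.2.2.2.2.2.2.2.2
    exact fun p hp => ((hy i).configCheck_iff.1 (h1 p hp)).2.1
  have hcan : ∀ a ∈ certTokens c, IsCanonical a := by
    simp only [certTokens, c0, c1, c2, c3, c4, c5, c6, toList_ofList, List.forall_mem_append,
      List.forall_mem_flatMap, List.forall_mem_ofFn_iff, List.forall_mem_cons]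
    refine ⟨⟨⟨isCanonical_intTree _, isCanonical_intTree _, isCanonical_intTree _,
      isCanonical_intTree _, isCanonical_intTree _, by simp⟩, fun _ => isCanonical_intTree _⟩, hyc⟩
  obtain ⟨-, hlink⟩ := (I.isFeasible_iff x).1 hx
  refine ⟨c, ⟨hcan, ?_, ?_, ?_, ?_, ?_, ?_, ?_, ?_⟩, hcs⟩
  · rw [eq_of_map_natVal_eq hcan, hI.map_intVal_certTokens]
    rfl
  · rw [hI.blockType_length, hI.τ]
  · rw [hI.b₀_length, hI.r]
  · rw [hI.s]; positivity
  · rw [hI.t]; positivity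
  · rw [forall_mem_toList hI.blockType_length]
    intro i
    rw [c6, arg_ofList_ofFn]
    exact hyt i c hI.b₀_length hI.t hI.s
  · intro a ha
    rw [hI.b₀_length] at ha
    have h1 := hI.b₀ ⟨a, ha⟩
    rw [sum_map_toList hI.blockType_length, h1, ← hlink, Fintype.sum_sigma]
    refine Finset.sum_congr rfl fun i _ => ?_
    rw [c6, arg_ofList_ofFn, ← hyF i fun v => ∑ j, I.E₁ i ⟨a, ha⟩ j * v j]
    refine congr_arg _ (List.map_congr_left fun p hp => ?_)
    rw [← (hy i).dot_E₁ (hlen i p hp)]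
  · rw [sum_map_toList hI.blockType_length, hI.k]
    rw [I.objective_eq] at hk
    norm_cast at hk
    refine le_trans (le_of_eq ?_) (mul_le_mul_of_nonneg_left hk zero_le_two)
    rw [Fintype.sum_sigma, Finset.mul_sum]
    refine Finset.sum_congr rfl fun i _ => ?_
    rw [c6, arg_ofList_ofFn, ← hyF i (I.value i), ← List.sum_map_mul_left]
    refine congr_arg _ (List.map_congr_left fun p hp => ?_)
    rw [(hy i).brickValue_eq (hlen i p hp)]
    ring

theorem exists_small_certificate : ∃ p : Polynomial ℕ, ∀ w ∈ quadraticHugeNFoldIPLanguage,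
    ∃ c : BinTree, c.size ≤ p.eval w.length ∧ Accepts (w.map fun a => symTree (some a)) c := by
  -- The size bound for depth 6, as a polynomial in the length `W` of the word, with `N = 8 * (W +
  -- 1) ^ 2` and `B = W * W + W + 3`. As `W` bounds the encoding length of the instance, `N` bounds
  -- the number of configurations after the reduction.
  refine ⟨(fun q => (8 * (Polynomial.X + 1) ^ 2) * (q + 1) + 1)^[6]
    (4 * (Polynomial.X * Polynomial.X + Polynomial.X + 3) + 3), fun w hw => ?_⟩
  obtain ⟨I, k, rfl, x, hx, hk⟩ := hw
  obtain ⟨x', hx', hobj, hcard⟩ := I.exists_few_configurations x hx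
  set W := (encodeInteger k ++ I.encode).length with hW
  have hLW : I.encode.length ≤ W := by simp [hW]
  have hkW : |k| < 2 ^ W := by
    refine (abs_lt_two_pow_of_mem_flatMap (l := [k]) (by simp)).trans_le
      (pow_le_pow_right₀ (by norm_num) (by simp [hW]))
  obtain ⟨c, hc, hcs⟩ := exists_accepts I k x' hx' (hobj.trans_le hk) (N := 8 * (W + 1) ^ 2)
    (B := W * W + W + 3) (by nlinarith) (by nlinarith) (hcard.trans (by gcongr)) (by gcongr)
    (hkW.trans_le (pow_le_pow_right₀ (by norm_num) (by omega)))
  refine ⟨c, (hcs.size_le (by nlinarith)).trans (le_of_eq ?_), hc⟩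
  simp [Function.iterate_succ]

end BinTree

/-! ### The decision version belongs to NP -/

namespace BinTree

/-- One step of the parser of a word and a certificate. The state consists of a flag that is set
after the separator, the reversed list of the symbols of the word, and the stack of a postfix
parser of the certificate. -/
def parseStep (s a : BinTree) : BinTree :=
  ifNil s.fst
    (ifNil a (node tt s.snd) (node nil (node (node a s.snd.fst) s.snd.snd)))
    (node tt (node s.snd.fst (ifNil a.fst (node nil s.snd.snd)
      (node (node s.snd.snd.snd.fst s.snd.snd.fst) s.snd.snd.snd.snd))))

def parse (x : BinTree) : BinTree :=
  x.toList.foldl parseStep (node nil (node nil nil))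

/-- The postfix serialization. -/
def postfixCode : BinTree → List Γ'
  | nil => [.bit false]
  | node l r => l.postfixCode ++ r.postfixCode ++ [.bit true]

theorem length_postfixCode (x : BinTree) : x.postfixCode.length = x.size := by
  induction x with
  | nil => rfl
  | node l r hl hr => simp [postfixCode, size, hl, hr, add_assoc]

/-- The symbol codes let the parser recognize symbols by shape: only the separator is `nil`, and
only `bit true` has an odd code, hence a nonzero lowest digit. After the separator every other
symbol counts as a leaf. -/
theorem symTree_none : symTree none = nil := by
  simp [symTree, symCode, natTree, encodeNat, encodeNum, ofList]

theorem symTree_bit_true : symTree (some (.bit true)) = node tt nil := by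
  simp [symTree, symCode, natTree, encodeNat]
  rfl

theorem symTree_bit_false : symTree (some (.bit false)) = node nil (node tt nil) := by
  simp [symTree, symCode, natTree, encodeNat]
  rfl

theorem symTree_some_ne_nil (a : Γ') : symTree (some a) ≠ nil := fun h => by
  have h1 := natVal_symTree (some a)
  rw [h] at h1
  rcases a with _ | (_ | _) | _ | _ | _ <;> simp [symCode] at h1

theorem foldl_parseStep_word (w : List Γ') (s : BinTree) :
    (w.map fun a => symTree (some a)).foldl parseStep (node nil (node s nil)) =
      node nil (node (revAppend (ofList (w.map fun a => symTree (some a))) s) nil) := by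
  induction w generalizing s with
  | nil => rfl
  | cons a w ih =>
    have h : parseStep (node nil (node s nil)) (symTree (some a)) =
        node nil (node (node (symTree (some a)) s) nil) := by
      cases ha : symTree (some a) with
      | nil => exact absurd ha (symTree_some_ne_nil a)
      | node l r => rfl
    rw [List.map_cons, List.foldl_cons, h, ih]
    rfl

/-- Postfix order lets a single left fold with a stack rebuild a tree: `r` is pushed after `l`, so
joining the second entry with the topmost one gives `node l r`. -/
theorem foldl_parseStep_postfixCode (x s t : BinTree) :
    (x.postfixCode.map fun a => symTree (some a)).foldl parseStep (node tt (node s t)) =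
      node tt (node s (node x t)) := by
  induction x generalizing t with
  | nil => simp [postfixCode, symTree_bit_false, parseStep, tt]
  | node l r hl hr =>
    simp only [postfixCode, List.map_append, List.foldl_append, hl, hr]
    simp [symTree_bit_true, parseStep, tt]

theorem parse_pairString (w y : List Γ') :
    parse (ofList ((pairString w y).map symTree)) =
      (y.map fun a => symTree (some a)).foldl parseStep
        (node tt (node (revAppend (ofList (w.map fun a => symTree (some a))) nil) nil)) := by
  have h := foldl_parseStep_word w nil
  simp only [parse, pairString, toList_ofList, List.map_append, List.map_cons, List.map_map,
    Function.comp_def, List.foldl_append, List.foldl_cons, symTree_none]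
  rw [h]
  rfl

/-- Nothing after the separator touches the stored word, so even a malformed certificate string is
judged against the true input. -/
theorem foldl_parseStep_fst (l : List BinTree) (s t : BinTree) :
    (l.foldl parseStep (node tt (node s t))).snd.fst = s := by
  induction l generalizing t with
  | nil => rfl
  | cons a l ih => exact ih _

end BinTree

/-! ### The parser takes polynomial time -/

namespace PolyComputable

open BinTree

theorem parse : PolyComputable BinTree.parse := by
  refine polyComputable_iff_polyTime.2 (PolyTime.foldl_of_size (F := fun _ => parseStep)
    (r := fun x => x.size + 20) PolyTime.id (.const _) ?_ (PolyBdd.size.add (.const 20))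
    fun x s a ha => ?_)
  · have ha := PolyTime.id.snd.fst
    have hs := PolyTime.id.snd.snd
    exact hs.fst.ifNil (ha.ifNil ((PolyTime.const tt).node hs.snd)
      ((PolyTime.const .nil).node ((ha.node hs.snd.fst).node hs.snd.snd)))
      ((PolyTime.const tt).node (hs.snd.fst.node (ha.fst.ifNil
        ((PolyTime.const .nil).node hs.snd.snd) ((hs.snd.snd.snd.fst.node hs.snd.snd.fst).node
          hs.snd.snd.snd.snd))))
  · have h := size_le_of_mem_toList ha
    rcases s with _ | ⟨_ | _, _ | ⟨_, _ | ⟨_, _ | _⟩⟩⟩ <;> rcases a with _ | ⟨_ | _, _⟩ <;>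
      simp [parseStep, tt, size] at * <;> omega

end PolyComputable

theorem quadraticHugeNFoldIPLanguage_inNP : InNP quadraticHugeNFoldIPLanguage := by
  classical
  -- The parser stores the word in reverse, and the certificate is the topmost tree on its stack.
  obtain ⟨f, hf, hf'⟩ := (PolyComputable.parse.snd.fst.toList.reverse).accepts
    PolyComputable.parse.snd.snd.fst
  obtain ⟨p, hp⟩ := BinTree.exists_small_certificate
  let cert (q : List Γ' × List Γ') : BinTree :=
    (BinTree.parse (BinTree.ofList ((pairString q.1 q.2).map symTree))).snd.snd.fst
  let V (q : List Γ' × List Γ') : Bool :=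
    decide (BinTree.Accepts (q.1.map fun a => symTree (some a)) (cert q))
  refine ⟨p, V, PolyTime.tm2ComputableInPolyTime _ symTree hf V fun q => ?_, fun w => ?_⟩
  · have h := hf' (BinTree.ofList ((pairString q.1 q.2).map symTree))
    simp only [TreeInterp.interp] at h
    rw [h, decide_eq_true_iff]
    have hw : (BinTree.parse (BinTree.ofList ((pairString q.1 q.2).map symTree))).snd.fst =
        BinTree.revAppend (BinTree.ofList (q.1.map fun a => symTree (some a))) .nil := by
      rw [BinTree.parse_pairString, BinTree.foldl_parseStep_fst]
    rw [hw]
    simp [cert]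
  · constructor
    · intro hw
      obtain ⟨c, hc, hacc⟩ := hp w hw
      -- The postfix code is exactly as long as the tree is large, so the same polynomial bounds the
      -- certificate string.
      refine ⟨c.postfixCode, by rwa [BinTree.length_postfixCode], decide_eq_true ?_⟩
      simpa [cert, BinTree.parse_pairString, BinTree.foldl_parseStep_postfixCode] using hacc
    · rintro ⟨y, -, hy⟩
      exact (of_decide_eq_true hy).mem_language

theorem mainTheorem7 :
    InNP quadraticHugeNFoldIPLanguage ∧
    ∃ p : Polynomial ℕ, ∀ I : QuadraticHugeNFoldIP, (∃ x, I.IsFeasible x) →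
      ∃ x, I.IsOptimal x ∧ (I.usedConfigurations x).ncard ≤ p.eval I.encode.length :=
  ⟨quadraticHugeNFoldIPLanguage_inNP, exists_polynomial_optimal_configurations⟩
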